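/- For $h>0$ let $\mathcal H(h)$ be the Dirichlet realization on $L^2((-\pi\sqrt2,0))$ of $-h^2\partial_x^2+V(x)$ with $V(x)=\dfrac{\pi^2}{4(x+\pi\sqrt2)^2}$, that is, the self-adjoint operator associated with the quadratic form $\psi\mapsto\int_{-\pi\sqrt2}^0\big(h^2|\psi'|^2+V|\psi|^2\big)\,dx$ on $\{\psi\in H^1_0((-\pi\sqrt2,0)) : \int V|\psi|^2\,dx<\infty\}$. All its eigenvalues are real and, repeated according to multiplicity, they form an infinite nondecreasing sequence $\lambda_1(h)\le\lambda_2(h)\le\cdots$. Let $\mathsf{Ai}$ be the Airy function, let $\mathsf A(x)=\mathsf{Ai}(-x)$; the real zeros of $\mathsf A$ form an infinite increasing sequence $z_{\mathsf A}(1)<z_{\mathsf A}(2)<\cdots$. Then for every $n\ge1$ there are real numbers $\hat\beta_{j,n}$, $j\ge0$, independent of $h$, with $$\hat\beta_{0,n}=\tfrac18,\qquad \hat\beta_{1,n}=(4\pi\sqrt2)^{-2/3}z_{\mathsf A}(n),$$ such that $\lambda_n(h)\sim\sum_{j\ge0}\hat\beta_{j,n}h^{2j/3}$ as $h\to0$,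 in the following sense: for every integer $J\ge0$ there are $C\in\mathbb R$ and $h_0>0$ (depending on $n$ and $J$) such that, for all $h\in(0,h_0)$, $$\Big|\lambda_n(h)-\sum_{j=0}^{J}\hat\beta_{j,n}h^{2j/3}\Big|\le C\,h^{2(J+1)/3}.$$ -/

import Mathlib

open MeasureTheory Set

noncomputable section

namespace BornOppenheimer

/-- The interval `(-π√2, 0)`. -/
def I : Set ℝ := Ioo (-(Real.pi * √2)) 0

/-- The Hilbert space `L²((-π√2, 0); ℂ)`. -/
abbrev L2 : Type := Lp ℂ 2 (volume.restrict I)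

/-- The potential `V(x) = π² / (4 (x + π√2)²)`. -/
def V (x : ℝ) : ℝ := Real.pi ^ 2 / (4 * (x + Real.pi * √2) ^ 2)

lemma measurable_V : Measurable V := by unfold V; fun_prop

lemma V_nonneg (x : ℝ) : 0 ≤ V x := by unfold V; positivity

lemma integrable_L2 (g : L2) : IntegrableOn g I :=
  have : IsFiniteMeasure (volume.restrict I) := ⟨by simp [I]⟩
  (Lp.memLp g).integrable (by norm_num)

lemma intervalIntegrable_L2 (g : L2) {x : ℝ} (hx : x ∈ Ioc (-(Real.pi * √2)) 0) :
    IntervalIntegrable g volume (-(Real.pi * √2)) x := by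
  rw [intervalIntegrable_iff_integrableOn_Ioo_of_le hx.1.le]
  exact (integrable_L2 g).mono_set fun t ht => ⟨ht.1, ht.2.trans_le hx.2⟩

lemma integral_congr_L2 {f g : ℝ → ℂ} (hfg : f =ᵐ[volume.restrict I] g) {x : ℝ}
    (hx : x ∈ Ioc (-(Real.pi * √2)) 0) :
    ∫ t in (-(Real.pi * √2))..x, f t = ∫ t in (-(Real.pi * √2))..x, g t := by
  rw [intervalIntegral.integral_of_le hx.1.le, intervalIntegral.integral_of_le hx.1.le,
    integral_Ioc_eq_integral_Ioo, integral_Ioc_eq_integral_Ioo]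
  exact integral_congr_ae (ae_restrict_of_ae_restrict_of_subset
    (fun t ht => (⟨ht.1, ht.2.trans_le hx.2⟩ : t ∈ I)) hfg)

lemma zero_mem : (0 : ℝ) ∈ Ioc (-(Real.pi * √2)) 0 :=
  ⟨by have := Real.pi_pos; simp; positivity, le_rfl⟩

/-- The Sobolev space `H¹₀((-π√2, 0))`, as the space of the pairs `(ψ, ψ')`: `ψ` is absolutely
continuous on `[-π√2, 0]`, with derivative `ψ' ∈ L²`, and vanishes at both end points. -/
def H10 : Submodule ℂ (L2 × L2) where
  carrier := {p | (∀ᵐ x ∂volume.restrict I, p.1 x = ∫ t in (-(Real.pi * √2))..x, p.2 t) ∧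
    ∫ t in (-(Real.pi * √2))..0, p.2 t = 0}
  zero_mem' := by
    have h0 : ∀ x ∈ Ioc (-(Real.pi * √2)) 0,
        ∫ t in (-(Real.pi * √2))..x, (0 : L2) t = 0 := fun x hx => by
      rw [integral_congr_L2 (Lp.coeFn_zero ℂ 2 (volume.restrict I)) hx]; simp
    refine ⟨?_, h0 0 zero_mem⟩
    filter_upwards [Lp.coeFn_zero ℂ 2 (volume.restrict I),
      ae_restrict_mem (measurableSet_Ioo : MeasurableSet I)] with x hx hxI
    exact hx.trans (h0 x ⟨hxI.1, hxI.2.le⟩).symm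
  add_mem' := by
    rintro p q ⟨hp, hp0⟩ ⟨hq, hq0⟩
    have hs : ∀ x ∈ Ioc (-(Real.pi * √2)) 0, ∫ t in (-(Real.pi * √2))..x, (p + q).2 t
        = (∫ t in (-(Real.pi * √2))..x, p.2 t) + ∫ t in (-(Real.pi * √2))..x, q.2 t := by
      intro x hx
      rw [← intervalIntegral.integral_add (intervalIntegrable_L2 _ hx)
        (intervalIntegrable_L2 _ hx)]
      exact integral_congr_L2 (Lp.coeFn_add p.2 q.2) hx
    refine ⟨?_, by rw [hs 0 zero_mem, hp0, hq0, add_zero]⟩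
    filter_upwards [hp, hq, Lp.coeFn_add p.1 q.1,
      ae_restrict_mem (measurableSet_Ioo : MeasurableSet I)] with x h1 h2 h3 hxI
    rw [hs x ⟨hxI.1, hxI.2.le⟩, ← h1, ← h2]
    exact h3
  smul_mem' := by
    rintro c p ⟨hp, hp0⟩
    have hs : ∀ x ∈ Ioc (-(Real.pi * √2)) 0, ∫ t in (-(Real.pi * √2))..x, (c • p).2 t
        = c • ∫ t in (-(Real.pi * √2))..x, p.2 t := by
      intro x hx
      rw [← intervalIntegral.integral_smul]
      exact integral_congr_L2 (Lp.coeFn_smul c p.2) hx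
    refine ⟨?_, by rw [hs 0 zero_mem, hp0, smul_zero]⟩
    filter_upwards [hp, Lp.coeFn_smul c p.1,
      ae_restrict_mem (measurableSet_Ioo : MeasurableSet I)] with x h1 h3 hxI
    rw [hs x ⟨hxI.1, hxI.2.le⟩, ← h1]
    exact h3

/-- `ψ ∈ L²` has finite potential energy: `V^{1/2} ψ ∈ L²`. -/
def FiniteEnergy (ψ : L2) : Prop :=
  MemLp (fun x => (√(V x) : ℂ) * ψ x) 2 (volume.restrict I)

/-- The domain of the quadratic form `h² ∫ |ψ'|² + ∫ V |ψ|²` with Dirichlet conditions: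
the pairs `(ψ, ψ')` in `H¹₀` with `∫ V |ψ|² < ∞`. -/
def formDomain : Submodule ℂ (L2 × L2) where
  carrier := {p | p ∈ H10 ∧ FiniteEnergy p.1}
  zero_mem' := by
    refine ⟨H10.zero_mem, (MemLp.zero' (ε := ℂ)).ae_eq ?_⟩
    filter_upwards [Lp.coeFn_zero ℂ 2 (volume.restrict I)] with x hx
    have h0 : ((0 : L2 × L2).1 : ℝ → ℂ) x = 0 := hx
    rw [h0, mul_zero]
  add_mem' := by
    rintro p q ⟨hp, hp'⟩ ⟨hq, hq'⟩
    refine ⟨H10.add_mem hp hq, (MemLp.add hp' hq').ae_eq ?_⟩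
    filter_upwards [Lp.coeFn_add p.1 q.1] with x hx
    have h1 : ((p + q).1 : ℝ → ℂ) x = p.1 x + q.1 x := hx
    rw [h1, mul_add]
    rfl
  smul_mem' := by
    rintro c p ⟨hp, hp'⟩
    refine ⟨H10.smul_mem c hp, (MemLp.const_smul hp' c).ae_eq ?_⟩
    filter_upwards [Lp.coeFn_smul c p.1] with x hx
    simp only [Pi.smul_apply, smul_eq_mul, Prod.smul_fst] at hx ⊢
    rw [hx]; ring

/-- The sesquilinear form `h² ∫ ψ' conj φ' + ∫ V ψ conj φ`, for `p = (ψ, ψ')`, `q = (φ, φ')`. -/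
def form (h : ℝ) (p q : L2 × L2) : ℂ :=
  (h : ℂ) ^ 2 * inner ℂ q.2 p.2 +
    ∫ x in I, (V x : ℂ) * p.1 x * (starRingEnd ℂ) (q.1 x)

lemma integrable_form {p q : L2 × L2} (hp : p ∈ formDomain) (hq : q ∈ formDomain) :
    Integrable (fun x => (V x : ℂ) * p.1 x * (starRingEnd ℂ) (q.1 x)) (volume.restrict I) := by
  have := MemLp.integrable_mul hp.2 hq.2.star
  refine this.congr (Filter.Eventually.of_forall fun x => ?_)
  have hV : ((√(V x) : ℝ) : ℂ) * ((√(V x) : ℝ) : ℂ) = (V x : ℂ) := by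
    rw [← Complex.ofReal_mul, Real.mul_self_sqrt (V_nonneg x)]
  simp only [Pi.mul_apply, Pi.star_apply, star_mul', RCLike.star_def, Complex.conj_ofReal]
  rw [← hV]; ring

lemma form_add (h : ℝ) {p p' q : L2 × L2} (hp : p ∈ formDomain) (hp' : p' ∈ formDomain)
    (hq : q ∈ formDomain) : form h (p + p') q = form h p q + form h p' q := by
  have : ∫ x in I, (V x : ℂ) * (p + p').1 x * (starRingEnd ℂ) (q.1 x) =
      (∫ x in I, (V x : ℂ) * p.1 x * (starRingEnd ℂ) (q.1 x)) +
      ∫ x in I, (V x : ℂ) * p'.1 x * (starRingEnd ℂ) (q.1 x) := by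
    rw [← integral_add (integrable_form hp hq) (integrable_form hp' hq)]
    refine integral_congr_ae ?_
    filter_upwards [Lp.coeFn_add p.1 p'.1] with x hx
    simp only [Prod.fst_add, hx, Pi.add_apply]; ring
  unfold form
  rw [this, Prod.snd_add, inner_add_right]; ring

lemma form_smul (h : ℝ) (c : ℂ) (p q : L2 × L2) : form h (c • p) q = c * form h p q := by
  have : ∫ x in I, (V x : ℂ) * (c • p).1 x * (starRingEnd ℂ) (q.1 x) =
      c * ∫ x in I, (V x : ℂ) * p.1 x * (starRingEnd ℂ) (q.1 x) := by
    rw [← integral_const_mul]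
    refine integral_congr_ae ?_
    filter_upwards [Lp.coeFn_smul c p.1] with x hx
    simp only [Prod.smul_fst, hx, Pi.smul_apply, smul_eq_mul]; ring
  unfold form
  rw [this, Prod.smul_snd, inner_smul_right]; ring

/-- The graph of the Dirichlet realization of `-h² ∂ₓ² + V` on `L²`, that is, of the operator
associated with the quadratic form: `ψ` is in the domain and is sent to `f` when `ψ` is in the
form domain and `h² ∫ ψ' conj φ' + ∫ V ψ conj φ = ∫ f conj φ` for all `φ` in the form domain. -/
def graph (h : ℝ) : Submodule ℂ (L2 × L2) where
  carrier := {r | ∃ g : L2, (r.1, g) ∈ formDomain ∧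
    ∀ q ∈ formDomain, form h (r.1, g) q = inner ℂ q.1 r.2}
  zero_mem' := by
    refine ⟨0, formDomain.zero_mem, fun q _ => ?_⟩
    have h0 := form_smul h 0 ((0 : L2), (0 : L2)) q
    rw [zero_smul, zero_mul] at h0
    exact h0.trans (inner_zero_right _).symm
  add_mem' := by
    rintro r s ⟨g, hg, H⟩ ⟨k, hk, K⟩
    refine ⟨g + k, formDomain.add_mem hg hk, fun q hq => ?_⟩
    rw [Prod.snd_add, inner_add_right, ← H q hq, ← K q hq, ← form_add h hg hk hq]
    rfl
  smul_mem' := by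
    rintro c r ⟨g, hg, H⟩
    refine ⟨c • g, formDomain.smul_mem c hg, fun q hq => ?_⟩
    rw [Prod.smul_snd, inner_smul_right, ← H q hq, ← form_smul]
    rfl

/-- A smooth function with compact support in the interval is in the form domain. -/
lemma testFunction_mem {u : ℝ → ℝ} (hu : ContDiff ℝ (⊤ : ℕ∞) u) (hc : HasCompactSupport u)
    (hs : tsupport u ⊆ I) :
    ∃ q ∈ formDomain, q.1 =ᵐ[volume.restrict I] fun x => (u x : ℂ) := by
  have : IsFiniteMeasure (volume.restrict I) := ⟨by simp [I]⟩
  have hd : Continuous (deriv u) := hu.continuous_deriv (by simp)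
  have m1 : MemLp (fun x => (u x : ℂ)) 2 (volume.restrict I) :=
    ((Complex.continuous_ofReal.comp hu.continuous).memLp_of_hasCompactSupport
      (hc.comp_left (g := Complex.ofReal) Complex.ofReal_zero)).restrict I
  have m2 : MemLp (fun x => ((deriv u x : ℝ) : ℂ)) 2 (volume.restrict I) :=
    ((Complex.continuous_ofReal.comp hd).memLp_of_hasCompactSupport
      (hc.deriv.comp_left (g := Complex.ofReal) Complex.ofReal_zero)).restrict I
  have za : u (-(Real.pi * √2)) = 0 :=
    image_eq_zero_of_notMem_tsupport fun h => lt_irrefl _ (hs h).1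
  have z0 : u 0 = 0 := image_eq_zero_of_notMem_tsupport fun h => lt_irrefl _ (hs h).2
  have ftc : ∀ x ∈ Ioc (-(Real.pi * √2)) 0,
      ∫ t in (-(Real.pi * √2))..x, (m2.toLp _ : L2) t = (u x : ℂ) := by
    intro x hx
    rw [integral_congr_L2 m2.coeFn_toLp hx, intervalIntegral.integral_ofReal,
      intervalIntegral.integral_deriv_eq_sub
        (fun t _ => (hu.differentiable (by simp)).differentiableAt)
        (hd.intervalIntegrable _ _), za, sub_zero]
  refine ⟨(m1.toLp _, m2.toLp _), ⟨⟨?_, ?_⟩, ?_⟩, m1.coeFn_toLp⟩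
  · filter_upwards [m1.coeFn_toLp,
      ae_restrict_mem (measurableSet_Ioo : MeasurableSet I)] with x hx hxI
    rw [ftc x ⟨hxI.1, hxI.2.le⟩]; exact hx
  · rw [ftc 0 zero_mem, z0, Complex.ofReal_zero]
  · have hVc : ContinuousOn (fun x => √(V x)) I := by
      refine ContinuousOn.sqrt ?_
      unfold V
      refine ContinuousOn.div (by fun_prop) (by fun_prop) fun x hx => ?_
      have : 0 < x + Real.pi * √2 := by linarith [hx.1]
      positivity
    have hcont : ContinuousOn (fun x => (√(V x) : ℂ) * (u x : ℂ)) (tsupport u) :=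
      ((Complex.continuous_ofReal.comp_continuousOn (hVc.mono hs))).mul
        (Complex.continuous_ofReal.comp hu.continuous).continuousOn
    obtain ⟨C, hC⟩ := hc.isCompact.exists_bound_of_continuousOn hcont
    refine MemLp.ae_eq (f := fun x => (√(V x) : ℂ) * (u x : ℂ)) ?_ (MemLp.of_bound ?_ (max C 0) ?_)
    · filter_upwards [m1.coeFn_toLp] with x hx
      rw [hx]
    · exact (Complex.measurable_ofReal.comp measurable_V.sqrt).aestronglyMeasurable.mul
        m1.aestronglyMeasurable
    · refine Filter.Eventually.of_forall fun x => ?_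
      by_cases hx : x ∈ tsupport u
      · exact (hC x hx).trans (le_max_left _ _)
      · simp [image_eq_zero_of_notMem_tsupport hx]

lemma graph_unique (h : ℝ) (r : L2 × L2) (hr : r ∈ graph h) (h0 : r.1 = 0) : r.2 = 0 := by
  obtain ⟨g, hg, H⟩ := hr
  rw [h0] at hg H
  have hform : ∀ q : L2 × L2, form h (0, g) q = (h : ℂ) ^ 2 * inner ℂ q.2 g := by
    intro q
    have : ∫ x in I, (V x : ℂ) * ((0 : L2), g).1 x * (starRingEnd ℂ) (q.1 x) = 0 := by
      refine integral_eq_zero_of_ae ?_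
      filter_upwards [Lp.coeFn_zero ℂ 2 (volume.restrict I)] with x hx
      have h0 : (((0 : L2), g).1 : ℝ → ℂ) x = 0 := hx
      rw [h0]
      simp
    unfold form
    rw [this, add_zero]
  have hz : (h : ℂ) ^ 2 = 0 ∨ g = 0 := by
    have := H (0, g) hg
    rw [hform, inner_zero_left] at this
    simpa using this
  have horth : ∀ q ∈ formDomain, inner ℂ q.1 r.2 = (0 : ℂ) := by
    intro q hq
    rw [← H q hq, hform]
    rcases hz with hz | hz <;> simp [hz]
  have hae := isOpen_Ioo.ae_eq_zero_of_integral_contDiff_smul_eq_zero (μ := volume) (U := I)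
    (f := r.2) (integrable_L2 r.2).locallyIntegrableOn fun u hu hc hs => by
      obtain ⟨q, hq, hqu⟩ := testFunction_mem hu hc hs
      rw [← setIntegral_eq_integral_of_forall_compl_eq_zero (s := I) fun x hx => by
        rw [image_eq_zero_of_notMem_tsupport fun h => hx (hs h), zero_smul]]
      rw [← horth q hq, L2.inner_def]
      refine integral_congr_ae ?_
      filter_upwards [hqu] with x hx
      rw [hx]
      simp [mul_comm]
  rw [Lp.eq_zero_iff_ae_eq_zero]
  exact (ae_restrict_iff' measurableSet_Ioo).2 hae

/-- The Dirichlet realization of `-h² ∂ₓ² + V` on `L²((-π√2, 0))`, an unbounded operator. -/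
def operator (h : ℝ) : L2 →ₗ.[ℂ] L2 := (graph h).toLinearPMap

lemma operator_graph (h : ℝ) : (operator h).graph = graph h :=
  Submodule.toLinearPMap_graph_eq _ (graph_unique h)

/-- The eigenspace of an unbounded operator `T` for `μ`: the `ψ` in the domain of `T` with
`T ψ = μ ψ`. -/
def eigenspace (T : L2 →ₗ.[ℂ] L2) (μ : ℂ) : Submodule ℂ T.domain :=
  LinearMap.ker (T.toFun - μ • T.domain.subtype)

/-- `lam 0 ≤ lam 1 ≤ …` is the list of all the eigenvalues of `T`, each one repeated according
to its multiplicity. -/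
def IsEigenvalueSequence (T : L2 →ₗ.[ℂ] L2) (lam : ℕ → ℝ) : Prop :=
  Monotone lam ∧
    ∀ μ : ℂ, {n : ℕ | (lam n : ℂ) = μ}.encard = Cardinal.toENat (Module.rank ℂ (eigenspace T μ))

/-- The Airy function, by its contour integral
`Ai(x) = (2πi)⁻¹ ∫ exp(t³/3 - x t) dt` along the vertical line `t = 1 + iτ`. The integral
converges absolutely and its value is real. -/
def airyAi (x : ℝ) : ℝ :=
  (2 * Real.pi)⁻¹ *
    (∫ τ : ℝ, Complex.exp ((1 + τ * Complex.I) ^ 3 / 3 - x * (1 + τ * Complex.I))).re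

/-- The reverse Airy function `A(x) = Ai(-x)`. -/
def airyA (x : ℝ) : ℝ := airyAi (-x)

/-- `z 0 < z 1 < …` is the list of all the zeros of the reverse Airy function. -/
def IsAiryZeroSequence (z : ℕ → ℝ) : Prop :=
  StrictMono z ∧ range z = {x : ℝ | airyA x = 0}

end BornOppenheimer

end

/-! An eigenfunction of the Dirichlet realization is, in the variable `y = κ (x + π√2)` with `κ = √λ
/ h`, a solution of the scaled Bessel equation `u'' = (s (s - 1) / y² - 1) u`, where `s = ν + 1 / 2`
and `ν² - 1 / 4 = π² / (4 h²)`. Vanishing at the singular end point singles out, up to a factor, the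
recessive solution `f_s(y) = y^s ∫ (1 - t²)^(s - 1) cos (y t) dt` (`besselF`), which is `√y J_ν(y)`
up to normalization. The Dirichlet condition at `x = 0` then says that `κ π√2` is a zero of `f_s`:
the eigenvalues are the numbers `(h ρ_n / (π√2))²`, for the positive zeros `ρ_n` of `f_s`, and they
are simple (`isEigenvalueSequence_operator`). Weak solutions are classical by du Bois-Reymond's
lemma (`IsWeakEigenpair.exists_ae_eq`); conversely, if `f_s(κ π√2) = 0`, Fubini's theorem shows that
the classical solution satisfies the weak equation (`exists_isWeakEigenpair`).

As `h → 0` the index `ν` tends to infinity, and `ρ_n` lies near the turning point `y = ν`. With `ν =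
2 / δ³` and `y = ν + w / δ`, Schläfli's contour integral for `J_ν`, which is another multiple of
`f_s / √y` because it gives a solution vanishing at the origin (`exists_schlafli_eq`), has in the
variable `t / δ` the phase `t³ / 3 + w t` plus a power series in `ε = δ²` without constant term.
Expanding the exponential of that series gives, uniformly for bounded `w`, an expansion of the
integral in powers of `ε` whose coefficients are polynomials times derivatives of the reverse Airy
function, and whose first term is that function itself (`schlafli_expansion`, `airyExpansion_zero`).

The zeros follow in two steps. Sign changes give a zero `w` near each zero of the reverse Airy
function; it is the only one, since zeros of solutions of `u'' = q u` cannot be close to each other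
when `q` is small (`IsSol.zero_unique`). There are no other zeros to the left, since the integral is
close to the reverse Airy function wherever this is not small, and `f_s²` is convex up to the
turning point (`lt_sq_of_besselF_eq_zero`). So the `n`-th zeros correspond
(`eventually_abs_zero_sub_lt`). Then the implicit function theorem, applied at each order to the
truncated expansion, yields `w = ψ(ε) + O(ε^(J + 1))` with `ψ` smooth (`exists_contDiffAt_zero`);
the zeros of the reverse Airy function are simple, as those of a nontrivial solution of a
second-order equation. Finally `ε` is a smooth function of `η = h^(2 / 3)`, the eigenvalue is a
polynomial in `η`, `ε` and `w`, and Taylor's formula gives a polynomial in `η` at each order.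
Asymptotic coefficients are unique, so that the polynomials for the different orders are truncations
of one series (`exists_coeff_of_forall_order`). -/

open Filter Topology

namespace BornOppenheimer

/-! ### Second-order linear equations on the line -/

/-- `u` solves `u'' = q u` on `S`, with derivative `u'`. -/
def IsSol (q : ℝ → ℝ) (S : Set ℝ) (u u' : ℝ → ℝ) : Prop :=
  ∀ x ∈ S, HasDerivAt u (u' x) x ∧ HasDerivAt u' (q x * u x) x

namespace IsSol

variable {q : ℝ → ℝ} {S T : Set ℝ} {u u' v v' : ℝ → ℝ}

lemma mono (h : IsSol q S u u') (hT : T ⊆ S) : IsSol q T u u' := fun x hx => h x (hT hx)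

lemma add (h : IsSol q S u u') (k : IsSol q S v v') :
    IsSol q S (fun x => u x + v x) (fun x => u' x + v' x) := fun x hx =>
  ⟨(h x hx).1.add (k x hx).1, ((h x hx).2.add (k x hx).2).congr_deriv (by ring)⟩

lemma const_mul (h : IsSol q S u u') (c : ℝ) :
    IsSol q S (fun x => c * u x) (fun x => c * u' x) := fun x hx =>
  ⟨(h x hx).1.const_mul c, ((h x hx).2.const_mul c).congr_deriv (by ring)⟩

lemma continuousOn (h : IsSol q S u u') : ContinuousOn u S := fun x hx =>
  (h x hx).1.continuousAt.continuousWithinAt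

lemma continuousOn' (h : IsSol q S u u') : ContinuousOn u' S := fun x hx =>
  (h x hx).2.continuousAt.continuousWithinAt

/-- A solution with vanishing Cauchy data at one point is zero. -/
lemma eq_zero_of_data (h : IsSol q S u u') (hS : S.OrdConnected) (hq : ContinuousOn q S)
    {p : ℝ} (hp : p ∈ S) (h0 : u p = 0) (h1 : u' p = 0) {x : ℝ} (hx : x ∈ S) : u x = 0 := by
  have hsub : uIcc p x ⊆ S := hS.uIcc_subset hp hx
  obtain ⟨M, hM⟩ := isCompact_uIcc.exists_bound_of_continuousOn (hq.mono hsub)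
  have hM0 : 0 ≤ M := (norm_nonneg _).trans (hM p left_mem_uIcc)
  have hlip : ∀ t ∈ uIcc p x, LipschitzOnWith (Real.toNNReal (max 1 M))
      (fun z : ℝ × ℝ => (z.2, q t * z.1)) univ := by
    intro t ht
    refine LipschitzOnWith.of_dist_le_mul fun y _ z _ => ?_
    rw [Real.coe_toNNReal _ (le_max_of_le_left zero_le_one), Prod.dist_eq, Prod.dist_eq]
    refine max_le ?_ ?_
    · calc dist y.2 z.2 ≤ 1 * max (dist y.1 z.1) (dist y.2 z.2) := by
            rw [one_mul]; exact le_max_right _ _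
        _ ≤ _ := by gcongr; exact le_max_left _ _
    · have : dist (q t * y.1) (q t * z.1) = |q t| * dist y.1 z.1 := by
        rw [Real.dist_eq, Real.dist_eq, ← abs_mul]; ring_nf
      simp only [this]
      gcongr
      · exact (hM t ht).trans (le_max_right _ _)
      · exact le_max_left _ _
  have hd : ∀ t ∈ uIcc p x, HasDerivAt (fun t => (u t, u' t)) (u' t, q t * u t) t :=
    fun t ht => (h t (hsub ht)).1.prodMk (h t (hsub ht)).2
  have hz : ∀ t : ℝ, HasDerivAt (fun _ : ℝ => ((0 : ℝ), (0 : ℝ))) ((0 : ℝ), q t * 0) t :=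
    fun t => (hasDerivAt_const t ((0 : ℝ), (0 : ℝ))).congr_deriv (by rw [mul_zero]; rfl)
  rcases le_total p x with hpx | hpx
  · rw [uIcc_of_le hpx] at hd hlip
    have := ODE_solution_unique_of_mem_Icc_right (s := fun _ => univ)
      (v := fun t (z : ℝ × ℝ) => (z.2, q t * z.1)) (f := fun t => (u t, u' t))
      (g := fun _ => ((0 : ℝ), (0 : ℝ))) (fun t ht => hlip t (Ico_subset_Icc_self ht))
      (fun t ht => (hd t ht).continuousAt.continuousWithinAt)
      (fun t ht => (hd t (Ico_subset_Icc_self ht)).hasDerivWithinAt) (fun _ _ => mem_univ _)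
      continuousOn_const (fun t _ => (hz t).hasDerivWithinAt) (fun _ _ => mem_univ _)
      (by simp [h0, h1]) (right_mem_Icc.2 hpx)
    exact (Prod.ext_iff.1 this).1
  · rw [uIcc_of_ge hpx] at hd hlip
    have := ODE_solution_unique_of_mem_Icc_left (s := fun _ => univ)
      (v := fun t (z : ℝ × ℝ) => (z.2, q t * z.1)) (f := fun t => (u t, u' t))
      (g := fun _ => ((0 : ℝ), (0 : ℝ))) (fun t ht => hlip t (Ioc_subset_Icc_self ht))
      (fun t ht => (hd t ht).continuousAt.continuousWithinAt)
      (fun t ht => (hd t (Ioc_subset_Icc_self ht)).hasDerivWithinAt) (fun _ _ => mem_univ _)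
      continuousOn_const (fun t _ => (hz t).hasDerivWithinAt) (fun _ _ => mem_univ _)
      (by simp [h0, h1]) (left_mem_Icc.2 hpx)
    exact (Prod.ext_iff.1 this).1

/-- A solution vanishing near a point is zero. -/
lemma eq_zero_of_eventually (h : IsSol q S u u') (hS : S.OrdConnected) (hq : ContinuousOn q S)
    {p : ℝ} (hp : p ∈ S) (h0 : ∀ᶠ y in 𝓝 p, u y = 0) {x : ℝ} (hx : x ∈ S) : u x = 0 :=
  h.eq_zero_of_data hS hq hp h0.self_of_nhds
    ((h p hp).1.unique ((hasDerivAt_const p (0 : ℝ)).congr_of_eventuallyEq h0)) hx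

/-- Where `q ≥ 0`, the function `u u'` is nondecreasing, that is, `u²` is convex. -/
lemma monotoneOn_mul (h : IsSol q S u u') (hS : S.OrdConnected) (hq : ∀ x ∈ S, 0 ≤ q x) :
    MonotoneOn (fun x => u x * u' x) S := by
  refine monotoneOn_of_hasDerivWithinAt_nonneg (f' := fun x => u' x * u' x + u x * (q x * u x))
    hS.convex
    (h.continuousOn.mul h.continuousOn') (fun x hx => ?_) (fun x hx => ?_)
  · exact ((h x (interior_subset hx)).1.mul (h x (interior_subset hx)).2).hasDerivWithinAt
  · have := mul_nonneg (hq x (interior_subset hx)) (mul_self_nonneg (u x))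
    nlinarith [mul_self_nonneg (u' x)]

lemma sq_le_sq_right (h : IsSol q S u u') (hS : S.OrdConnected) (hq : ∀ x ∈ S, 0 ≤ q x)
    {p x : ℝ} (hp : p ∈ S) (hx : x ∈ S) (hpx : p ≤ x) (h0 : 0 ≤ u p * u' p) :
    u p ^ 2 ≤ u x ^ 2 := by
  have hsub : Icc p x ⊆ S := hS.out hp hx
  refine (monotoneOn_of_hasDerivWithinAt_nonneg (f := fun x => u x ^ 2)
    (f' := fun x => 2 * (u x * u' x)) (convex_Icc p x) ((h.mono hsub).continuousOn.pow 2)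
    (fun y hy => ?_) (fun y hy => ?_)) (left_mem_Icc.2 hpx) (right_mem_Icc.2 hpx) hpx
  · exact (((h y (hsub (interior_subset hy))).1.pow 2).congr_deriv (by simp; ring)).hasDerivWithinAt
  · have hy' := interior_subset hy
    have := h.monotoneOn_mul hS hq hp (hsub hy') hy'.1
    simp only at this
    linarith

lemma sq_le_sq_left (h : IsSol q S u u') (hS : S.OrdConnected) (hq : ∀ x ∈ S, 0 ≤ q x)
    {p x : ℝ} (hp : p ∈ S) (hx : x ∈ S) (hxp : x ≤ p) (h0 : u p * u' p ≤ 0) :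
    u p ^ 2 ≤ u x ^ 2 := by
  have hsub : Icc x p ⊆ S := hS.out hx hp
  refine (antitoneOn_of_hasDerivWithinAt_nonpos (f := fun x => u x ^ 2)
    (f' := fun x => 2 * (u x * u' x)) (convex_Icc x p) ((h.mono hsub).continuousOn.pow 2)
    (fun y hy => ?_) (fun y hy => ?_)) (left_mem_Icc.2 hxp) (right_mem_Icc.2 hxp) hxp
  · exact (((h y (hsub (interior_subset hy))).1.pow 2).congr_deriv (by simp; ring)).hasDerivWithinAt
  · have hy' := interior_subset hy
    have := h.monotoneOn_mul hS hq (hsub hy') hp hy'.2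
    simp only at this
    linarith

/-- Where `q ≥ 0`, a solution that vanishes at the right end of an interval and tends to `0` along
some filter of points moving off to the left is zero: `u²` is convex. -/
lemma eq_zero_of_tendsto (h : IsSol q S u u') (hS : S.OrdConnected) (hq : ∀ x ∈ S, 0 ≤ q x)
    {b : ℝ} (hb : b ∈ S) (hub : u b = 0) {l : Filter ℝ} [l.NeBot]
    (hl : ∀ p ∈ S, ∀ᶠ x in l, x ∈ S ∧ x ≤ p) (hu : Tendsto u l (𝓝 0))
    {p : ℝ} (hp : p ∈ S) (hpb : p ≤ b) : u p = 0 := by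
  rcases le_total 0 (u p * u' p) with h0 | h0
  · have := h.sq_le_sq_right hS hq hp hb hpb h0
    rw [hub] at this
    nlinarith [sq_nonneg (u p)]
  · have h1 : Tendsto (fun x => u x ^ 2) l (𝓝 0) := by simpa using hu.pow 2
    have h2 : u p ^ 2 ≤ 0 := ge_of_tendsto h1 ((hl p hp).mono fun x hx =>
      h.sq_le_sq_left hS hq hp hx.1 hx.2 h0)
    nlinarith [sq_nonneg (u p)]

/-- Sturm comparison with `sin (k (x - a))`: if `q ≤ -k²` on `[a, a + π / k]` then every solution
has a zero there. -/
lemma exists_zero (h : IsSol q S u u') {a k : ℝ} (hk : 0 < k)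
    (hS : Icc a (a + Real.pi / k) ⊆ S) (hq : ∀ x ∈ Icc a (a + Real.pi / k), q x ≤ -k ^ 2) :
    ∃ x ∈ Icc a (a + Real.pi / k), u x = 0 := by
  set b := a + Real.pi / k with hb
  have hab : a < b := by have := Real.pi_pos; rw [hb]; linarith [div_pos this hk]
  -- A positive solution `v` would make the Wronskian with the sine nonincreasing.
  have key : ∀ v v' : ℝ → ℝ, IsSol q (Icc a b) v v' → ¬ ∀ x ∈ Icc a b, 0 < v x := by
    intro v v' hv hpos
    have hsin : ∀ x, HasDerivAt (fun x => Real.sin (k * (x - a))) (k * Real.cos (k * (x - a))) x :=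
      fun x => ((((hasDerivAt_id x).sub_const a).const_mul k).sin).congr_deriv (by simp; ring)
    have hcos : ∀ x, HasDerivAt (fun x => Real.cos (k * (x - a))) (-k * Real.sin (k * (x - a))) x :=
      fun x => ((((hasDerivAt_id x).sub_const a).const_mul k).cos).congr_deriv (by simp; ring)
    have hW : ∀ x ∈ Icc a b, HasDerivAt
        (fun x => v' x * Real.sin (k * (x - a)) - k * (v x * Real.cos (k * (x - a))))
        ((q x + k ^ 2) * v x * Real.sin (k * (x - a))) x := fun x hx =>
      (((hv x hx).2.mul (hsin x)).sub (((hv x hx).1.mul (hcos x)).const_mul k)).congr_deriv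
        (by ring)
    have hanti := antitoneOn_of_hasDerivWithinAt_nonpos (convex_Icc a b)
      (fun x hx => (hW x hx).continuousAt.continuousWithinAt)
      (fun x hx => (hW x (interior_subset hx)).hasDerivWithinAt) (fun x hx => by
        have hx' := interior_subset hx
        have h1 := hq x hx'
        have h2 := hpos x hx'
        have h3 : 0 ≤ Real.sin (k * (x - a)) := by
          refine Real.sin_nonneg_of_nonneg_of_le_pi (by nlinarith [hx'.1]) ?_
          have : x - a ≤ Real.pi / k := by linarith [hx'.2]
          calc k * (x - a) ≤ k * (Real.pi / k) := by gcongr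
            _ = Real.pi := by field_simp
        have : (q x + k ^ 2) * v x ≤ 0 := mul_nonpos_of_nonpos_of_nonneg (by linarith) h2.le
        exact mul_nonpos_of_nonpos_of_nonneg this h3)
    have h1 := hanti (left_mem_Icc.2 hab.le) (right_mem_Icc.2 hab.le) hab.le
    have h2 : k * (b - a) = Real.pi := by rw [hb]; field_simp; ring
    simp only [h2, sub_self, mul_zero, Real.sin_zero, Real.cos_zero, Real.sin_pi, Real.cos_pi] at h1
    have h3 := hpos a (left_mem_Icc.2 hab.le)
    have h4 := hpos b (right_mem_Icc.2 hab.le)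
    nlinarith [mul_pos hk h3, mul_pos hk h4]
  by_contra! hne
  have hu := h.mono hS
  rcases lt_or_gt_of_ne (hne a (left_mem_Icc.2 hab.le)) with ha | ha
  · refine key _ _ (hu.const_mul (-1)) fun x hx => ?_
    by_contra! hx0
    obtain ⟨y, hy, hy0⟩ := (convex_Icc a b).isPreconnected.intermediate_value
      (left_mem_Icc.2 hab.le) hx hu.continuousOn (show (0 : ℝ) ∈ Icc (u a) (u x) from
        ⟨ha.le, by linarith⟩)
    exact hne y hy hy0
  · refine key _ _ hu fun x hx => ?_
    by_contra! hx0
    obtain ⟨y, hy, hy0⟩ := (convex_Icc a b).isPreconnected.intermediate_value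
      hx (left_mem_Icc.2 hab.le) hu.continuousOn (show (0 : ℝ) ∈ Icc (u x) (u a) from
        ⟨hx0, ha.le⟩)
    exact hne y hy hy0

/-- The zeros of a nontrivial solution are isolated. -/
lemma finite_zeros (h : IsSol q S u u') (hS : S.OrdConnected) (hq : ContinuousOn q S)
    (hu : ∃ x ∈ S, u x ≠ 0) {a b : ℝ} (hab : Icc a b ⊆ S) :
    {x ∈ Icc a b | u x = 0}.Finite := by
  by_contra hinf
  obtain ⟨p, hp, hacc⟩ := Set.Infinite.exists_accPt_of_subset_isCompact hinf
    (isCompact_Icc (a := a) (b := b)) (sep_subset _ _)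
  -- both `u` and `u'` vanish at an accumulation point of the zeros
  have hfreq : ∃ᶠ y in 𝓝[≠] p, u y = 0 :=
    (accPt_iff_frequently_nhdsNE.1 hacc).mono fun y hy => hy.2
  have hd := h p (hab hp)
  have h1 : u' p = 0 := by
    by_contra hne
    exact hfreq (hd.1.eventually_ne hne)
  have h0 : u p = 0 := by
    by_contra hne
    exact hfreq ((hd.1.continuousAt.eventually_ne hne).filter_mono nhdsWithin_le_nhds)
  obtain ⟨x, hx, hux⟩ := hu
  exact hux (h.eq_zero_of_data hS hq (hab hp) h0 h1 hx)

/-- If `|q| ≤ M` and `M d² < 1`, two distinct zeros of a nontrivial solution are at distance at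
least `d`. -/
lemma zero_unique (h : IsSol q S u u') (hS : S.OrdConnected) (hq : ContinuousOn q S)
    (hu : ∃ x ∈ S, u x ≠ 0) {a b d M : ℝ} (hab : Icc a b ⊆ S) (hM : ∀ x ∈ Icc a b, |q x| ≤ M)
    (hd : b - a ≤ d) (hMd : M * d ^ 2 < 1) (ha : u a = 0) (hb : u b = 0) : ¬ a < b := by
  intro hlt
  have hM0 : 0 ≤ M := (abs_nonneg _).trans (hM a (left_mem_Icc.2 hlt.le))
  -- Two mean value estimates from a critical point `c` bound the maximum of `|u|` by `M d²` times
  -- itself.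
  obtain ⟨p, hp, hpmax⟩ := isCompact_Icc.exists_isMaxOn (nonempty_Icc.2 hlt.le)
    (h.mono hab).continuousOn.abs
  obtain ⟨c, hc, hc0⟩ := exists_hasDerivAt_eq_zero hlt (h.mono hab).continuousOn (by rw [ha, hb])
    (fun x hx => (h x (hab (Ioo_subset_Icc_self hx))).1)
  have hc' := Ioo_subset_Icc_self hc
  have hdiff : ∀ y ∈ Icc a b, ∀ z ∈ Icc a b, |y - z| ≤ d := fun y hy z hz => by
    rw [abs_le]; constructor <;> linarith [hy.1, hy.2, hz.1, hz.2]
  have hu'le : ∀ y ∈ Icc a b, ‖u' y‖ ≤ M * |u p| * d := fun y hy => by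
    have := (convex_Icc a b).norm_image_sub_le_of_norm_hasDerivWithin_le
      (f := u') (C := M * |u p|) (fun x hx => (h x (hab hx)).2.hasDerivWithinAt) (fun x hx => by
        rw [norm_mul]
        exact mul_le_mul (hM x hx) (hpmax hx) (abs_nonneg _) hM0) hc' hy
    rw [hc0, sub_zero] at this
    exact this.trans (by
      have := hdiff y hy c hc'
      gcongr
      exact this)
  have hup : |u p| ≤ M * |u p| * d * d := by
    have := (convex_Icc a b).norm_image_sub_le_of_norm_hasDerivWithin_le
      (f := u) (C := M * |u p| * d) (fun x hx => (h x (hab hx)).1.hasDerivWithinAt) hu'le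
      (left_mem_Icc.2 hlt.le) hp
    rw [ha, sub_zero] at this
    refine this.trans ?_
    have h0 := (norm_nonneg _).trans (hu'le a (left_mem_Icc.2 hlt.le))
    have := hdiff p hp a (left_mem_Icc.2 hlt.le)
    gcongr
    exact this
  have hp0 : |u p| = 0 := by
    by_contra hne
    have : 0 < |u p| := lt_of_le_of_ne (abs_nonneg _) (Ne.symm hne)
    nlinarith
  have hall : ∀ y ∈ Icc a b, u y = 0 := fun y hy =>
    abs_eq_zero.1 (le_antisymm ((hpmax hy).trans hp0.le) (abs_nonneg _))
  obtain ⟨x, hx, hux⟩ := hu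
  exact hux (h.eq_zero_of_data hS hq (hab hc') (hall c hc') hc0 hx)

end IsSol

/-- An infinite set of positive numbers with finitely many elements below each bound is listed in
increasing order by a sequence. -/
lemma exists_strictMono_range {Z : Set ℝ} (hfin : ∀ R, {x ∈ Z | x ≤ R}.Finite)
    (hinf : ∀ R, ∃ x ∈ Z, R < x) : ∃ z : ℕ → ℝ, StrictMono z ∧ range z = Z := by
  -- the least element of `Z` above `R`
  have hnext : ∀ R, ∃ y ∈ Z, R < y ∧ ∀ x ∈ Z, R < x → y ≤ x := by
    intro R
    obtain ⟨x₀, hx₀, hR⟩ := hinf R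
    obtain ⟨y, hy, hmin⟩ := ((hfin x₀).subset (fun x hx => hx.1) :
      ({x | (x ∈ Z ∧ x ≤ x₀) ∧ R < x}).Finite).exists_minimalFor id _ ⟨x₀, ⟨hx₀, le_rfl⟩, hR⟩
    refine ⟨y, hy.1.1, hy.2, fun x hx hRx => ?_⟩
    by_contra! hlt
    have := hmin (j := x) ⟨⟨hx, hlt.le.trans hy.1.2⟩, hRx⟩ hlt.le
    exact absurd this (not_le.2 hlt)
  choose nx hnxZ hnxlt hnxmin using hnext
  -- a lower bound of `Z`
  obtain ⟨m, hm⟩ : ∃ m, ∀ x ∈ Z, m < x := by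
    obtain ⟨m, hm⟩ := (hfin 0).bddBelow
    refine ⟨min m 0 - 1, fun x hx => ?_⟩
    rcases le_total x 0 with h | h
    · have := hm ⟨hx, h⟩
      linarith [min_le_left m 0]
    · linarith [min_le_right m 0]
  let z : ℕ → ℝ := fun n => nx^[n + 1] m
  have hz : ∀ n, z (n + 1) = nx (z n) := fun n => Function.iterate_succ_apply' nx (n + 1) m
  have hmono : StrictMono z := strictMono_nat_of_lt_succ fun n => by rw [hz]; exact hnxlt _
  have hmem : ∀ n, z n ∈ Z := fun n => by
    simp only [z, Function.iterate_succ_apply']; exact hnxZ _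
  refine ⟨z, hmono, Subset.antisymm (range_subset_iff.2 hmem) fun x hx => ?_⟩
  by_contra hne
  have hlt : ∀ n, z n < x := fun n => by
    refine lt_of_le_of_ne ?_ fun h => hne ⟨n, h⟩
    induction n with
    | zero => exact hnxmin m x hx (hm x hx)
    | succ n ih =>
      rw [hz]
      exact hnxmin _ x hx (lt_of_le_of_ne ih fun h => hne ⟨n, h⟩)
  exact (infinite_range_of_injective hmono.injective) ((hfin x).subset
    (range_subset_iff.2 fun n => ⟨hmem n, (hlt n).le⟩))

noncomputable section

/-! ### The Airy function and its zeros -/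

lemma integrable_gaussianWeight {c : ℝ} (hc : 0 < c) (N : ℕ) :
    Integrable fun σ : ℝ => (1 + |σ|) ^ N * Real.exp (-c * σ ^ 2) := by
  have h : ∀ k : ℕ, Integrable fun σ : ℝ => |σ| ^ k * Real.exp (-c * σ ^ 2) := fun k => by
    have := (integrable_rpow_mul_exp_neg_mul_sq hc (s := k) (by
      have : (0 : ℝ) ≤ k := k.cast_nonneg
      linarith)).norm
    refine this.congr (Eventually.of_forall fun σ => ?_)
    simp [Real.abs_exp]
  have : (fun σ : ℝ => (1 + |σ|) ^ N * Real.exp (-c * σ ^ 2)) = fun σ =>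
      ∑ k ∈ Finset.range (N + 1), (N.choose k : ℝ) * (|σ| ^ k * Real.exp (-c * σ ^ 2)) := by
    funext σ
    rw [add_comm, add_pow, Finset.sum_mul]
    exact Finset.sum_congr rfl fun k _ => by rw [one_pow]; ring
  rw [this]
  exact integrable_finsetSum _ fun k _ => (h k).const_mul _

/-- The point `1 + iσ` of the vertical contour. -/
def vline (σ : ℝ) : ℂ := 1 + σ * Complex.I

lemma continuous_vline : Continuous vline := by unfold vline; fun_prop

lemma norm_vline_le (σ : ℝ) : ‖vline σ‖ ≤ 1 + |σ| := by
  refine (norm_add_le _ _).trans ?_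
  simp

lemma hasDerivAt_vline (σ : ℝ) : HasDerivAt vline Complex.I σ := by
  unfold vline
  simpa using ((Complex.ofRealCLM.hasDerivAt (x := σ)).mul_const Complex.I).const_add 1

/-- The integrand `exp (t³ / 3 + w t)` of the Airy integral at `t = 1 + iσ`. -/
def airyExp (w σ : ℝ) : ℂ := Complex.exp (vline σ ^ 3 / 3 + w * vline σ)

lemma norm_airyExp (w σ : ℝ) : ‖airyExp w σ‖ = Real.exp (1 / 3 - σ ^ 2 + w) := by
  rw [airyExp, Complex.norm_exp]
  congr 1
  have : vline σ ^ 3 / 3 + w * vline σ =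
      ((1 / 3 - σ ^ 2 + w : ℝ) : ℂ) + ((σ - σ ^ 3 / 3 + w * σ : ℝ) : ℂ) * Complex.I := by
    unfold vline
    have h3 : Complex.I ^ 3 = -Complex.I := by rw [pow_succ, Complex.I_sq]; ring
    push_cast
    linear_combination ((σ : ℂ) ^ 2 ) * Complex.I_sq + (σ : ℂ) ^ 3 / 3 * h3
  rw [this]
  simp only [Complex.add_re, Complex.mul_re, Complex.ofReal_re, Complex.ofReal_im, Complex.I_re,
    Complex.I_im]
  ring

lemma continuous_airyExp (w : ℝ) : Continuous (airyExp w) := by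
  have := continuous_vline
  unfold airyExp
  fun_prop

lemma norm_vline_pow_mul_airyExp_le (m : ℕ) {w W : ℝ} (hw : w ≤ W) (σ : ℝ) :
    ‖vline σ ^ m * airyExp w σ‖ ≤
      Real.exp (1 / 3 + W) * ((1 + |σ|) ^ m * Real.exp (-1 * σ ^ 2)) := by
  rw [norm_mul, norm_pow, norm_airyExp]
  calc ‖vline σ‖ ^ m * Real.exp (1 / 3 - σ ^ 2 + w)
      ≤ (1 + |σ|) ^ m * Real.exp (1 / 3 - σ ^ 2 + W) := by
        gcongr
        exact norm_vline_le σ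
    _ = _ := by
        rw [show 1 / 3 - σ ^ 2 + W = (1 / 3 + W) + (-1 * σ ^ 2) by ring, Real.exp_add]; ring

lemma integrable_vline_pow_mul_airyExp (m : ℕ) (w : ℝ) :
    Integrable fun σ => vline σ ^ m * airyExp w σ :=
  ((integrable_gaussianWeight one_pos m).const_mul (Real.exp (1 / 3 + w))).mono'
    ((continuous_vline.pow m).mul (continuous_airyExp w)).aestronglyMeasurable
    (Eventually.of_forall fun σ => norm_vline_pow_mul_airyExp_le m le_rfl σ)

/-- The Airy moments `∫ t^m exp (t³ / 3 + w t)` along `t = 1 + iσ`; up to the factor `2π`, the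
`m`-th derivative of the reverse Airy function. -/
def airyMoment (m : ℕ) (w : ℝ) : ℂ := ∫ σ : ℝ, vline σ ^ m * airyExp w σ

lemma hasDerivAt_airyMoment (m : ℕ) (w : ℝ) :
    HasDerivAt (airyMoment m) (airyMoment (m + 1) w) w := by
  refine (hasDerivAt_integral_of_dominated_loc_of_deriv_le (μ := volume)
    (F := fun w σ => vline σ ^ m * airyExp w σ)
    (F' := fun w σ => vline σ ^ (m + 1) * airyExp w σ)
    (bound := fun σ => Real.exp (1 / 3 + (w + 1)) * ((1 + |σ|) ^ (m + 1) * Real.exp (-1 * σ ^ 2)))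
    (Iio_mem_nhds (lt_add_one w))
    (Eventually.of_forall fun v => (integrable_vline_pow_mul_airyExp m v).aestronglyMeasurable)
    (integrable_vline_pow_mul_airyExp m w)
    (integrable_vline_pow_mul_airyExp (m + 1) w).aestronglyMeasurable
    (Eventually.of_forall fun σ v hv => norm_vline_pow_mul_airyExp_le (m + 1) (le_of_lt hv) σ)
    ((integrable_gaussianWeight one_pos (m + 1)).const_mul _)
    (Eventually.of_forall fun σ v _ => ?_)).2
  have h1 : HasDerivAt (fun v : ℝ => vline σ ^ 3 / 3 + (v : ℂ) * vline σ) (vline σ) v := by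
    simpa using ((Complex.ofRealCLM.hasDerivAt (x := v)).mul_const (vline σ)).const_add
      (vline σ ^ 3 / 3)
  exact (h1.cexp.const_mul (vline σ ^ m)).congr_deriv (by rw [airyExp]; ring)

/-- The Airy equation, by integration of `d/dt exp (t³ / 3 + w t)`. -/
lemma airyMoment_two (w : ℝ) : airyMoment 2 w = -w * airyMoment 0 w := by
  have hd : ∀ σ : ℝ, HasDerivAt (airyExp w)
      (Complex.I * (vline σ ^ 2 * airyExp w σ + w * (vline σ ^ 0 * airyExp w σ))) σ := fun σ => by
    have h1 := ((((hasDerivAt_vline σ).pow 3).div_const 3).add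
      ((hasDerivAt_vline σ).const_mul (w : ℂ))).cexp
    refine h1.congr_deriv ?_
    simp only [airyExp, Pi.pow_apply, Pi.add_apply]
    push_cast
    ring
  have i2 := integrable_vline_pow_mul_airyExp 2 w
  have i0 := (integrable_vline_pow_mul_airyExp 0 w).const_mul (w : ℂ)
  have h := integral_eq_zero_of_hasDerivAt_of_integrable hd ((i2.add i0).const_mul Complex.I)
    (by simpa using integrable_vline_pow_mul_airyExp 0 w)
  rw [integral_const_mul, integral_add i2 i0, integral_const_mul] at h
  have h' := (mul_eq_zero.1 h).resolve_left Complex.I_ne_zero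
  rw [airyMoment, airyMoment]
  linear_combination h'

lemma airyMoment_conj (w : ℝ) : (starRingEnd ℂ) (airyMoment 0 w) = airyMoment 0 w := by
  rw [airyMoment, ← integral_conj]
  rw [← integral_neg_eq_self]
  refine integral_congr_ae (Eventually.of_forall fun σ => ?_)
  simp [airyExp, vline, ← Complex.exp_conj, map_ofNat]

lemma airyA_eq (w : ℝ) : airyA w = (2 * Real.pi)⁻¹ * (airyMoment 0 w).re := by
  rw [airyA, airyAi, airyMoment]
  congr 3
  funext σ
  simp [airyExp, vline]

/-- The derivative of the reverse Airy function. -/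
def airyA' (w : ℝ) : ℝ := (2 * Real.pi)⁻¹ * (airyMoment 1 w).re

lemma hasDerivAt_re_airyMoment (m : ℕ) (w : ℝ) :
    HasDerivAt (fun w => (airyMoment m w).re) (airyMoment (m + 1) w).re w :=
  (Complex.reCLM.hasFDerivAt.comp_hasDerivAt w (hasDerivAt_airyMoment m w))

lemma isSol_airyA : IsSol (fun w => -w) univ airyA airyA' := fun w _ => by
  have h0 : airyA = fun w => (2 * Real.pi)⁻¹ * (airyMoment 0 w).re := funext airyA_eq
  refine ⟨h0 ▸ (hasDerivAt_re_airyMoment 0 w).const_mul _, ?_⟩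
  refine ((hasDerivAt_re_airyMoment 1 w).const_mul (2 * Real.pi)⁻¹).congr_deriv ?_
  rw [airyMoment_two, airyA_eq]
  have : (-(w : ℂ) * airyMoment 0 w).re = -w * (airyMoment 0 w).re := by
    rw [← Complex.ofReal_neg, Complex.re_ofReal_mul]
  rw [this]; ring

/-- The reverse Airy function is not identically zero, by Fourier inversion. -/
lemma exists_airyA_ne_zero : ∃ w, airyA w ≠ 0 := by
  by_contra! hA
  have h0 : ∀ w, airyMoment 0 w = 0 := fun w => by
    have h1 := hA w
    rw [airyA_eq] at h1
    have h2 : (airyMoment 0 w).re = 0 := (mul_eq_zero.1 h1).resolve_left (by positivity)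
    have h3 := congrArg Complex.im (airyMoment_conj w)
    rw [Complex.conj_im] at h3
    exact Complex.ext h2 (by simp; linarith)
  have hF : FourierTransform.fourier (airyExp 0) = 0 := by
    funext ξ
    rw [Real.fourier_real_eq_integral_exp_smul]
    have h1 := h0 (-2 * Real.pi * ξ)
    have h2 : ∀ σ : ℝ, vline σ ^ 0 * airyExp (-2 * Real.pi * ξ) σ =
        Complex.exp (-2 * Real.pi * ξ) *
          (Complex.exp (((-2 * Real.pi * σ * ξ : ℝ) : ℂ) * Complex.I) • airyExp 0 σ) := fun σ => by
      rw [airyExp, airyExp, pow_zero, one_mul, smul_eq_mul, ← Complex.exp_add, ← Complex.exp_add]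
      congr 1
      simp only [vline]
      push_cast
      ring
    rw [airyMoment, integral_congr_ae (Eventually.of_forall h2), integral_const_mul] at h1
    exact (mul_eq_zero.1 h1).resolve_left (Complex.exp_ne_zero _)
  have hi : Integrable (airyExp 0) := by simpa using integrable_vline_pow_mul_airyExp 0 0
  have hinv := (continuous_airyExp 0).fourierInv_fourier_eq hi
    (by rw [hF]; exact integrable_zero _ _ _)
  have : airyExp 0 0 = 0 := by
    rw [← hinv, hF]
    simp [Real.fourierInv_eq']
  exact Complex.exp_ne_zero _ this

lemma continuousOn_airy_coeff (S : Set ℝ) : ContinuousOn (fun w : ℝ => -w) S :=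
  continuous_neg.continuousOn

lemma airyA'_ne_zero {w : ℝ} (hw : airyA w = 0) : airyA' w ≠ 0 := fun h => by
  obtain ⟨v, hv⟩ := exists_airyA_ne_zero
  exact hv (isSol_airyA.eq_zero_of_data ordConnected_univ (continuousOn_airy_coeff _)
    (mem_univ w) hw h (mem_univ v))

lemma tendsto_airyA_atBot : Tendsto airyA atBot (𝓝 0) := by
  have hb : ∀ w, |airyA w| ≤ Real.exp w * ((2 * Real.pi)⁻¹ *
      ∫ σ : ℝ, Real.exp (1 / 3) * ((1 + |σ|) ^ 0 * Real.exp (-1 * σ ^ 2))) := fun w => by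
    rw [airyA_eq, abs_mul, abs_of_pos (a := (2 * Real.pi)⁻¹) (by positivity), ← mul_assoc,
      mul_comm (Real.exp w), mul_assoc]
    gcongr
    refine (Complex.abs_re_le_norm _).trans ?_
    rw [← integral_const_mul]
    refine norm_integral_le_of_norm_le
      (((integrable_gaussianWeight one_pos 0).const_mul _).const_mul _)
      (Eventually.of_forall fun σ => ?_)
    refine (norm_vline_pow_mul_airyExp_le 0 le_rfl σ).trans_eq ?_
    rw [Real.exp_add]; ring
  refine squeeze_zero_norm hb ?_
  simpa using Real.tendsto_exp_atBot.mul_const _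

/-- All the zeros of the reverse Airy function are positive: on a half-line `(-∞, w]` with `w ≤ 0`,
a solution that tends to `0` at `-∞` and vanishes at `w` is zero, by convexity of its square. -/
lemma airyA_zero_pos {w : ℝ} (hw : airyA w = 0) : 0 < w := by
  by_contra! hw0
  obtain ⟨v, hv⟩ := exists_airyA_ne_zero
  refine hv (isSol_airyA.eq_zero_of_eventually ordConnected_univ (continuousOn_airy_coeff _)
    (mem_univ (w - 1)) ?_ (mem_univ v))
  filter_upwards [Iio_mem_nhds (show w - 1 < w by linarith)] with p hp
  have hpw : p < w := hp
  refine (isSol_airyA.mono (subset_univ (Iic w))).eq_zero_of_tendsto ordConnected_Iic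
    (fun x hx => by have : x ≤ w := hx; linarith) (mem_Iic.2 le_rfl) hw (l := atBot)
    (fun y hy => ?_) tendsto_airyA_atBot hpw.le hpw.le
  filter_upwards [eventually_le_atBot y] with x hx using ⟨hx.trans hy, hx⟩

lemma exists_isAiryZeroSequence : ∃ z, IsAiryZeroSequence z := by
  refine exists_strictMono_range (fun R => ?_) (fun R => ?_)
  · refine (isSol_airyA.finite_zeros ordConnected_univ (continuousOn_airy_coeff _)
      (by simpa using exists_airyA_ne_zero) (subset_univ (Icc 0 R))).subset fun x hx => ?_
    exact ⟨⟨(airyA_zero_pos hx.1).le, hx.2⟩, hx.1⟩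
  · obtain ⟨x, hx, h0⟩ := isSol_airyA.exists_zero (a := max R 1 + 1) one_pos (subset_univ _)
      (fun x hx => by
        have := hx.1
        have := le_max_right R 1
        linarith)
    exact ⟨x, h0, by linarith [hx.1, le_max_left R 1]⟩

/-! ### The recessive solution of the scaled Bessel equation -/

/-- The coefficient of the scaled Bessel equation `u'' = (s (s - 1) / x² - 1) u`. -/
def besselCoeff (s x : ℝ) : ℝ := s * (s - 1) / x ^ 2 - 1

lemma continuousOn_besselCoeff (s : ℝ) {S : Set ℝ} (hS : S ⊆ Ioi 0) :
    ContinuousOn (besselCoeff s) S := by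
  unfold besselCoeff
  refine (continuousOn_const.div (by fun_prop) fun x hx => ?_).sub continuousOn_const
  exact pow_ne_zero 2 (ne_of_gt (hS hx))

lemma besselCoeff_nonneg {s x : ℝ} (hx : 0 < x) (h : x ^ 2 ≤ s * (s - 1)) :
    0 ≤ besselCoeff s x := by
  rw [besselCoeff, sub_nonneg, one_le_div (by positivity)]
  exact h

/-- Two solutions tending to `0` at the left end, where `q ≥ 0`, are proportional: the combination
vanishing at `y₀` is zero by convexity of its square. -/
lemma IsSol.eq_const_mul {q u u' v v' : ℝ → ℝ} {S : Set ℝ} (hu : IsSol q S u u')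
    (hv : IsSol q S v v') (hS : S.OrdConnected) (hq : ContinuousOn q S) {y₀ : ℝ} (hy₀ : 0 < y₀)
    (hyS : Ioc 0 y₀ ⊆ S) (hq0 : ∀ x ∈ Ioc 0 y₀, 0 ≤ q x) (hu0 : u y₀ ≠ 0)
    (hul : Tendsto u (𝓝[>] 0) (𝓝 0)) (hvl : Tendsto v (𝓝[>] 0) (𝓝 0)) {x : ℝ} (hx : x ∈ S) :
    v x = v y₀ / u y₀ * u x := by
  have hw := hv.add (hu.const_mul (-(v y₀ / u y₀)))
  have hz : v x + -(v y₀ / u y₀) * u x = 0 := by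
    refine hw.eq_zero_of_eventually hS hq (hyS ⟨half_pos hy₀, by linarith⟩) ?_ hx
    filter_upwards [Ioo_mem_nhds (half_pos hy₀) (half_lt_self hy₀)] with p hp
    refine (hw.mono hyS).eq_zero_of_tendsto ordConnected_Ioc hq0 (right_mem_Ioc.2 hy₀)
      (by field_simp; ring) (l := 𝓝[>] 0) (fun r hr => ?_) ?_ ⟨hp.1, hp.2.le⟩ hp.2.le
    · filter_upwards [Ioo_mem_nhdsGT hr.1] with t ht
      exact ⟨⟨ht.1, ht.2.le.trans hr.2⟩, ht.2.le⟩
    · simpa using hvl.add (hul.const_mul (-(v y₀ / u y₀)))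
  linarith

/-- The weight `(1 - t²)^(s - 1)` of the Poisson integral. -/
def poissonWeight (s t : ℝ) : ℝ := (1 - t ^ 2) ^ (s - 1)

/-- The Poisson integral `∫ (1 - t²)^(s - 1) cos (x t)` over `(-1, 1)`. -/
def poisson (s x : ℝ) : ℝ := ∫ t in (-1 : ℝ)..1, poissonWeight s t * Real.cos (x * t)

/-- The derivative of the Poisson integral. -/
def poisson' (s x : ℝ) : ℝ := ∫ t in (-1 : ℝ)..1, -(poissonWeight s t * t) * Real.sin (x * t)

lemma continuous_poissonWeight {s : ℝ} (hs : 1 < s) : Continuous (poissonWeight s) := by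
  unfold poissonWeight
  exact Continuous.rpow_const (by fun_prop) fun x => Or.inr (by linarith)

lemma poissonWeight_mem {s t : ℝ} (hs : 1 < s) (ht : |t| ≤ 1) :
    0 ≤ poissonWeight s t ∧ poissonWeight s t ≤ 1 := by
  have h1 : 0 ≤ 1 - t ^ 2 := by have := (sq_le_one_iff_abs_le_one t).2 ht; linarith
  exact ⟨Real.rpow_nonneg h1 _, Real.rpow_le_one h1 (by nlinarith [sq_nonneg t]) (by linarith)⟩

lemma abs_le_one_of_mem {t : ℝ} (ht : t ∈ uIoc (-1 : ℝ) 1) : |t| ≤ 1 := by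
  rw [uIoc_of_le (by norm_num)] at ht
  exact abs_le.2 ⟨ht.1.le, ht.2⟩

lemma hasDerivAt_integral_cos {g : ℝ → ℝ} (hg : Continuous g) (x : ℝ) :
    HasDerivAt (fun x => ∫ t in (-1 : ℝ)..1, g t * Real.cos (x * t))
      (∫ t in (-1 : ℝ)..1, -(g t * t) * Real.sin (x * t)) x := by
  refine (intervalIntegral.hasDerivAt_integral_of_dominated_loc_of_deriv_le
    (F' := fun x t => -(g t * t) * Real.sin (x * t)) (bound := fun t => |g t * t|) univ_mem
    (Eventually.of_forall fun x => by fun_prop) (Continuous.intervalIntegrable (by fun_prop) _ _)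
    (by fun_prop) (Eventually.of_forall fun t _ x _ => ?_)
    (Continuous.intervalIntegrable (by fun_prop) _ _)
    (Eventually.of_forall fun t _ x _ => ?_)).2
  · rw [norm_mul, norm_neg]
    exact mul_le_of_le_one_right (norm_nonneg _) (Real.abs_sin_le_one _)
  · exact ((((hasDerivAt_id x).mul_const t).cos).const_mul (g t)).congr_deriv (by simp; ring)

lemma hasDerivAt_integral_sin {g : ℝ → ℝ} (hg : Continuous g) (x : ℝ) :
    HasDerivAt (fun x => ∫ t in (-1 : ℝ)..1, g t * Real.sin (x * t))
      (∫ t in (-1 : ℝ)..1, (g t * t) * Real.cos (x * t)) x := by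
  refine (intervalIntegral.hasDerivAt_integral_of_dominated_loc_of_deriv_le
    (F' := fun x t => (g t * t) * Real.cos (x * t)) (bound := fun t => |g t * t|) univ_mem
    (Eventually.of_forall fun x => by fun_prop) (Continuous.intervalIntegrable (by fun_prop) _ _)
    (by fun_prop) (Eventually.of_forall fun t _ x _ => ?_)
    (Continuous.intervalIntegrable (by fun_prop) _ _)
    (Eventually.of_forall fun t _ x _ => ?_)).2
  · rw [norm_mul]
    exact mul_le_of_le_one_right (norm_nonneg _) (Real.abs_cos_le_one _)
  · exact ((((hasDerivAt_id x).mul_const t).sin).const_mul (g t)).congr_deriv (by simp; ring)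

lemma hasDerivAt_poisson {s : ℝ} (hs : 1 < s) (x : ℝ) :
    HasDerivAt (poisson s) (poisson' s x) x :=
  hasDerivAt_integral_cos (continuous_poissonWeight hs) x

/-- The Bessel equation for the Poisson integral, by integrating the derivative of
`(1 - t²)^s sin (x t)`. -/
lemma hasDerivAt_poisson' {s : ℝ} (hs : 1 < s) {x : ℝ} (hx : 0 < x) :
    HasDerivAt (poisson' s) (-poisson s x - 2 * s / x * poisson' s x) x := by
  have hc := continuous_poissonWeight hs
  refine (hasDerivAt_integral_sin (g := fun t => -(poissonWeight s t * t)) (by fun_prop) x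
    ).congr_deriv ?_
  have hd : ∀ t : ℝ, HasDerivAt (fun t => (1 - t ^ 2) ^ s * Real.sin (x * t))
      (x * ((1 - t ^ 2) ^ s * Real.cos (x * t)) +
        2 * s * (-(poissonWeight s t * t) * Real.sin (x * t))) t := fun t => by
    have h1 : HasDerivAt (fun t : ℝ => 1 - t ^ 2) (-(2 * t)) t := by
      simpa using (hasDerivAt_pow 2 t).const_sub 1
    have h2 := h1.rpow_const (p := s) (Or.inr hs.le)
    have h3 := ((hasDerivAt_id t).const_mul x).sin
    refine (h2.mul h3).congr_deriv ?_
    simp only [poissonWeight, id]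
    ring
  have hcs : Continuous fun t : ℝ => (1 - t ^ 2) ^ s :=
    Continuous.rpow_const (by fun_prop) fun x => Or.inr (by linarith)
  have hftc := intervalIntegral.integral_eq_sub_of_hasDerivAt (a := -1) (b := 1)
    (fun t _ => hd t) (Continuous.intervalIntegrable (by fun_prop) _ _)
  rw [intervalIntegral.integral_add (Continuous.intervalIntegrable (by fun_prop) _ _)
    (Continuous.intervalIntegrable (by fun_prop) _ _), intervalIntegral.integral_const_mul,
    intervalIntegral.integral_const_mul] at hftc
  have h0 : ((1 : ℝ) - 1 ^ 2) ^ s = 0 := by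
    rw [one_pow, sub_self, Real.zero_rpow (by linarith)]
  have h0' : ((1 : ℝ) - (-1) ^ 2) ^ s = 0 := by
    rw [neg_one_sq, sub_self, Real.zero_rpow (by linarith)]
  rw [h0, h0', zero_mul, zero_mul, sub_zero] at hftc
  have hsum : (∫ t in (-1 : ℝ)..1, (-(poissonWeight s t * t) * t) * Real.cos (x * t))
      = (∫ t in (-1 : ℝ)..1, (1 - t ^ 2) ^ s * Real.cos (x * t)) - poisson s x := by
    rw [poisson, ← intervalIntegral.integral_sub (Continuous.intervalIntegrable (by fun_prop) _ _)
      (Continuous.intervalIntegrable (by fun_prop) _ _)]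
    refine intervalIntegral.integral_congr fun t ht => ?_
    rw [uIcc_of_le (by norm_num)] at ht
    have h1 : (1 - t ^ 2) ^ s = poissonWeight s t * (1 - t ^ 2) := by
      have h2 : 0 ≤ 1 - t ^ 2 := by nlinarith [ht.1, ht.2]
      rw [poissonWeight]
      conv_lhs => rw [show s = s - 1 + 1 by ring]
      rw [Real.rpow_add_one' h2 (by linarith)]
    simp only [h1]
    ring
  rw [hsum]
  have : (∫ t in (-1 : ℝ)..1, (1 - t ^ 2) ^ s * Real.cos (x * t)) =
      -(2 * s) / x * poisson' s x := by
    rw [show -(2 * s) / x * poisson' s x = -(2 * s * poisson' s x) / x by ring,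
      eq_div_iff hx.ne', poisson']
    linarith
  rw [this]
  ring

lemma abs_poisson_le {s : ℝ} (hs : 1 < s) (x : ℝ) : |poisson s x| ≤ 2 := by
  have := intervalIntegral.norm_integral_le_of_norm_le_const (a := -1) (b := 1) (C := 1)
    (f := fun t => poissonWeight s t * Real.cos (x * t)) fun t ht => by
      obtain ⟨h1, h2⟩ := poissonWeight_mem hs (abs_le_one_of_mem ht)
      rw [norm_mul, Real.norm_eq_abs, abs_of_nonneg h1]
      exact mul_le_one₀ h2 (norm_nonneg _) (Real.abs_cos_le_one _)
  refine this.trans ?_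
  norm_num

lemma abs_poisson'_le {s : ℝ} (hs : 1 < s) (x : ℝ) : |poisson' s x| ≤ 2 := by
  have := intervalIntegral.norm_integral_le_of_norm_le_const (a := -1) (b := 1) (C := 1)
    (f := fun t => -(poissonWeight s t * t) * Real.sin (x * t)) fun t ht => by
      obtain ⟨h1, h2⟩ := poissonWeight_mem hs (abs_le_one_of_mem ht)
      rw [norm_mul, norm_neg, norm_mul, Real.norm_eq_abs, abs_of_nonneg h1]
      exact mul_le_one₀ (mul_le_one₀ h2 (norm_nonneg _) (abs_le_one_of_mem ht)) (norm_nonneg _)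
        (Real.abs_sin_le_one _)
  refine this.trans ?_
  norm_num

lemma poisson_pos {s : ℝ} (hs : 1 < s) {x : ℝ} (hx : 0 < x) (hx1 : x ≤ 1) : 0 < poisson s x := by
  have hc := continuous_poissonWeight hs
  refine intervalIntegral.intervalIntegral_pos_of_pos_on
    (Continuous.intervalIntegrable (by fun_prop) _ _) (fun t ht => ?_) (by norm_num)
  refine mul_pos (Real.rpow_pos_of_pos (by nlinarith [ht.1, ht.2]) _)
    (Real.cos_pos_of_mem_Ioo ?_)
  have := Real.pi_gt_three
  constructor <;> nlinarith [ht.1, ht.2]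

/-- The solution `x^s ∫ (1 - t²)^(s - 1) cos (x t)` of `u'' = (s (s - 1) / x² - 1) u` that vanishes
at `0`. -/
def besselF (s x : ℝ) : ℝ := x ^ s * poisson s x

/-- The derivative of `besselF`. -/
def besselF' (s x : ℝ) : ℝ := s * x ^ (s - 1) * poisson s x + x ^ s * poisson' s x

lemma isSol_besselF {s : ℝ} (hs : 1 < s) :
    IsSol (besselCoeff s) (Ioi 0) (besselF s) (besselF' s) := by
  intro x hx
  have hx0 : 0 < x := hx
  have h1 : HasDerivAt (fun x : ℝ => x ^ s) (s * x ^ (s - 1)) x :=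
    Real.hasDerivAt_rpow_const (Or.inl hx0.ne')
  have h2 : HasDerivAt (fun x : ℝ => x ^ (s - 1)) ((s - 1) * x ^ (s - 1 - 1)) x :=
    Real.hasDerivAt_rpow_const (Or.inl hx0.ne')
  refine ⟨h1.mul (hasDerivAt_poisson hs x), ?_⟩
  refine (((h2.const_mul s).mul (hasDerivAt_poisson hs x)).add
    (h1.mul (hasDerivAt_poisson' hs hx0))).congr_deriv ?_
  rw [besselF, besselCoeff, Real.rpow_sub_one hx0.ne' (s - 1), Real.rpow_sub_one hx0.ne' s]
  field_simp
  ring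

lemma abs_besselF_le {s : ℝ} (hs : 1 < s) {x : ℝ} (hx : 0 ≤ x) : |besselF s x| ≤ 2 * x ^ s := by
  rw [besselF, abs_mul, abs_of_nonneg (Real.rpow_nonneg hx _), mul_comm]
  have := abs_poisson_le hs x
  have := Real.rpow_nonneg hx s
  gcongr

lemma abs_besselF'_le {s : ℝ} (hs : 1 < s) {x : ℝ} (hx : 0 ≤ x) :
    |besselF' s x| ≤ 2 * (s + x) * x ^ (s - 1) := by
  have h1 := abs_poisson_le hs x
  have h2 := abs_poisson'_le hs x
  have h3 := Real.rpow_nonneg hx (s - 1)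
  have h4 : x ^ s = x * x ^ (s - 1) := by
    conv_lhs => rw [show s = 1 + (s - 1) by ring]
    rw [Real.rpow_one_add' hx (by linarith)]
  rw [besselF', h4]
  refine (abs_add_le _ _).trans ?_
  rw [abs_mul, abs_mul, abs_mul, abs_mul, abs_of_nonneg h3, abs_of_nonneg hx,
    abs_of_nonneg (zero_le_one.trans hs.le)]
  calc s * x ^ (s - 1) * |poisson s x| + x * x ^ (s - 1) * |poisson' s x|
      ≤ s * x ^ (s - 1) * 2 + x * x ^ (s - 1) * 2 := by gcongr
    _ = _ := by ring

lemma continuous_besselF {s : ℝ} (hs : 1 < s) : Continuous (besselF s) := by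
  have : Continuous (poisson s) :=
    continuous_iff_continuousAt.2 fun x => (hasDerivAt_poisson hs x).continuousAt
  exact (Real.continuous_rpow_const (by linarith)).mul this

lemma besselF_zero {s : ℝ} (hs : 1 < s) : besselF s 0 = 0 := by
  rw [besselF, Real.zero_rpow (by linarith), zero_mul]

lemma besselF_pos {s : ℝ} (hs : 1 < s) {x : ℝ} (hx : 0 < x) (hx1 : x ≤ 1) : 0 < besselF s x :=
  mul_pos (Real.rpow_pos_of_pos hx _) (poisson_pos hs hx hx1)

lemma tendsto_besselF {s : ℝ} (hs : 1 < s) : Tendsto (besselF s) (𝓝[>] 0) (𝓝 0) := by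
  have := (continuous_besselF hs).tendsto 0
  rw [besselF_zero hs] at this
  exact this.mono_left nhdsWithin_le_nhds

lemma exists_besselF_ne_zero {s : ℝ} (hs : 1 < s) : ∃ x ∈ Ioi (0 : ℝ), besselF s x ≠ 0 :=
  ⟨1, mem_Ioi.2 one_pos, (besselF_pos hs one_pos le_rfl).ne'⟩

/-- Every solution tending to `0` at the origin is a multiple of `besselF`. -/
lemma IsSol.eq_const_mul_besselF {s : ℝ} (hs : 1 < s) {v v' : ℝ → ℝ} {S : Set ℝ}
    (hv : IsSol (besselCoeff s) S v v') (hS : S.OrdConnected) (hS0 : S ⊆ Ioi 0)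
    (hS1 : S ∈ 𝓝[>] (0 : ℝ)) (hvl : Tendsto v (𝓝[>] 0) (𝓝 0)) :
    ∃ c, ∀ x ∈ S, v x = c * besselF s x := by
  obtain ⟨r, hr, hrS⟩ := mem_nhdsGT_iff_exists_Ioc_subset.1 hS1
  have hr0 : 0 < r := hr
  have hss : 0 < s * (s - 1) := mul_pos (by linarith) (by linarith)
  set y := min r (min 1 √(s * (s - 1))) with hy
  have hy0 : 0 < y := lt_min hr0 (lt_min one_pos (Real.sqrt_pos.2 hss))
  have hy1 : y ≤ 1 := (min_le_right _ _).trans (min_le_left _ _)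
  have hys : y ≤ √(s * (s - 1)) := (min_le_right _ _).trans (min_le_right _ _)
  refine ⟨v y / besselF s y, fun x hx => ((isSol_besselF hs).mono hS0).eq_const_mul hv hS
    (continuousOn_besselCoeff s hS0) hy0
    (fun t ht => hrS ⟨ht.1, ht.2.trans (min_le_left _ _)⟩) (fun t ht => ?_)
    (besselF_pos hs hy0 hy1).ne' (tendsto_besselF hs) hvl hx⟩
  refine besselCoeff_nonneg ht.1 ?_
  calc t ^ 2 ≤ √(s * (s - 1)) ^ 2 := by
        have := ht.1
        have := ht.2.trans hys
        gcongr
    _ = _ := Real.sq_sqrt hss.le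

/-- `besselF` has no zero up to the turning point `√(s (s - 1))`. -/
lemma lt_sq_of_besselF_eq_zero {s : ℝ} (hs : 1 < s) {x : ℝ} (hx : 0 < x) (h0 : besselF s x = 0) :
    s * (s - 1) < x ^ 2 := by
  by_contra! hle
  have hsol := (isSol_besselF hs).mono (S := Ioi 0) (T := Ioc 0 x) fun t ht => ht.1
  have hz : 0 < min x 1 := lt_min hx one_pos
  refine (besselF_pos hs hz (min_le_right _ _)).ne' ?_
  refine hsol.eq_zero_of_tendsto ordConnected_Ioc (fun t ht => besselCoeff_nonneg ht.1 ?_)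
    (right_mem_Ioc.2 hx) h0 (l := 𝓝[>] 0) (fun r hr => ?_) (tendsto_besselF hs)
    ⟨hz, min_le_left _ _⟩ (min_le_left _ _)
  · have := ht.1
    exact (pow_le_pow_left₀ ht.1.le ht.2 2).trans hle
  · filter_upwards [Ioo_mem_nhdsGT hr.1] with t ht
    exact ⟨⟨ht.1, ht.2.le.trans hr.2⟩, ht.2.le⟩

/-- The positive zeros of `besselF`, listed in increasing order. -/
lemma exists_besselF_zeros {s : ℝ} (hs : 1 < s) :
    ∃ ρ : ℕ → ℝ, StrictMono ρ ∧ range ρ = {x | 0 < x ∧ besselF s x = 0} := by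
  have hss : 0 < s * (s - 1) := mul_pos (by linarith) (by linarith)
  have hsol := isSol_besselF hs
  refine exists_strictMono_range (fun R => ?_) (fun R => ?_)
  · refine (hsol.finite_zeros ordConnected_Ioi (continuousOn_besselCoeff s subset_rfl)
      (exists_besselF_ne_zero hs) (a := √(s * (s - 1))) (b := R)
      fun x hx => (Real.sqrt_pos.2 hss).trans_le hx.1).subset fun x hx => ⟨⟨?_, hx.2⟩, hx.1.2⟩
    exact Real.sqrt_le_iff.2 ⟨hx.1.1.le, (lt_sq_of_besselF_eq_zero hs hx.1.1 hx.1.2).le⟩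
  · set a := max R (√(2 * (s * (s - 1)))) + 1 with ha
    have hpos : ∀ x ∈ Icc a (a + Real.pi / (1 / 2)), √(2 * (s * (s - 1))) < x := fun x hx =>
      by linarith [hx.1, le_max_right R (√(2 * (s * (s - 1))))]
    have hpos' : ∀ x ∈ Icc a (a + Real.pi / (1 / 2)), 0 < x := fun x hx =>
      (Real.sqrt_nonneg _).trans_lt (hpos x hx)
    obtain ⟨x, hx, h0⟩ := hsol.exists_zero (a := a) (k := 1 / 2) (by norm_num) hpos'
      (fun x hx => by
        have h2 : 2 * (s * (s - 1)) < x ^ 2 := (Real.sqrt_lt' (hpos' x hx)).1 (hpos x hx)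
        have h3 : s * (s - 1) / x ^ 2 ≤ 1 / 2 := by
          rw [div_le_iff₀ (by have := hpos' x hx; positivity)]
          linarith
        rw [besselCoeff]
        linarith)
    exact ⟨x, ⟨hpos' x hx, h0⟩, by linarith [hx.1, le_max_left R (√(2 * (s * (s - 1))))]⟩

/-! ### Schläfli's contour integral -/

/-- The derivatives in `x` of the integral of `exp (x sinh t - ν t)` along the segment from
`A - iπ` to `A + iπ`. -/
def schlafliSegment (ν A : ℝ) (k : ℕ) (x : ℝ) : ℂ :=
  ∫ θ in (-Real.pi)..Real.pi, Complex.sinh (A + θ * Complex.I) ^ k *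
    Complex.exp (x * Complex.sinh (A + θ * Complex.I) - ν * (A + θ * Complex.I))

/-- The derivatives in `x` of the integral of `exp (-x sinh u - ν u)` over `(A, ∞)`: up to phases,
the contribution of either of the half-lines from `A ± iπ` to infinity. -/
def schlafliRay (ν A : ℝ) (k : ℕ) (x : ℝ) : ℝ :=
  ∫ u in Ioi A, (-Real.sinh u) ^ k * Real.exp (-x * Real.sinh u - ν * u)

lemma hasDerivAt_schlafliSegment (ν A : ℝ) (k : ℕ) (x : ℝ) :
    HasDerivAt (schlafliSegment ν A k) (schlafliSegment ν A (k + 1) x) x := by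
  have hs : Continuous fun θ : ℝ => Complex.sinh (A + θ * Complex.I) :=
    Complex.continuous_sinh.comp (by fun_prop)
  refine (intervalIntegral.hasDerivAt_integral_of_dominated_loc_of_deriv_le
    (F' := fun (x : ℝ) θ => Complex.sinh (A + θ * Complex.I) ^ (k + 1) *
      Complex.exp (x * Complex.sinh (A + θ * Complex.I) - ν * (A + θ * Complex.I)))
    (bound := fun θ => ‖Complex.sinh (A + θ * Complex.I)‖ ^ (k + 1) *
      Real.exp ((|x| + 1) * ‖Complex.sinh (A + θ * Complex.I)‖ + ‖ν * (A + θ * Complex.I)‖))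
    (Metric.ball_mem_nhds x one_pos)
    (Eventually.of_forall fun x => Continuous.aestronglyMeasurable (by fun_prop))
    (Continuous.intervalIntegrable (by fun_prop) _ _)
    (Continuous.aestronglyMeasurable (by fun_prop)) (Eventually.of_forall fun θ _ y hy => ?_)
    (Continuous.intervalIntegrable (by fun_prop) _ _)
    (Eventually.of_forall fun θ _ y _ => ?_)).2
  · rw [norm_mul, norm_pow, Complex.norm_exp]
    gcongr
    refine (Complex.re_le_norm _).trans ((norm_sub_le _ _).trans ?_)
    gcongr
    rw [norm_mul, Complex.norm_real]
    gcongr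
    have h1 : |y - x| < 1 := hy
    have h2 := abs_sub_abs_le_abs_sub y x
    rw [Real.norm_eq_abs]
    linarith
  · have h1 := ((Complex.ofRealCLM.hasDerivAt (x := y)).mul_const
      (Complex.sinh (A + θ * Complex.I))).sub_const ((ν : ℂ) * (A + θ * Complex.I))
    refine (h1.cexp.const_mul (Complex.sinh (A + θ * Complex.I) ^ k)).congr_deriv ?_
    simp
    ring

lemma pow_mul_exp_neg_le {c y : ℝ} (hc : 0 < c) (hy : 0 ≤ y) (k : ℕ) :
    y ^ k * Real.exp (-c * y) ≤ k.factorial / c ^ k := by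
  have h := Real.pow_div_factorial_le_exp (c * y) (by positivity) k
  rw [div_le_iff₀ (by positivity), mul_pow] at h
  rw [neg_mul, Real.exp_neg, ← div_eq_mul_inv, div_le_div_iff₀ (Real.exp_pos _) (by positivity)]
  linarith

lemma ray_le {ν A c x u : ℝ} (hA : 0 ≤ A) (hc : 0 < c) (hx : c ≤ x) (hu : A < u) (k : ℕ) :
    ‖(-Real.sinh u) ^ k * Real.exp (-x * Real.sinh u - ν * u)‖ ≤
      k.factorial / c ^ k * Real.exp (-ν * u) := by
  have hs : 0 ≤ Real.sinh u := Real.sinh_nonneg_iff.2 (hA.trans hu.le)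
  rw [norm_mul, norm_pow, norm_neg, Real.norm_eq_abs, Real.norm_eq_abs, abs_of_nonneg hs,
    Real.abs_exp, sub_eq_add_neg, Real.exp_add, ← mul_assoc, ← neg_mul]
  gcongr
  refine le_trans ?_ (pow_mul_exp_neg_le hc hs k)
  gcongr

lemma integrableOn_exp_neg_mul {ν : ℝ} (hν : 0 < ν) (A : ℝ) :
    IntegrableOn (fun u => Real.exp (-ν * u)) (Ioi A) :=
  integrableOn_exp_mul_Ioi (neg_lt_zero.2 hν) A

lemma integrableOn_ray {ν A x : ℝ} (hν : 0 < ν) (hA : 0 ≤ A) (hx : 0 < x) (k : ℕ) :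
    IntegrableOn (fun u => (-Real.sinh u) ^ k * Real.exp (-x * Real.sinh u - ν * u)) (Ioi A) := by
  refine ((integrableOn_exp_neg_mul hν A).const_mul (k.factorial / x ^ k)).mono' ?_ ?_
  · have := Real.continuous_sinh
    exact Continuous.aestronglyMeasurable (by fun_prop)
  · exact (ae_restrict_mem measurableSet_Ioi).mono fun u hu => ray_le hA hx le_rfl hu k

lemma hasDerivAt_schlafliRay {ν A x : ℝ} (hν : 0 < ν) (hA : 0 ≤ A) (hx : 0 < x) (k : ℕ) :
    HasDerivAt (schlafliRay ν A k) (schlafliRay ν A (k + 1) x) x := by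
  have hsc := Real.continuous_sinh
  have hxm : 0 < x / 2 := half_pos hx
  refine (hasDerivAt_integral_of_dominated_loc_of_deriv_le (μ := volume.restrict (Ioi A))
    (F := fun x u => (-Real.sinh u) ^ k * Real.exp (-x * Real.sinh u - ν * u))
    (F' := fun x u => (-Real.sinh u) ^ (k + 1) * Real.exp (-x * Real.sinh u - ν * u))
    (bound := fun u => (k + 1).factorial / (x / 2) ^ (k + 1) * Real.exp (-ν * u))
    (Ici_mem_nhds (half_lt_self hx))
    (Eventually.of_forall fun x => Continuous.aestronglyMeasurable (by fun_prop))
    (integrableOn_ray hν hA hx k) (Continuous.aestronglyMeasurable (by fun_prop))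
    ((ae_restrict_mem measurableSet_Ioi).mono fun u hu y hy => ray_le hA hxm hy hu _)
    ((integrableOn_exp_neg_mul hν A).const_mul _) (Eventually.of_forall fun u y _ => ?_)).2
  have h1 : HasDerivAt (fun y : ℝ => -y * Real.sinh u - ν * u) (-Real.sinh u) y := by
    simpa using ((hasDerivAt_neg y).mul_const (Real.sinh u)).sub_const (ν * u)
  exact (h1.exp.const_mul _).congr_deriv (by ring)

/-- The Bessel operator applied to the segment integral is a boundary term, since
`(x² sinh² t + x sinh t + x² - ν²) exp (x sinh t - ν t)` is the derivative of
`(x cosh t + ν) exp (x sinh t - ν t)`. -/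
lemma bessel_schlafliSegment (ν A x : ℝ) :
    x ^ 2 * schlafliSegment ν A 2 x + x * schlafliSegment ν A 1 x +
      (x ^ 2 - ν ^ 2) * schlafliSegment ν A 0 x =
    ((2 * Real.sin (ν * Real.pi) *
      ((x * Real.cosh A - ν) * Real.exp (-x * Real.sinh A - ν * A)) : ℝ) : ℂ) := by
  have hs : Continuous fun θ : ℝ => Complex.sinh (A + θ * Complex.I) :=
    Complex.continuous_sinh.comp (by fun_prop)
  have hi : ∀ k : ℕ, IntervalIntegrable (fun θ : ℝ => Complex.sinh (A + θ * Complex.I) ^ k *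
      Complex.exp (x * Complex.sinh (A + θ * Complex.I) - ν * (A + θ * Complex.I)))
      volume (-Real.pi) Real.pi := fun k => Continuous.intervalIntegrable (by fun_prop) _ _
  have hd : ∀ θ : ℝ, HasDerivAt (fun θ : ℝ => (x * Complex.cosh (A + θ * Complex.I) + ν) *
      Complex.exp (x * Complex.sinh (A + θ * Complex.I) - ν * (A + θ * Complex.I)))
      (Complex.I * (x ^ 2 * (Complex.sinh (A + θ * Complex.I) ^ 2 *
          Complex.exp (x * Complex.sinh (A + θ * Complex.I) - ν * (A + θ * Complex.I))) +
        x * (Complex.sinh (A + θ * Complex.I) ^ 1 *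
          Complex.exp (x * Complex.sinh (A + θ * Complex.I) - ν * (A + θ * Complex.I))) +
        (x ^ 2 - ν ^ 2) * (Complex.sinh (A + θ * Complex.I) ^ 0 *
          Complex.exp (x * Complex.sinh (A + θ * Complex.I) - ν * (A + θ * Complex.I))))) θ := by
    intro θ
    have h0 : HasDerivAt (fun θ : ℝ => (A : ℂ) + θ * Complex.I) Complex.I θ := by
      simpa using ((Complex.ofRealCLM.hasDerivAt (x := θ)).mul_const Complex.I).const_add (A : ℂ)
    have h1 := ((((Complex.hasDerivAt_cosh _).comp θ h0).const_mul (x : ℂ)).add_const (ν : ℂ)).mul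
      (((((Complex.hasDerivAt_sinh _).comp θ h0).const_mul (x : ℂ)).sub
        (h0.const_mul (ν : ℂ))).cexp)
    refine h1.congr_deriv ?_
    have hcs := Complex.cosh_sq (A + θ * Complex.I)
    simp only [Function.comp_apply, Pi.sub_apply]
    linear_combination (Complex.I * x ^ 2 * Complex.exp
      (x * Complex.sinh (A + θ * Complex.I) - ν * (A + θ * Complex.I))) * hcs
  have hftc := intervalIntegral.integral_eq_sub_of_hasDerivAt (a := -Real.pi) (b := Real.pi)
    (fun θ _ => hd θ) ((((hi 2).const_mul _).add ((hi 1).const_mul _)).add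
      ((hi 0).const_mul _) |>.const_mul _)
  rw [intervalIntegral.integral_const_mul, intervalIntegral.integral_add
    (((hi 2).const_mul _).add ((hi 1).const_mul _)) ((hi 0).const_mul _),
    intervalIntegral.integral_add ((hi 2).const_mul _) ((hi 1).const_mul _),
    intervalIntegral.integral_const_mul, intervalIntegral.integral_const_mul,
    intervalIntegral.integral_const_mul] at hftc
  have hsp : Complex.sinh (A + Real.pi * Complex.I) = -Real.sinh A := by
    rw [Complex.sinh_add, Complex.sinh_mul_I, Complex.cosh_mul_I]; simp
  have hcp : Complex.cosh (A + Real.pi * Complex.I) = -Real.cosh A := by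
    rw [Complex.cosh_add, Complex.sinh_mul_I, Complex.cosh_mul_I]; simp
  have hsm : Complex.sinh (A + ((-Real.pi : ℝ) : ℂ) * Complex.I) = -Real.sinh A := by
    rw [Complex.sinh_add, Complex.sinh_mul_I, Complex.cosh_mul_I]; simp
  have hcm : Complex.cosh (A + ((-Real.pi : ℝ) : ℂ) * Complex.I) = -Real.cosh A := by
    rw [Complex.cosh_add, Complex.sinh_mul_I, Complex.cosh_mul_I]; simp
  have he : ∀ φ : ℝ, Complex.exp (x * -(Real.sinh A : ℂ) - ν * (A + φ * Complex.I)) =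
      Real.exp (-x * Real.sinh A - ν * A) *
        (Complex.cos (ν * φ) - Complex.sin (ν * φ) * Complex.I) := fun φ => by
    have h1 := Complex.exp_mul_I (-(ν * φ : ℂ))
    rw [Complex.cos_neg, Complex.sin_neg] at h1
    rw [show Complex.cos (ν * φ) - Complex.sin (ν * φ) * Complex.I =
      Complex.exp (-(ν * φ) * Complex.I) by rw [h1]; ring, Complex.ofReal_exp, ← Complex.exp_add]
    congr 1
    push_cast
    ring
  rw [hsp, hcp, hsm, hcm, he, he] at hftc
  have hneg : (ν : ℂ) * ((-Real.pi : ℝ) : ℂ) = -(ν * Real.pi) := by push_cast; ring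
  rw [hneg, Complex.cos_neg, Complex.sin_neg] at hftc
  have := mul_left_cancel₀ Complex.I_ne_zero (hftc.trans (b := _)
    (c := Complex.I * (2 * Complex.sin (ν * Real.pi) *
      ((x * Real.cosh A - ν) * Real.exp (-x * Real.sinh A - ν * A)))) (by ring))
  rw [schlafliSegment, schlafliSegment, schlafliSegment, this]
  push_cast
  ring

/-- The Bessel operator applied to the half-line integral is a boundary term, since
`(x² sinh² u - x sinh u + x² - ν²) exp (-x sinh u - ν u)` is the derivative of
`(ν - x cosh u) exp (-x sinh u - ν u)`. -/
lemma bessel_schlafliRay {ν A x : ℝ} (hν : 0 < ν) (hA : 0 ≤ A) (hx : 0 < x) :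
    x ^ 2 * schlafliRay ν A 2 x + x * schlafliRay ν A 1 x +
      (x ^ 2 - ν ^ 2) * schlafliRay ν A 0 x =
    (x * Real.cosh A - ν) * Real.exp (-x * Real.sinh A - ν * A) := by
  have hi := integrableOn_ray hν hA hx
  have hd : ∀ u : ℝ, HasDerivAt
      (fun u => (ν - x * Real.cosh u) * Real.exp (-x * Real.sinh u - ν * u))
      (x ^ 2 * ((-Real.sinh u) ^ 2 * Real.exp (-x * Real.sinh u - ν * u)) +
        x * ((-Real.sinh u) ^ 1 * Real.exp (-x * Real.sinh u - ν * u)) +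
        (x ^ 2 - ν ^ 2) * ((-Real.sinh u) ^ 0 * Real.exp (-x * Real.sinh u - ν * u))) u := by
    intro u
    have h1 := (((Real.hasDerivAt_cosh u).const_mul x).const_sub ν).mul
      ((((Real.hasDerivAt_sinh u).const_mul (-x)).sub ((hasDerivAt_id u).const_mul ν)).exp)
    refine h1.congr_deriv ?_
    have hcs := Real.cosh_sq u
    simp only [Pi.sub_apply, id]
    linear_combination (x ^ 2 * Real.exp (-x * Real.sinh u - ν * u)) * hcs
  have hint := (((hi 2).const_mul (x ^ 2)).add ((hi 1).const_mul x)).add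
    ((hi 0).const_mul (x ^ 2 - ν ^ 2))
  have hexp : Tendsto (fun u => Real.exp (-ν * u)) atTop (𝓝 0) :=
    Real.tendsto_exp_atBot.comp (tendsto_id.const_mul_atTop_of_neg (neg_lt_zero.2 hν))
  have hlim : Tendsto (fun u => (ν - x * Real.cosh u) * Real.exp (-x * Real.sinh u - ν * u))
      atTop (𝓝 0) := by
    refine squeeze_zero_norm' (a := fun u => (ν * ((0).factorial / x ^ 0) +
      x * ((0).factorial / x ^ 0 + (1).factorial / x ^ 1)) * Real.exp (-ν * u)) ?_
      (by simpa using hexp.const_mul _)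
    filter_upwards [eventually_gt_atTop A] with u hu
    have hs : 0 ≤ Real.sinh u := Real.sinh_nonneg_iff.2 (hA.trans hu.le)
    have hc : Real.cosh u ≤ 1 + Real.sinh u := by
      rw [add_comm, ← sub_le_iff_le_add', Real.cosh_sub_sinh]
      exact Real.exp_le_one_iff.2 (by linarith)
    have h0 := ray_le (ν := ν) hA hx le_rfl hu 0
    have h1 := ray_le (ν := ν) hA hx le_rfl hu 1
    rw [norm_mul, norm_pow, norm_neg, Real.norm_eq_abs, Real.norm_eq_abs, Real.abs_exp,
      abs_of_nonneg hs] at h0 h1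
    rw [norm_mul, Real.norm_eq_abs, Real.norm_eq_abs, Real.abs_exp]
    have h2 : |ν - x * Real.cosh u| ≤ ν + x * (1 + Real.sinh u) := by
      refine (abs_sub _ _).trans ?_
      rw [abs_of_pos hν, abs_of_pos (mul_pos hx (Real.cosh_pos u))]
      gcongr
    calc |ν - x * Real.cosh u| * Real.exp (-x * Real.sinh u - ν * u)
        ≤ (ν + x * (1 + Real.sinh u)) * Real.exp (-x * Real.sinh u - ν * u) := by gcongr
      _ = ν * (Real.sinh u ^ 0 * Real.exp (-x * Real.sinh u - ν * u)) +
          x * (Real.sinh u ^ 0 * Real.exp (-x * Real.sinh u - ν * u) +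
            Real.sinh u ^ 1 * Real.exp (-x * Real.sinh u - ν * u)) := by ring
      _ ≤ ν * ((0).factorial / x ^ 0 * Real.exp (-ν * u)) +
          x * ((0).factorial / x ^ 0 * Real.exp (-ν * u) +
            (1).factorial / x ^ 1 * Real.exp (-ν * u)) := by gcongr
      _ = _ := by ring
  have h := integral_Ioi_of_hasDerivAt_of_tendsto' (a := A) (fun u _ => hd u) hint hlim
  have hint' : Integrable (fun u =>
      x ^ 2 * ((-Real.sinh u) ^ 2 * Real.exp (-x * Real.sinh u - ν * u))
      + x * ((-Real.sinh u) ^ 1 * Real.exp (-x * Real.sinh u - ν * u))) (volume.restrict (Ioi A)) :=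
    ((hi 2).const_mul (x ^ 2)).add ((hi 1).const_mul x)
  rw [integral_add hint' ((hi 0).const_mul (x ^ 2 - ν ^ 2)),
    integral_add ((hi 2).const_mul (x ^ 2)) ((hi 1).const_mul x), integral_const_mul,
    integral_const_mul, integral_const_mul] at h
  rw [schlafliRay, schlafliRay, schlafliRay, h]
  ring

/-- The `k`-th derivative of Schläfli's integral for `2π J_ν`. The parameter `A` is the abscissa of
the vertical segment of the contour, of which the integral is independent; it is chosen later so
that the contour passes at distance `δ` from the saddle point `t = 0`. -/
def schlafli (ν A : ℝ) (k : ℕ) (x : ℝ) : ℝ :=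
  (schlafliSegment ν A k x).re - 2 * Real.sin (ν * Real.pi) * schlafliRay ν A k x

lemma hasDerivAt_schlafli {ν A x : ℝ} (hν : 0 < ν) (hA : 0 ≤ A) (hx : 0 < x) (k : ℕ) :
    HasDerivAt (schlafli ν A k) (schlafli ν A (k + 1) x) x :=
  (Complex.reCLM.hasFDerivAt.comp_hasDerivAt x (hasDerivAt_schlafliSegment ν A k x)).sub
    ((hasDerivAt_schlafliRay hν hA hx k).const_mul _)

lemma bessel_schlafli {ν A x : ℝ} (hν : 0 < ν) (hA : 0 ≤ A) (hx : 0 < x) :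
    x ^ 2 * schlafli ν A 2 x + x * schlafli ν A 1 x + (x ^ 2 - ν ^ 2) * schlafli ν A 0 x = 0 := by
  have h1 := congrArg Complex.re (bessel_schlafliSegment ν A x)
  have h2 := bessel_schlafliRay hν hA hx
  have h3 : ∀ (r : ℝ) (z : ℂ), ((r : ℂ) * z).re = r * z.re := fun r z => Complex.re_ofReal_mul r z
  rw [Complex.add_re, Complex.add_re, ← Complex.ofReal_pow, ← Complex.ofReal_pow,
    ← Complex.ofReal_sub, h3, h3, h3, Complex.ofReal_re] at h1
  simp only [schlafli]
  linear_combination h1 - 2 * Real.sin (ν * Real.pi) * h2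

/-- The factor `√x` removes the first-order term of Bessel's equation. -/
lemma isSol_schlafli {ν A : ℝ} (hν : 0 < ν) (hA : 0 ≤ A) :
    IsSol (besselCoeff (ν + 1 / 2)) (Ioi 0) (fun x => √x * schlafli ν A 0 x)
      (fun x => 1 / (2 * √x) * schlafli ν A 0 x + √x * schlafli ν A 1 x) := by
  intro x hx
  have hx0 : 0 < x := hx
  have hs := Real.hasDerivAt_sqrt hx0.ne'
  have hsx : 0 < √x := Real.sqrt_pos.2 hx0
  have h0 := hasDerivAt_schlafli hν hA hx0 0
  have h1 := hasDerivAt_schlafli hν hA hx0 1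
  refine ⟨hs.mul h0, ?_⟩
  have hs' : HasDerivAt (fun x => 1 / (2 * √x)) (-(1 / (4 * (x * √x)))) x := by
    refine ((hs.const_mul 2).inv (by positivity)).congr_deriv ?_ |>.congr_of_eventuallyEq ?_
    · have : √x ^ 2 = x := Real.sq_sqrt hx0.le
      field_simp
      rw [this]
      ring
    · exact Eventually.of_forall fun y => by simp
  refine ((hs'.mul h0).add (hs.mul h1)).congr_deriv ?_
  have hode := bessel_schlafli hν hA hx0
  have h2 : schlafli ν A 2 x =
      -(schlafli ν A 1 x / x) - (1 - ν ^ 2 / x ^ 2) * schlafli ν A 0 x := by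
    field_simp
    linarith
  have hsq : √x ^ 2 = x := Real.sq_sqrt hx0.le
  simp only [h2, besselCoeff, Nat.reduceAdd]
  have hinv : 1 / (2 * √x) = √x / (2 * x) := by
    field_simp
    rw [hsq]
  have hinv' : 1 / (4 * (x * √x)) = √x / (4 * x ^ 2) := by
    field_simp
    rw [hsq]
  rw [hinv, hinv']
  field_simp
  ring

lemma tendsto_schlafli {ν A : ℝ} (hν : 0 < ν) (hA : 0 ≤ A) :
    Tendsto (fun x => √x * schlafli ν A 0 x) (𝓝[>] 0) (𝓝 0) := by
  have hseg : Tendsto (schlafliSegment ν A 0) (𝓝[>] 0) (𝓝 (schlafliSegment ν A 0 0)) :=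
    (hasDerivAt_schlafliSegment ν A 0 0).continuousAt.tendsto.mono_left nhdsWithin_le_nhds
  have hsqrt : Tendsto (fun x => √x) (𝓝[>] 0) (𝓝 0) := by
    simpa using (Real.continuous_sqrt.tendsto 0).mono_left nhdsWithin_le_nhds
  have h1 : Tendsto (fun x => √x * (schlafliSegment ν A 0 x).re) (𝓝[>] 0) (𝓝 0) := by
    simpa using hsqrt.mul ((Complex.continuous_re.tendsto _).comp hseg)
  have h2 : Tendsto (fun x => √x * schlafliRay ν A 0 x) (𝓝[>] 0) (𝓝 0) := by
    refine squeeze_zero_norm' (a := fun x => √x * ∫ u in Ioi A, Real.exp (-ν * u)) ?_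
      (by simpa using hsqrt.mul_const _)
    filter_upwards [self_mem_nhdsWithin] with x hx
    have hx0 : 0 < x := hx
    rw [norm_mul, Real.norm_eq_abs, abs_of_nonneg (Real.sqrt_nonneg x)]
    gcongr
    refine norm_integral_le_of_norm_le (integrableOn_exp_neg_mul hν A) ?_
    refine (ae_restrict_mem measurableSet_Ioi).mono fun u hu => ?_
    simpa using ray_le (ν := ν) hA hx0 le_rfl hu 0
  have := h1.sub (h2.const_mul (2 * Real.sin (ν * Real.pi)))
  rw [mul_zero, sub_zero] at this
  refine this.congr fun x => ?_
  rw [schlafli]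
  ring

/-- Schläfli's integral is a multiple of the recessive solution. -/
lemma exists_schlafli_eq {ν A : ℝ} (hν : 1 / 2 < ν) (hA : 0 ≤ A) :
    ∃ c, ∀ x > 0, √x * schlafli ν A 0 x = c * besselF (ν + 1 / 2) x :=
  (isSol_schlafli (by linarith) hA).eq_const_mul_besselF (by linarith) ordConnected_Ioi subset_rfl
    self_mem_nhdsWithin (tendsto_schlafli (by linarith) hA)

/-! ### Expansion of Schläfli's integral at the turning point -/

/-- Taylor's formula for the exponential, with a remainder that stays small when `Re z` is very
negative. -/
lemma norm_exp_sub_sum_le (n : ℕ) (z : ℂ) :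
    ‖Complex.exp z - ∑ k ∈ Finset.range n, z ^ k / k.factorial‖ ≤
      ‖z‖ ^ n * max 1 (Real.exp z.re) := by
  induction n generalizing z with
  | zero => simp [Complex.norm_exp]
  | succ n ih =>
    have hd : ∀ r : ℝ, HasDerivAt (fun r : ℝ => Complex.exp (r * z) -
        ∑ k ∈ Finset.range (n + 1), (r * z) ^ k / k.factorial)
        (z * (Complex.exp (r * z) - ∑ k ∈ Finset.range n, (r * z) ^ k / k.factorial)) r := by
      intro r
      have h0 : HasDerivAt (fun r : ℝ => (r : ℂ) * z) z r := by
        simpa using (Complex.ofRealCLM.hasDerivAt (x := r)).mul_const z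
      have h1 : ∀ k : ℕ, HasDerivAt (fun r : ℝ => ((r : ℂ) * z) ^ (k + 1) / (k + 1).factorial)
          (z * (((r : ℂ) * z) ^ k / k.factorial)) r := fun k => by
        refine ((h0.pow (k + 1)).div_const _).congr_deriv ?_
        rw [Nat.factorial_succ]
        have : (k.factorial : ℂ) ≠ 0 := Nat.cast_ne_zero.2 k.factorial_ne_zero
        have : (k : ℂ) + 1 ≠ 0 := Nat.cast_add_one_ne_zero k
        push_cast
        field_simp
      have h2 : HasDerivAt (fun r : ℝ => ∑ k ∈ Finset.range n,
          ((r : ℂ) * z) ^ (k + 1) / (k + 1).factorial)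
          (∑ k ∈ Finset.range n, z * (((r : ℂ) * z) ^ k / k.factorial)) r :=
        HasDerivAt.fun_sum fun k _ => h1 k
      simp only [Finset.sum_range_succ', pow_zero]
      refine (h0.cexp.sub (h2.add_const _)).congr_deriv ?_
      rw [← Finset.mul_sum]
      ring
    have hle := norm_image_sub_le_of_norm_deriv_le_segment_01'
      (fun r _ => (hd r).hasDerivWithinAt) (C := ‖z‖ ^ (n + 1) * max 1 (Real.exp z.re))
      fun r hr => by
        rw [norm_mul, pow_succ', mul_assoc]
        gcongr
        refine (ih _).trans ?_
        have h1 : ‖(r : ℂ) * z‖ ≤ ‖z‖ := by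
          rw [norm_mul, Complex.norm_real, Real.norm_eq_abs, abs_of_nonneg hr.1]
          exact mul_le_of_le_one_left (norm_nonneg _) hr.2.le
        have h2 : max 1 (Real.exp ((r : ℂ) * z).re) ≤ max 1 (Real.exp z.re) := by
          refine max_le (le_max_left _ _) ?_
          rw [Complex.re_ofReal_mul]
          rcases le_total z.re 0 with h | h
          · exact le_max_of_le_left (Real.exp_le_one_iff.2 (mul_nonpos_of_nonneg_of_nonpos hr.1 h))
          · exact le_max_of_le_right (Real.exp_le_exp.2 (mul_le_of_le_one_left h hr.2.le))
        gcongr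
    simpa [Finset.sum_range_succ'] using hle

lemma norm_sinh_sub_sum_le (M : ℕ) (z : ℂ) :
    ‖Complex.sinh z - ∑ m ∈ Finset.range M, z ^ (2 * m + 1) / (2 * m + 1).factorial‖ ≤
      ‖z‖ ^ (2 * M + 1) * Real.exp ‖z‖ := by
  have hsum : ∑ m ∈ Finset.range M, z ^ (2 * m + 1) / (2 * m + 1).factorial =
      ((∑ k ∈ Finset.range (2 * M + 1), z ^ k / k.factorial) -
        ∑ k ∈ Finset.range (2 * M + 1), (-z) ^ k / k.factorial) / 2 := by
    induction M with
    | zero => simp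
    | succ M ih =>
      rw [Finset.sum_range_succ, ih, show 2 * (M + 1) + 1 = 2 * M + 1 + 1 + 1 by ring,
        Finset.sum_range_succ _ (2 * M + 1 + 1), Finset.sum_range_succ _ (2 * M + 1),
        Finset.sum_range_succ _ (2 * M + 1 + 1), Finset.sum_range_succ _ (2 * M + 1),
        Odd.neg_pow ⟨M, rfl⟩, Even.neg_pow ⟨M + 1, by ring⟩]
      ring
  have h1 := Complex.norm_exp_sub_sum_le_norm_mul_exp z (2 * M + 1)
  have h2 := Complex.norm_exp_sub_sum_le_norm_mul_exp (-z) (2 * M + 1)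
  rw [norm_neg] at h2
  rw [hsum, Complex.sinh, ← sub_div, norm_div, Complex.norm_two, div_le_iff₀ two_pos]
  calc _ = ‖(Complex.exp z - ∑ k ∈ Finset.range (2 * M + 1), z ^ k / k.factorial) -
        (Complex.exp (-z) - ∑ k ∈ Finset.range (2 * M + 1), (-z) ^ k / k.factorial)‖ := by
          congr 1; ring
    _ ≤ _ := (norm_sub_le _ _).trans (by linarith)

lemma norm_pow_sub_pow_le' {a b : ℂ} {B : ℝ} (hB : 1 ≤ B) (ha : ‖a‖ ≤ B) (hb : ‖b‖ ≤ B) (k : ℕ) :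
    ‖a ^ k - b ^ k‖ ≤ k * B ^ k * ‖a - b‖ := by
  have hB0 : 0 ≤ B := zero_le_one.trans hB
  induction k with
  | zero => simp
  | succ k ih =>
    rw [show a ^ (k + 1) - b ^ (k + 1) = a * (a ^ k - b ^ k) + b ^ k * (a - b) by ring]
    refine (norm_add_le _ _).trans ?_
    rw [norm_mul, norm_mul, norm_pow]
    have h1 : ‖b‖ ^ k ≤ B ^ (k + 1) :=
      (pow_le_pow_left₀ (norm_nonneg _) hb k).trans (pow_le_pow_right₀ hB (Nat.le_succ k))
    calc ‖a‖ * ‖a ^ k - b ^ k‖ + ‖b‖ ^ k * ‖a - b‖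
        ≤ B * (k * B ^ k * ‖a - b‖) + B ^ (k + 1) * ‖a - b‖ := by gcongr
      _ = _ := by push_cast; ring

/-- The Taylor polynomial of order `J` in `ε` of
`2 ε^(-3/2) (sinh (√ε t) - √ε t) - t³ / 3 + w (ε^(-1/2) sinh (√ε t) - t)`. -/
def phasePoly (J : ℕ) (ε w t : ℂ) : ℂ :=
  ∑ m ∈ Finset.range J, ε ^ (m + 1) *
    (2 * t ^ (2 * m + 5) / (2 * m + 5).factorial + w * t ^ (2 * m + 3) / (2 * m + 3).factorial)

/-- The truncated exponential series at `phasePoly`. -/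
def amplitudePoly (J : ℕ) (ε w t : ℂ) : ℂ :=
  ∑ k ∈ Finset.range (J + 1), phasePoly J ε w t ^ k / k.factorial

lemma exists_mvPolynomial_eq_amplitudePoly (J : ℕ) : ∃ Q : MvPolynomial (Fin 3) ℂ,
    ∀ ε w t, amplitudePoly J ε w t = MvPolynomial.eval ![ε, w, t] Q := by
  refine ⟨∑ k ∈ Finset.range (J + 1), MvPolynomial.C ((k.factorial : ℂ)⁻¹) *
    (∑ m ∈ Finset.range J, MvPolynomial.X 0 ^ (m + 1) *
      (MvPolynomial.C (2 / ((2 * m + 5).factorial : ℂ)) * MvPolynomial.X 2 ^ (2 * m + 5) +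
        MvPolynomial.C (((2 * m + 3).factorial : ℂ)⁻¹) * MvPolynomial.X 1 *
          MvPolynomial.X 2 ^ (2 * m + 3))) ^ k, fun ε w t => ?_⟩
  simp only [map_sum, map_mul, map_pow, map_add, MvPolynomial.eval_C, MvPolynomial.eval_X,
    Matrix.cons_val_zero, Matrix.cons_val_one, Matrix.cons_val, amplitudePoly, phasePoly]
  refine Finset.sum_congr rfl fun k _ => ?_
  rw [div_eq_inv_mul]
  congr 2
  exact Finset.sum_congr rfl fun m _ => by ring

/-- The real part of `∫ amplitudePoly J ε w t exp (t³ / 3 + w t)` along `t = 1 + iσ`. -/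
def airyExpansion (J : ℕ) (ε w : ℝ) : ℝ :=
  (∫ σ : ℝ, amplitudePoly J ε w (vline σ) * airyExp w σ).re

lemma contDiff_airyMoment (n m : ℕ) : ContDiff ℝ n (airyMoment m) := by
  have hderiv : ∀ m, deriv (airyMoment m) = airyMoment (m + 1) := fun m =>
    funext fun w => (hasDerivAt_airyMoment m w).deriv
  have hdiff : ∀ m, Differentiable ℝ (airyMoment m) := fun m w =>
    (hasDerivAt_airyMoment m w).differentiableAt
  induction n generalizing m with
  | zero => exact contDiff_zero.2 (hdiff m).continuous
  | succ n ih =>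
    push_cast
    refine contDiff_succ_iff_deriv.2 ⟨hdiff m, by simp, ?_⟩
    rw [hderiv]
    exact ih (m + 1)

/-- The expansion is a combination of Airy moments with polynomial coefficients. -/
lemma airyExpansion_eq (J : ℕ) : ∃ Q : MvPolynomial (Fin 3) ℂ, ∀ ε w : ℝ,
    Integrable (fun σ : ℝ => amplitudePoly J ε w (vline σ) * airyExp w σ) ∧
    airyExpansion J ε w = (∑ d ∈ Q.support,
      Q.coeff d * ((ε : ℂ) ^ d 0 * (w : ℂ) ^ d 1) * airyMoment (d 2) w).re := by
  obtain ⟨Q, hQ⟩ := exists_mvPolynomial_eq_amplitudePoly J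
  refine ⟨Q, fun ε w => ?_⟩
  have h1 : (fun σ : ℝ => amplitudePoly J ε w (vline σ) * airyExp w σ) = fun σ =>
      ∑ d ∈ Q.support, Q.coeff d * ((ε : ℂ) ^ d 0 * (w : ℂ) ^ d 1) *
        (vline σ ^ d 2 * airyExp w σ) := by
    funext σ
    rw [hQ, MvPolynomial.eval_eq', Finset.sum_mul]
    refine Finset.sum_congr rfl fun d _ => ?_
    rw [Fin.prod_univ_three]
    simp only [Matrix.cons_val_zero, Matrix.cons_val_one, Matrix.cons_val]
    ring
  have hi : ∀ d ∈ Q.support, Integrable fun σ => Q.coeff d * ((ε : ℂ) ^ d 0 * (w : ℂ) ^ d 1) *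
      (vline σ ^ d 2 * airyExp w σ) := fun d _ =>
    (integrable_vline_pow_mul_airyExp (d 2) w).const_mul _
  refine ⟨by rw [h1]; exact integrable_finsetSum _ hi, ?_⟩
  rw [airyExpansion, h1, integral_finsetSum _ hi]
  congr 1
  exact Finset.sum_congr rfl fun d _ => by rw [integral_const_mul, airyMoment]

lemma contDiff_airyExpansion (n J : ℕ) :
    ContDiff ℝ n fun p : ℝ × ℝ => airyExpansion J p.1 p.2 := by
  obtain ⟨Q, hQ⟩ := airyExpansion_eq J
  have : (fun p : ℝ × ℝ => airyExpansion J p.1 p.2) = fun p => Complex.reCLM (∑ d ∈ Q.support,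
      Q.coeff d * ((p.1 : ℂ) ^ d 0 * (p.2 : ℂ) ^ d 1) * airyMoment (d 2) p.2) :=
    funext fun p => (hQ p.1 p.2).2
  rw [this]
  refine Complex.reCLM.contDiff.comp (ContDiff.sum fun d _ => ContDiff.mul (contDiff_const.mul
    (ContDiff.mul (ContDiff.pow ?_ _) (ContDiff.pow ?_ _))) ?_)
  · exact Complex.ofRealCLM.contDiff.comp contDiff_fst
  · exact Complex.ofRealCLM.contDiff.comp contDiff_snd
  · exact (contDiff_airyMoment n _).comp contDiff_snd

lemma airyExpansion_zero (J : ℕ) (w : ℝ) : airyExpansion J 0 w = 2 * Real.pi * airyA w := by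
  have h : ∀ t : ℂ, amplitudePoly J 0 w t = t ^ 0 := fun t => by
    have h0 : phasePoly J 0 w t = 0 :=
      Finset.sum_eq_zero fun m _ => by rw [zero_pow (Nat.succ_ne_zero m), zero_mul]
    rw [amplitudePoly, h0, Finset.sum_eq_single 0]
    · simp
    · intro k _ hk; rw [zero_pow hk, zero_div]
    · simp
  rw [airyA_eq, airyExpansion, Complex.ofReal_zero]
  simp only [h]
  rw [airyMoment, ← mul_assoc, mul_inv_cancel₀ (by positivity), one_mul]

/-- The integrand of Schläfli's integral for `ν = 2 / δ³` and `x = ν + w / δ`, at the point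
`δ (1 + iσ)` of the segment. -/
def scaledExp (δ w σ : ℝ) : ℂ :=
  Complex.exp ((2 / δ ^ 3 + w / δ) * Complex.sinh (δ * vline σ) - 2 / δ ^ 3 * (δ * vline σ))

/-- The difference between the phase of `scaledExp` and that of `airyExp`. -/
def phaseDiff (δ w σ : ℝ) : ℂ :=
  2 / δ ^ 3 * (Complex.sinh (δ * vline σ) - δ * vline σ - (δ * vline σ) ^ 3 / 6) +
    w / δ * (Complex.sinh (δ * vline σ) - δ * vline σ)

lemma scaledExp_eq {δ : ℝ} (hδ : δ ≠ 0) (w σ : ℝ) :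
    scaledExp δ w σ = airyExp w σ * Complex.exp (phaseDiff δ w σ) := by
  rw [scaledExp, airyExp, phaseDiff, ← Complex.exp_add]
  have : (δ : ℂ) ≠ 0 := Complex.ofReal_ne_zero.2 hδ
  congr 1
  field_simp
  ring

lemma one_le_weight (σ : ℝ) : 1 ≤ 1 + |σ| := by linarith [abs_nonneg σ]

lemma norm_phasePoly_le (J : ℕ) {R ε w : ℝ} (hR : 1 ≤ R) (hε : 0 ≤ ε) (hε1 : ε ≤ 1)
    (hw : |w| ≤ R) (σ : ℝ) :
    ‖phasePoly J ε w (vline σ)‖ ≤ ε * (J * (2 + R) * (1 + |σ|) ^ (2 * J + 5)) := by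
  have hT := one_le_weight σ
  have hfac : ∀ k : ℕ, (1 : ℝ) ≤ k.factorial := fun k => by
    exact_mod_cast Nat.succ_le_of_lt k.factorial_pos
  have hpow : ∀ k ≤ 2 * J + 5, ‖vline σ‖ ^ k ≤ (1 + |σ|) ^ (2 * J + 5) := fun k hk =>
    (pow_le_pow_left₀ (norm_nonneg _) (norm_vline_le σ) k).trans (pow_le_pow_right₀ hT hk)
  have hterm : ∀ m ∈ Finset.range J, ‖(ε : ℂ) ^ (m + 1) *
      (2 * vline σ ^ (2 * m + 5) / (2 * m + 5).factorial +
        w * vline σ ^ (2 * m + 3) / (2 * m + 3).factorial)‖ ≤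
      ε * ((2 + R) * (1 + |σ|) ^ (2 * J + 5)) := fun m hm => by
    have hm' := Finset.mem_range.1 hm
    rw [norm_mul, norm_pow, Complex.norm_real, Real.norm_eq_abs, abs_of_nonneg hε]
    gcongr
    · rw [pow_succ]
      exact mul_le_of_le_one_left hε (pow_le_one₀ hε hε1)
    · refine (norm_add_le _ _).trans ?_
      rw [norm_div, norm_div, norm_mul, norm_mul, norm_pow, norm_pow, Complex.norm_natCast,
        Complex.norm_natCast, Complex.norm_two, Complex.norm_real, Real.norm_eq_abs, add_mul]
      refine add_le_add ((div_le_self (by positivity) (hfac _)).trans ?_)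
        ((div_le_self (by positivity) (hfac _)).trans ?_)
      · gcongr
        exact hpow _ (by omega)
      · gcongr
        exact hpow _ (by omega)
  refine (norm_sum_le_of_le _ hterm).trans_eq ?_
  rw [Finset.sum_const, Finset.card_range, nsmul_eq_mul]
  ring

lemma norm_phaseDiff_sub_le (J : ℕ) {R δ w σ : ℝ} (hδ : 0 < δ) (hw : |w| ≤ R)
    (hσ : δ * (1 + |σ|) ≤ 5) :
    ‖phaseDiff δ w σ - phasePoly J (δ ^ 2 : ℝ) w (vline σ)‖ ≤
      (δ ^ 2) ^ (J + 1) * ((2 + R) * Real.exp 5 * (1 + |σ|) ^ (2 * J + 5)) := by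
  have hT := one_le_weight σ
  have hδ' : (δ : ℂ) ≠ 0 := Complex.ofReal_ne_zero.2 hδ.ne'
  have hR : 0 ≤ R := (abs_nonneg w).trans hw
  set t := vline σ with ht
  have hz : ‖(δ : ℂ) * t‖ ≤ δ * (1 + |σ|) := by
    rw [norm_mul, Complex.norm_real, Real.norm_eq_abs, abs_of_pos hδ]
    gcongr
    exact norm_vline_le σ
  have hexp : Real.exp ‖(δ : ℂ) * t‖ ≤ Real.exp 5 := Real.exp_le_exp.2 (hz.trans hσ)
  -- the phase difference, as a combination of remainders of the series of `sinh`
  have hpoly : phaseDiff δ w σ - phasePoly J (δ ^ 2 : ℝ) w t =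
      2 / δ ^ 3 * (Complex.sinh (δ * t) - ∑ m ∈ Finset.range (J + 2),
        (δ * t) ^ (2 * m + 1) / (2 * m + 1).factorial) +
      w / δ * (Complex.sinh (δ * t) - ∑ m ∈ Finset.range (J + 1),
        (δ * t) ^ (2 * m + 1) / (2 * m + 1).factorial) := by
    have e1 : ∑ m ∈ Finset.range (J + 2), ((δ : ℂ) * t) ^ (2 * m + 1) / (2 * m + 1).factorial =
        (∑ m ∈ Finset.range J, ((δ : ℂ) * t) ^ (2 * m + 5) / (2 * m + 5).factorial) +
          (δ * t) ^ 3 / 6 + δ * t := by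
      rw [Finset.sum_range_succ', Finset.sum_range_succ']
      simp [Nat.factorial, mul_add, add_assoc]
    have e2 : ∑ m ∈ Finset.range (J + 1), ((δ : ℂ) * t) ^ (2 * m + 1) / (2 * m + 1).factorial =
        (∑ m ∈ Finset.range J, ((δ : ℂ) * t) ^ (2 * m + 3) / (2 * m + 3).factorial) + δ * t := by
      rw [Finset.sum_range_succ']
      simp [Nat.factorial, mul_add, add_assoc]
    have e3 : phasePoly J (δ ^ 2 : ℝ) w t =
        2 / δ ^ 3 * (∑ m ∈ Finset.range J, ((δ : ℂ) * t) ^ (2 * m + 5) / (2 * m + 5).factorial) +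
        w / δ * (∑ m ∈ Finset.range J, ((δ : ℂ) * t) ^ (2 * m + 3) / (2 * m + 3).factorial) := by
      rw [phasePoly, Finset.mul_sum, Finset.mul_sum, ← Finset.sum_add_distrib]
      refine Finset.sum_congr rfl fun m _ => ?_
      push_cast
      field_simp
      ring
    rw [e1, e2, e3, phaseDiff]
    ring
  rw [hpoly]
  refine (norm_add_le _ _).trans ?_
  have hn : ‖(2 : ℂ) / (δ : ℂ) ^ 3‖ = 2 / δ ^ 3 := by
    rw [norm_div, norm_pow, Complex.norm_real, Complex.norm_two, Real.norm_eq_abs, abs_of_pos hδ]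
  have hn' : ‖(w : ℂ) / (δ : ℂ)‖ ≤ R / δ := by
    rw [norm_div, Complex.norm_real, Complex.norm_real, Real.norm_eq_abs, Real.norm_eq_abs,
      abs_of_pos hδ]
    gcongr
  rw [norm_mul, norm_mul, hn]
  have h1 : ‖(δ : ℂ) * t‖ ^ (2 * (J + 2) + 1) * Real.exp ‖(δ : ℂ) * t‖ ≤
      (δ * (1 + |σ|)) ^ (2 * (J + 2) + 1) * Real.exp 5 := by gcongr
  have h2 : ‖(δ : ℂ) * t‖ ^ (2 * (J + 1) + 1) * Real.exp ‖(δ : ℂ) * t‖ ≤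
      (δ * (1 + |σ|)) ^ (2 * (J + 1) + 1) * Real.exp 5 := by gcongr
  have h3 : (1 + |σ|) ^ (2 * (J + 1) + 1) ≤ (1 + |σ|) ^ (2 * J + 5) :=
    pow_le_pow_right₀ hT (by omega)
  calc _ ≤ 2 / δ ^ 3 * ((δ * (1 + |σ|)) ^ (2 * (J + 2) + 1) * Real.exp 5) +
        R / δ * ((δ * (1 + |σ|)) ^ (2 * (J + 1) + 1) * Real.exp 5) :=
        add_le_add (mul_le_mul_of_nonneg_left ((norm_sinh_sub_sum_le _ _).trans h1) (by positivity))
          (mul_le_mul hn' ((norm_sinh_sub_sum_le _ _).trans h2) (norm_nonneg _) (by positivity))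
    _ = (δ ^ 2) ^ (J + 1) * (2 * Real.exp 5 * (1 + |σ|) ^ (2 * J + 5) +
        R * Real.exp 5 * (1 + |σ|) ^ (2 * (J + 1) + 1)) := by
        rw [mul_pow, mul_pow]
        field_simp
        ring
    _ ≤ (δ ^ 2) ^ (J + 1) * (2 * Real.exp 5 * (1 + |σ|) ^ (2 * J + 5) +
        R * Real.exp 5 * (1 + |σ|) ^ (2 * J + 5)) := by gcongr
    _ = _ := by ring

/-- The rate of Gaussian decay of `scaledExp` along the segment. -/
def decayRate : ℝ := 2 / Real.pi ^ 2

lemma decayRate_pos : 0 < decayRate := by have := Real.pi_pos; unfold decayRate; positivity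

lemma decayRate_le_one : decayRate ≤ 1 := by
  have := Real.pi_gt_three
  rw [decayRate, div_le_one (by positivity)]
  nlinarith

/-- A bound for `scaledExp` and `airyExp` when `|w| ≤ R`, up to the Gaussian factor. -/
def expBound (R : ℝ) : ℝ := Real.exp (2 * Real.exp 1 + R * (1 + Real.exp 1) + 1)

lemma norm_airyExp_le {R w : ℝ} (hR : 1 ≤ R) (hw : |w| ≤ R) (σ : ℝ) :
    ‖airyExp w σ‖ ≤ expBound R * Real.exp (-1 * σ ^ 2) := by
  rw [norm_airyExp, expBound, ← Real.exp_add]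
  have h1 := Real.exp_pos 1
  have h2 := (abs_le.1 hw).2
  have : 0 ≤ R * Real.exp 1 := by positivity
  exact Real.exp_le_exp.2 (by linarith)

lemma sinh_sub_self_le {δ : ℝ} (hδ : 0 ≤ δ) (hδ1 : δ ≤ 1) :
    Real.sinh δ - δ ≤ δ ^ 3 * Real.exp 1 := by
  have h := norm_sinh_sub_sum_le 1 (δ : ℂ)
  simp only [Finset.sum_range_one, mul_zero, zero_add, pow_one, Nat.factorial_one, Nat.cast_one,
    div_one, mul_one, Complex.norm_real, Real.norm_eq_abs, abs_of_nonneg hδ] at h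
  rw [← Complex.ofReal_sinh, ← Complex.ofReal_sub, Complex.norm_real] at h
  refine (le_abs_self _).trans (h.trans ?_)
  gcongr

/-- Gaussian decay along the segment, uniform in `δ`: the real part of `sinh (δ + iθ)` is
`sinh δ cos θ`, and `cos θ ≤ 1 - 2 θ² / π²` for `|θ| ≤ π`. -/
lemma norm_scaledExp_le {R δ w σ : ℝ} (hR : 1 ≤ R) (hδ : 0 < δ) (hRδ : R * δ ^ 2 ≤ 1)
    (hw : |w| ≤ R) (hσ : |δ * σ| ≤ Real.pi) :
    ‖scaledExp δ w σ‖ ≤ expBound R * Real.exp (-decayRate * σ ^ 2) := by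
  have hδ1 : δ ≤ 1 := by nlinarith
  have hπ := Real.pi_pos
  have hre : ((2 / (δ : ℂ) ^ 3 + w / δ) * Complex.sinh (δ * vline σ) -
      2 / (δ : ℂ) ^ 3 * (δ * vline σ)).re =
      (2 / δ ^ 3 + w / δ) * (Real.sinh δ * Real.cos (δ * σ)) - 2 / δ ^ 3 * δ := by
    have h1 : Complex.sinh (δ * vline σ) =
        ((Real.sinh δ * Real.cos (δ * σ) : ℝ) : ℂ) +
          ((Real.cosh δ * Real.sin (δ * σ) : ℝ) : ℂ) * Complex.I := by
      rw [vline, mul_add, mul_one, ← mul_assoc, Complex.sinh_add, Complex.cosh_mul_I,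
        Complex.sinh_mul_I]
      push_cast
      ring
    have h2 : (2 / (δ : ℂ) ^ 3 + w / δ) = ((2 / δ ^ 3 + w / δ : ℝ) : ℂ) := by push_cast; rfl
    have h3 : (2 / (δ : ℂ) ^ 3 * (δ * vline σ)) = ((2 / δ ^ 3 * δ : ℝ) : ℂ) * vline σ := by
      push_cast; ring
    rw [h1, h2, h3, Complex.sub_re, Complex.re_ofReal_mul, Complex.re_ofReal_mul, vline]
    simp only [Complex.add_re, Complex.ofReal_re, Complex.re_ofReal_mul, Complex.I_re, mul_zero,
      add_zero, Complex.one_re, mul_one]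
  rw [scaledExp, Complex.norm_exp, hre, expBound, ← Real.exp_add]
  refine Real.exp_le_exp.2 ?_
  have hcos := Real.cos_le_one_sub_mul_cos_sq hσ
  have hsinh : δ ≤ Real.sinh δ := Real.self_le_sinh_iff.2 hδ.le
  have hsub := sinh_sub_self_le hδ.le hδ1
  have hw' := abs_le.1 hw
  have hx : 1 / δ ^ 3 ≤ 2 / δ ^ 3 + w / δ := by
    rw [show 2 / δ ^ 3 + w / δ = (2 + w * δ ^ 2) / δ ^ 3 by field_simp]
    gcongr
    nlinarith [sq_nonneg δ]
  have hx0 : 0 ≤ 2 / δ ^ 3 + w / δ := le_trans (by positivity) hx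
  -- the gain from the cosine
  have hgain : decayRate * σ ^ 2 ≤
      (2 / δ ^ 3 + w / δ) * (Real.sinh δ * (2 / Real.pi ^ 2 * (δ * σ) ^ 2)) := by
    calc decayRate * σ ^ 2 = 1 / δ ^ 3 * (δ * (2 / Real.pi ^ 2 * (δ * σ) ^ 2)) := by
          rw [decayRate]; field_simp
      _ ≤ _ := by gcongr
  have hmain : (2 / δ ^ 3 + w / δ) * (Real.sinh δ * Real.cos (δ * σ)) ≤
      (2 / δ ^ 3 + w / δ) * Real.sinh δ - decayRate * σ ^ 2 := by
    have hs0 : 0 ≤ Real.sinh δ := hδ.le.trans hsinh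
    calc _ ≤ (2 / δ ^ 3 + w / δ) * (Real.sinh δ * (1 - 2 / Real.pi ^ 2 * (δ * σ) ^ 2)) := by
          gcongr
      _ ≤ _ := by linarith
  have hone : 2 / δ ^ 3 * (Real.sinh δ - δ) ≤ 2 * Real.exp 1 := by
    calc 2 / δ ^ 3 * (Real.sinh δ - δ) ≤ 2 / δ ^ 3 * (δ ^ 3 * Real.exp 1) := by gcongr
      _ = _ := by field_simp
  have htwo : w / δ * Real.sinh δ ≤ R * (1 + Real.exp 1) := by
    have : Real.sinh δ ≤ δ * (1 + Real.exp 1) := by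
      have : δ ^ 3 * Real.exp 1 ≤ δ * Real.exp 1 := by
        gcongr
        exact pow_le_of_le_one hδ.le hδ1 (by norm_num)
      linarith
    calc w / δ * Real.sinh δ ≤ R / δ * (δ * (1 + Real.exp 1)) := by
          have := hδ.le.trans hsinh
          have := hw'.2
          gcongr
      _ = _ := by field_simp
  linarith

lemma norm_amplitudePoly_le (J : ℕ) {R ε w : ℝ} (hR : 1 ≤ R) (hε : 0 ≤ ε) (hε1 : ε ≤ 1)
    (hw : |w| ≤ R) (σ : ℝ) :
    ‖amplitudePoly J ε w (vline σ)‖ ≤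
      (J + 1) * (((J + 1) * (2 + R)) ^ J * (1 + |σ|) ^ ((2 * J + 5) * J)) := by
  have hT := one_le_weight σ
  set B := (J + 1) * (2 + R) * (1 + |σ|) ^ (2 * J + 5) with hB
  have hJ : (0 : ℝ) ≤ J := J.cast_nonneg
  have hB1 : 1 ≤ B := one_le_mul_of_one_le_of_one_le
    (by nlinarith) (one_le_pow₀ hT)
  have hY : ‖phasePoly J ε w (vline σ)‖ ≤ B := by
    refine (norm_phasePoly_le J hR hε hε1 hw σ).trans ((mul_le_of_le_one_left (by positivity)
      hε1).trans ?_)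
    rw [hB]
    gcongr
    linarith
  have hterm : ∀ k ∈ Finset.range (J + 1), ‖phasePoly J ε w (vline σ) ^ k / k.factorial‖ ≤ B ^ J :=
    fun k hk => by
      rw [norm_div, norm_pow, Complex.norm_natCast]
      refine (div_le_self (by positivity) (by exact_mod_cast Nat.succ_le_of_lt k.factorial_pos)
        ).trans ?_
      calc _ ≤ B ^ k := by gcongr
        _ ≤ B ^ J := pow_le_pow_right₀ hB1 (Nat.lt_succ_iff.1 (Finset.mem_range.1 hk))
  refine (norm_sum_le_of_le _ hterm).trans_eq ?_
  rw [Finset.sum_const, Finset.card_range, nsmul_eq_mul, hB, mul_pow, ← pow_mul]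
  push_cast
  ring

/-- The pointwise estimate: on the segment, `scaledExp` agrees with its expansion up to
`(δ²)^(J + 1)` times a Gaussian weight. -/
lemma norm_scaledExp_sub_le (J : ℕ) {R : ℝ} (hR : 1 ≤ R) : ∃ C N, ∀ δ w σ : ℝ, 0 < δ →
    R * δ ^ 2 ≤ 1 → |w| ≤ R → |δ * σ| ≤ Real.pi →
    ‖scaledExp δ w σ - amplitudePoly J (δ ^ 2 : ℝ) w (vline σ) * airyExp w σ‖ ≤
      (δ ^ 2) ^ (J + 1) * (C * ((1 + |σ|) ^ N * Real.exp (-decayRate * σ ^ 2))) := by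
  set c₁ := (2 + R) * Real.exp 5 with hc₁
  set c₂ := (J + 1) * (2 + R) * Real.exp 5 with hc₂
  refine ⟨expBound R * (c₂ ^ (J + 1) + ∑ k ∈ Finset.range (J + 1), k * c₂ ^ J * c₁),
    (2 * J + 5) * (J + 1), fun δ w σ hδ hRδ hw hσ => ?_⟩
  have hT := one_le_weight σ
  have hπ := Real.pi_lt_four
  have hJ : (0 : ℝ) ≤ J := J.cast_nonneg
  have hδ1 : δ ≤ 1 := by nlinarith
  have hε0 : 0 ≤ δ ^ 2 := sq_nonneg δ
  have hε1 : δ ^ 2 ≤ 1 := pow_le_one₀ hδ.le hδ1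
  have he5 : 1 ≤ Real.exp 5 := Real.one_le_exp (by norm_num)
  have hσ5 : δ * (1 + |σ|) ≤ 5 := by
    rw [abs_mul, abs_of_pos hδ] at hσ
    linarith
  set T := (1 + |σ|) ^ (2 * J + 5) with hTdef
  have hT1 : 1 ≤ T := one_le_pow₀ hT
  set y := phaseDiff δ w σ with hy
  set Y := phasePoly J (δ ^ 2 : ℝ) w (vline σ) with hYdef
  have hyY : ‖y - Y‖ ≤ (δ ^ 2) ^ (J + 1) * (c₁ * T) := norm_phaseDiff_sub_le J hδ hw hσ5
  have hY : ‖Y‖ ≤ δ ^ 2 * (J * (2 + R) * T) := norm_phasePoly_le J hR hε0 hε1 hw σ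
  have hJR : J * (2 + R) ≤ J * (2 + R) * Real.exp 5 := le_mul_of_one_le_right (by positivity) he5
  have hY' : ‖Y‖ ≤ δ ^ 2 * (c₂ * T) := hY.trans (by
    have : J * (2 + R) ≤ c₂ := hJR.trans (by rw [hc₂]; gcongr; linarith)
    gcongr)
  have hyn : ‖y‖ ≤ δ ^ 2 * (c₂ * T) := by
    have h1 : ‖y‖ ≤ ‖y - Y‖ + ‖Y‖ := by simpa using norm_add_le (y - Y) Y
    have h2 : (δ ^ 2) ^ (J + 1) ≤ δ ^ 2 := pow_le_of_le_one hε0 hε1 (Nat.succ_ne_zero J)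
    calc ‖y‖ ≤ δ ^ 2 * (c₁ * T) + δ ^ 2 * (J * (2 + R) * T) := h1.trans (add_le_add
          (hyY.trans (by gcongr)) hY)
      _ ≤ δ ^ 2 * (c₁ * T) + δ ^ 2 * (J * (2 + R) * Real.exp 5 * T) := by
        gcongr δ ^ 2 * (c₁ * T) + δ ^ 2 * (?_ * T)
      _ = _ := by rw [hc₁, hc₂]; ring
  have hB1 : 1 ≤ c₂ * T := one_le_mul_of_one_le_of_one_le
    (one_le_mul_of_one_le_of_one_le (by nlinarith) he5) hT1
  have hyB : ‖y‖ ≤ c₂ * T := hyn.trans (mul_le_of_le_one_left (by positivity) hε1)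
  have hYB : ‖Y‖ ≤ c₂ * T := hY'.trans (mul_le_of_le_one_left (by positivity) hε1)
  -- the remainder of the exponential series
  have hE : Real.exp (-1 * σ ^ 2) ≤ Real.exp (-decayRate * σ ^ 2) := by
    have := decayRate_le_one
    have := sq_nonneg σ
    exact Real.exp_le_exp.2 (by nlinarith)
  have hEb : 0 ≤ expBound R := (Real.exp_pos _).le
  have hA : ‖airyExp w σ‖ ≤ expBound R * Real.exp (-decayRate * σ ^ 2) :=
    (norm_airyExp_le hR hw σ).trans (by gcongr)
  have hmax : ‖airyExp w σ‖ * max 1 (Real.exp y.re) ≤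
      expBound R * Real.exp (-decayRate * σ ^ 2) := by
    rw [mul_max_of_nonneg _ _ (norm_nonneg _), mul_one, ← Complex.norm_exp, ← norm_mul,
      hy, ← scaledExp_eq hδ.ne']
    exact max_le hA (norm_scaledExp_le hR hδ hRδ hw hσ)
  have h1 : ‖airyExp w σ * (Complex.exp y - ∑ k ∈ Finset.range (J + 1), y ^ k / k.factorial)‖ ≤
      (δ ^ 2) ^ (J + 1) * (expBound R * c₂ ^ (J + 1) * (T ^ (J + 1) *
        Real.exp (-decayRate * σ ^ 2))) := by
    rw [norm_mul]
    calc _ ≤ ‖airyExp w σ‖ * (‖y‖ ^ (J + 1) * max 1 (Real.exp y.re)) := by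
          gcongr
          exact norm_exp_sub_sum_le _ _
      _ = ‖y‖ ^ (J + 1) * (‖airyExp w σ‖ * max 1 (Real.exp y.re)) := by ring
      _ ≤ (δ ^ 2 * (c₂ * T)) ^ (J + 1) * (expBound R * Real.exp (-decayRate * σ ^ 2)) := by gcongr
      _ = _ := by rw [mul_pow, mul_pow]; ring
  -- the replacement of `y` by its Taylor polynomial
  have h2 : ‖airyExp w σ * ((∑ k ∈ Finset.range (J + 1), y ^ k / k.factorial) -
      ∑ k ∈ Finset.range (J + 1), Y ^ k / k.factorial)‖ ≤
      (δ ^ 2) ^ (J + 1) * (expBound R * (∑ k ∈ Finset.range (J + 1), k * c₂ ^ J * c₁) *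
        (T ^ (J + 1) * Real.exp (-decayRate * σ ^ 2))) := by
    rw [norm_mul, ← Finset.sum_sub_distrib]
    have hc21 : 1 ≤ c₂ := one_le_mul_of_one_le_of_one_le (by nlinarith) he5
    have hterm : ∀ k ∈ Finset.range (J + 1), ‖y ^ k / (k.factorial : ℂ) - Y ^ k / k.factorial‖ ≤
        (k * c₂ ^ J * c₁) * ((δ ^ 2) ^ (J + 1) * T ^ (J + 1)) := fun k hk => by
      rw [← sub_div, norm_div, Complex.norm_natCast]
      refine (div_le_self (norm_nonneg _) (by exact_mod_cast Nat.succ_le_of_lt k.factorial_pos)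
        ).trans ((norm_pow_sub_pow_le' hB1 hyB hYB k).trans ?_)
      have hk' : k ≤ J := Nat.lt_succ_iff.1 (Finset.mem_range.1 hk)
      calc k * (c₂ * T) ^ k * ‖y - Y‖ ≤ k * (c₂ * T) ^ J * ((δ ^ 2) ^ (J + 1) * (c₁ * T)) := by
            gcongr
        _ = _ := by rw [mul_pow]; ring
    calc _ ≤ (expBound R * Real.exp (-decayRate * σ ^ 2)) *
          ∑ k ∈ Finset.range (J + 1), (k * c₂ ^ J * c₁) * ((δ ^ 2) ^ (J + 1) * T ^ (J + 1)) :=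
          mul_le_mul hA (norm_sum_le_of_le _ hterm) (norm_nonneg _) (by positivity)
      _ = _ := by rw [← Finset.sum_mul]; ring
  have hsplit : scaledExp δ w σ - amplitudePoly J (δ ^ 2 : ℝ) w (vline σ) * airyExp w σ =
      airyExp w σ * (Complex.exp y - ∑ k ∈ Finset.range (J + 1), y ^ k / k.factorial) +
      airyExp w σ * ((∑ k ∈ Finset.range (J + 1), y ^ k / k.factorial) -
        ∑ k ∈ Finset.range (J + 1), Y ^ k / k.factorial) := by
    rw [scaledExp_eq hδ.ne', amplitudePoly]
    ring
  rw [hsplit]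
  refine (norm_add_le _ _).trans ((add_le_add h1 h2).trans_eq ?_)
  have hTp : (1 + |σ|) ^ ((2 * J + 5) * (J + 1)) = T ^ (J + 1) := pow_mul _ _ _
  rw [hTp]
  ring

lemma continuous_scaledExp (δ w : ℝ) : Continuous (scaledExp δ w) := by
  have h1 := continuous_vline
  have h2 : Continuous fun σ => Complex.sinh (δ * vline σ) :=
    Complex.continuous_sinh.comp (by fun_prop)
  unfold scaledExp
  fun_prop

/-- The segment part of Schläfli's integral, in the scaled variable. -/
lemma schlafliSegment_eq {δ : ℝ} (hδ : 0 < δ) (w : ℝ) :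
    schlafliSegment (2 / δ ^ 3) δ 0 (2 / δ ^ 3 + w / δ) =
      δ * ∫ σ in (-(Real.pi / δ))..(Real.pi / δ), scaledExp δ w σ := by
  have h := intervalIntegral.integral_comp_mul_left (a := -(Real.pi / δ)) (b := Real.pi / δ)
    (fun θ : ℝ => Complex.sinh (δ + θ * Complex.I) ^ 0 *
      Complex.exp (((2 / δ ^ 3 + w / δ : ℝ) : ℂ) * Complex.sinh (δ + θ * Complex.I) -
        ((2 / δ ^ 3 : ℝ) : ℂ) * (δ + θ * Complex.I))) hδ.ne'
  rw [show δ * -(Real.pi / δ) = -Real.pi by field_simp,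
    show δ * (Real.pi / δ) = Real.pi by field_simp] at h
  rw [schlafliSegment]
  have hδ' : (δ : ℂ) ≠ 0 := Complex.ofReal_ne_zero.2 hδ.ne'
  have h3 : ∀ σ : ℝ, scaledExp δ w σ = Complex.sinh (δ + (δ * σ : ℝ) * Complex.I) ^ 0 *
      Complex.exp (((2 / δ ^ 3 + w / δ : ℝ) : ℂ) * Complex.sinh (δ + (δ * σ : ℝ) * Complex.I) -
        ((2 / δ ^ 3 : ℝ) : ℂ) * (δ + (δ * σ : ℝ) * Complex.I)) := fun σ => by
    have : (δ : ℂ) * vline σ = δ + (δ * σ : ℝ) * Complex.I := by rw [vline]; push_cast; ring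
    rw [scaledExp, this, pow_zero, one_mul]
    push_cast
    rfl
  simp only [h3]
  rw [h, Complex.real_smul, Complex.ofReal_inv, mul_inv_cancel_left₀ hδ']

lemma integral_scaledExp_sub_le (J : ℕ) {R : ℝ} (hR : 1 ≤ R) : ∃ C, ∀ δ w : ℝ, 0 < δ →
    R * δ ^ 2 ≤ 1 → |w| ≤ R →
    ‖(∫ σ in (-(Real.pi / δ))..(Real.pi / δ), scaledExp δ w σ) -
      ∫ σ : ℝ, amplitudePoly J (δ ^ 2 : ℝ) w (vline σ) * airyExp w σ‖ ≤ C * (δ ^ 2) ^ (J + 1) := by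
  obtain ⟨C₁, N₁, h₁⟩ := norm_scaledExp_sub_le J hR
  set C₂ := (J + 1) * ((J + 1) * (2 + R)) ^ J * expBound R with hC₂
  set N₂ := (2 * J + 5) * J + 2 * (J + 1) with hN₂
  set G : ℝ → ℝ := fun σ => C₁ * ((1 + |σ|) ^ N₁ * Real.exp (-decayRate * σ ^ 2)) +
    C₂ * ((1 + |σ|) ^ N₂ * Real.exp (-decayRate * σ ^ 2)) with hG
  have hGi : Integrable G :=
    ((integrable_gaussianWeight decayRate_pos N₁).const_mul C₁).add
      ((integrable_gaussianWeight decayRate_pos N₂).const_mul C₂)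
  refine ⟨∫ σ, G σ, fun δ w hδ hRδ hw => ?_⟩
  obtain ⟨Q, hQ⟩ := airyExpansion_eq J
  have hi := (hQ (δ ^ 2) w).1
  have hπδ : 0 < Real.pi / δ := div_pos Real.pi_pos hδ
  have hδ1 : δ ≤ 1 := by nlinarith
  have hEb : 0 ≤ expBound R := (Real.exp_pos _).le
  have hC₂0 : 0 ≤ C₂ := by positivity
  rw [intervalIntegral.integral_of_le (by linarith), ← integral_indicator measurableSet_Ioc,
    ← integral_sub (((continuous_scaledExp δ w).integrableOn_Ioc).integrable_indicator
      measurableSet_Ioc) hi, mul_comm, ← integral_const_mul]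
  refine norm_integral_le_of_norm_le (hGi.const_mul _) (Eventually.of_forall fun σ => ?_)
  have hT := one_le_weight σ
  have hC₁0 : 0 ≤ C₁ * ((1 + |σ|) ^ N₁ * Real.exp (-decayRate * σ ^ 2)) := by
    have h := (norm_nonneg _).trans (h₁ δ w 0 hδ hRδ hw (by simp [Real.pi_pos.le]))
    have hp : 0 < (δ ^ 2) ^ (J + 1) := by positivity
    have h' := nonneg_of_mul_nonneg_right h hp
    have hC : 0 ≤ C₁ := by simpa using h'
    positivity
  by_cases hσ : σ ∈ Ioc (-(Real.pi / δ)) (Real.pi / δ)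
  · have hσ' : |δ * σ| ≤ Real.pi := by
      rw [abs_mul, abs_of_pos hδ]
      have : |σ| ≤ Real.pi / δ := abs_le.2 ⟨hσ.1.le, hσ.2⟩
      calc δ * |σ| ≤ δ * (Real.pi / δ) := by gcongr
        _ = Real.pi := by field_simp
    rw [indicator_of_mem hσ]
    refine (h₁ δ w σ hδ hRδ hw hσ').trans ?_
    rw [hG]
    gcongr
    exact le_add_of_nonneg_right (by positivity)
  · -- outside the segment, `1 ≤ (δ |σ|)^(2 (J + 1))` turns Gaussian decay into powers of `δ`
    have hσ1 : 1 ≤ δ * |σ| := by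
      have : Real.pi / δ ≤ |σ| := by
        by_contra! hlt
        exact hσ ⟨(abs_lt.1 hlt).1, (abs_lt.1 hlt).2.le⟩
      calc 1 ≤ Real.pi := by linarith [Real.pi_gt_three]
        _ = δ * (Real.pi / δ) := by field_simp
        _ ≤ _ := by gcongr
    rw [indicator_of_notMem hσ, zero_sub, norm_neg, norm_mul]
    have hP := norm_amplitudePoly_le J hR (sq_nonneg δ) (pow_le_one₀ hδ.le hδ1) hw σ
    have hE : Real.exp (-1 * σ ^ 2) ≤ Real.exp (-decayRate * σ ^ 2) := by
      have := decayRate_le_one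
      have := sq_nonneg σ
      exact Real.exp_le_exp.2 (by nlinarith)
    calc _ ≤ (J + 1) * (((J + 1) * (2 + R)) ^ J * (1 + |σ|) ^ ((2 * J + 5) * J)) *
          (expBound R * Real.exp (-decayRate * σ ^ 2)) :=
          mul_le_mul hP ((norm_airyExp_le hR hw σ).trans (by gcongr)) (norm_nonneg _)
            (by positivity)
      _ = C₂ * ((1 + |σ|) ^ ((2 * J + 5) * J) * Real.exp (-decayRate * σ ^ 2)) * 1 := by
          rw [hC₂]; ring
      _ ≤ C₂ * ((1 + |σ|) ^ ((2 * J + 5) * J) * Real.exp (-decayRate * σ ^ 2)) *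
          (δ * (1 + |σ|)) ^ (2 * (J + 1)) := by
          gcongr
          exact one_le_pow₀ (hσ1.trans (by gcongr; linarith))
      _ = (δ ^ 2) ^ (J + 1) * (C₂ * ((1 + |σ|) ^ N₂ * Real.exp (-decayRate * σ ^ 2))) := by
          rw [hN₂, pow_add, mul_pow, ← pow_mul]; ring
      _ ≤ _ := by
          rw [hG]
          gcongr
          exact le_add_of_nonneg_left hC₁0

/-- The expansion of Schläfli's integral at the turning point, uniform for `|w| ≤ R`. -/
lemma schlafli_expansion (J : ℕ) {R : ℝ} (hR : 1 ≤ R) : ∃ C, ∀ δ w : ℝ, 0 < δ →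
    R * δ ^ 2 ≤ 1 → |w| ≤ R →
    |schlafli (2 / δ ^ 3) δ 0 (2 / δ ^ 3 + w / δ) / δ - airyExpansion J (δ ^ 2) w| ≤
      C * (δ ^ 2) ^ (J + 1) := by
  obtain ⟨C, hC⟩ := integral_scaledExp_sub_le J hR
  refine ⟨C + (J + 1).factorial, fun δ w hδ hRδ hw => ?_⟩
  have hδ1 : δ ≤ 1 := by nlinarith
  have hδ' : (δ : ℂ) ≠ 0 := Complex.ofReal_ne_zero.2 hδ.ne'
  have hν : 0 < 2 / δ ^ 3 := by positivity
  set x := 2 / δ ^ 3 + w / δ with hx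
  have hx0 : 0 < x := by
    rw [hx, show 2 / δ ^ 3 + w / δ = (2 + w * δ ^ 2) / δ ^ 3 by field_simp]
    have := (abs_le.1 hw).1
    have : 0 < 2 + w * δ ^ 2 := by nlinarith [sq_nonneg δ]
    positivity
  have hsplit : schlafli (2 / δ ^ 3) δ 0 x / δ - airyExpansion J (δ ^ 2) w =
      ((∫ σ in (-(Real.pi / δ))..(Real.pi / δ), scaledExp δ w σ) -
        ∫ σ : ℝ, amplitudePoly J (δ ^ 2 : ℝ) w (vline σ) * airyExp w σ).re -
      2 / δ * Real.sin (2 / δ ^ 3 * Real.pi) * schlafliRay (2 / δ ^ 3) δ 0 x := by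
    rw [schlafli, hx, schlafliSegment_eq hδ, airyExpansion, Complex.sub_re, Complex.re_ofReal_mul]
    field_simp
    ring
  -- the half-lines contribute an exponentially small term
  have hray : |schlafliRay (2 / δ ^ 3) δ 0 x| ≤ δ ^ 3 / 2 * Real.exp (-(2 / δ ^ 2)) := by
    have h1 : ‖schlafliRay (2 / δ ^ 3) δ 0 x‖ ≤ ∫ u in Ioi δ, Real.exp (-(2 / δ ^ 3) * u) :=
      norm_integral_le_of_norm_le (integrableOn_exp_neg_mul hν δ)
        ((ae_restrict_mem measurableSet_Ioi).mono fun u hu => by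
          simpa using ray_le (ν := 2 / δ ^ 3) hδ.le hx0 le_rfl hu 0)
    refine h1.trans_eq ?_
    rw [integral_exp_mul_Ioi (neg_lt_zero.2 hν)]
    rw [show -(2 / δ ^ 3) * δ = -(2 / δ ^ 2) by field_simp]
    field_simp
  have hexp : δ ^ 2 * Real.exp (-(2 / δ ^ 2)) ≤ (J + 1).factorial * (δ ^ 2) ^ (J + 1) := by
    have h := Real.pow_div_factorial_le_exp (2 / δ ^ 2) (by positivity) (J + 1)
    have hf : (0 : ℝ) < (J + 1).factorial := by exact_mod_cast (J + 1).factorial_pos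
    have h2 : ((2 / δ ^ 2) ^ (J + 1) / (J + 1).factorial)⁻¹ ≤
        (J + 1).factorial * (δ ^ 2) ^ (J + 1) := by
      rw [inv_div, div_pow, div_div_eq_mul_div]
      exact div_le_self (by positivity) (one_le_pow₀ (by norm_num))
    rw [Real.exp_neg]
    calc δ ^ 2 * (Real.exp (2 / δ ^ 2))⁻¹ ≤ 1 * (Real.exp (2 / δ ^ 2))⁻¹ := by
          gcongr
          exact pow_le_one₀ hδ.le hδ1
      _ ≤ ((2 / δ ^ 2) ^ (J + 1) / (J + 1).factorial)⁻¹ := by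
          rw [one_mul]
          gcongr
      _ ≤ _ := h2
  rw [hsplit]
  refine (abs_sub _ _).trans ?_
  rw [add_mul]
  refine add_le_add ((Complex.abs_re_le_norm _).trans (hC δ w hδ hRδ hw)) ?_
  rw [abs_mul, abs_mul, abs_of_pos (show 0 < 2 / δ by positivity)]
  calc 2 / δ * |Real.sin (2 / δ ^ 3 * Real.pi)| * |schlafliRay (2 / δ ^ 3) δ 0 x|
      ≤ 2 / δ * 1 * (δ ^ 3 / 2 * Real.exp (-(2 / δ ^ 2))) := by
        gcongr
        exact Real.abs_sin_le_one _
    _ = δ ^ 2 * Real.exp (-(2 / δ ^ 2)) := by field_simp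
    _ ≤ _ := hexp

/-! ### Localization of the Bessel zeros near the turning point -/

/-- `ρ` lists the positive zeros of `besselF s` in increasing order. -/
def IsBesselZeroSequence (s : ℝ) (ρ : ℕ → ℝ) : Prop :=
  StrictMono ρ ∧ range ρ = {x | 0 < x ∧ besselF s x = 0}

lemma IsBesselZeroSequence.pos {s : ℝ} {ρ : ℕ → ℝ} (h : IsBesselZeroSequence s ρ) (n : ℕ) :
    0 < ρ n := (h.2 ▸ mem_range_self n : ρ n ∈ {x | 0 < x ∧ besselF s x = 0}).1

lemma IsBesselZeroSequence.zero {s : ℝ} {ρ : ℕ → ℝ} (h : IsBesselZeroSequence s ρ) (n : ℕ) :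
    besselF s (ρ n) = 0 := (h.2 ▸ mem_range_self n : ρ n ∈ {x | 0 < x ∧ besselF s x = 0}).2

/-- A function with a simple zero takes values of opposite signs near it. -/
lemma exists_mul_neg_of_hasDerivAt {f : ℝ → ℝ} {f' z r : ℝ} (hf : HasDerivAt f f' z)
    (hz : f z = 0) (hf' : f' ≠ 0) (hr : 0 < r) :
    ∃ p ∈ Ioo (z - r) z, ∃ q ∈ Ioo z (z + r), f p * f q < 0 := by
  have h1 : ∀ᶠ y in 𝓝[≠] z, 0 < slope f z y * f' :=
    ((hasDerivAt_iff_tendsto_slope.1 hf).mul_const f').eventually_const_lt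
      (mul_self_pos.2 hf')
  have h2 : ∀ᶠ y in 𝓝[<] z, 0 < slope f z y * f' := h1.filter_mono (nhdsLT_le_nhdsNE z)
  have h3 : ∀ᶠ y in 𝓝[>] z, 0 < slope f z y * f' := h1.filter_mono (nhdsGT_le_nhdsNE z)
  obtain ⟨p, hp, hpz⟩ := (h2.and (Ioo_mem_nhdsLT (show z - r < z by linarith))).exists
  obtain ⟨q, hq, hqz⟩ := (h3.and (Ioo_mem_nhdsGT (show z < z + r by linarith))).exists
  refine ⟨p, hpz, q, hqz, ?_⟩
  have ep : f p = slope f z p * (p - z) := by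
    rw [slope_def_field, hz, sub_zero, div_mul_cancel₀ _ (sub_ne_zero.2 hpz.2.ne)]
  have eq : f q = slope f z q * (q - z) := by
    rw [slope_def_field, hz, sub_zero, div_mul_cancel₀ _ (sub_ne_zero.2 hqz.1.ne')]
  have hpq := mul_pos hp hq
  have hss : 0 < slope f z p * slope f z q := by
    have : slope f z p * f' * (slope f z q * f') = slope f z p * slope f z q * (f' * f') := by ring
    rw [this] at hpq
    exact pos_of_mul_pos_left hpq (mul_self_nonneg f')
  rw [ep, eq, show slope f z p * (p - z) * (slope f z q * (q - z)) =
    -(slope f z p * slope f z q * ((z - p) * (q - z))) by ring]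
  exact neg_neg_of_pos (mul_pos hss (mul_pos (sub_pos.2 hpz.2) (sub_pos.2 hqz.1)))

/-- If near each of `z 0, …, z n` there is exactly one term of the increasing sequence `W`, and all
the terms of `W` below `b` are of this kind, then the one near `z n` is `W n`. -/
lemma abs_sub_lt_of_localized {z W : ℕ → ℝ} (hz : StrictMono z) (hW : StrictMono W) {n : ℕ}
    {r b : ℝ} (hgap : ∀ k ≤ n, 2 * r ≤ z (k + 1) - z k) (hb : z n + r ≤ b)
    (hex : ∀ k ≤ n, ∃ j, |W j - z k| < r) (hall : ∀ i, W i < b → ∃ k ≤ n, |W i - z k| < r)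
    (huniq : ∀ k ≤ n, ∀ i j, |W i - z k| < r → |W j - z k| < r → i = j) : |W n - z n| < r := by
  choose! j hj using hex
  have hmono : ∀ k l, k < l → l ≤ n → j k < j l := fun k l hkl hl => by
    have h1 := (abs_lt.1 (hj k (hkl.le.trans hl))).2
    have h2 := (abs_lt.1 (hj l hl)).1
    have h3 := hgap k (hkl.le.trans hl)
    have h4 := hz.monotone (Nat.succ_le_of_lt hkl)
    exact hW.lt_iff_lt.1 (by simp only [Nat.succ_eq_add_one] at h4; linarith)
  have hle : ∀ k ≤ n, k ≤ j k := fun k => by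
    induction k with
    | zero => exact fun _ => Nat.zero_le _
    | succ k ih => exact fun hk => (ih (by omega)).trans_lt (hmono k (k + 1) (by omega) hk)
  have hsub : Finset.range (j n + 1) ⊆ (Finset.range (n + 1)).image j := fun i hi => by
    have hi' : i ≤ j n := Nat.lt_succ_iff.1 (Finset.mem_range.1 hi)
    have h1 := (abs_lt.1 (hj n le_rfl)).2
    have h2 := hW.monotone hi'
    obtain ⟨k, hk, hik⟩ := hall i (by linarith)
    exact Finset.mem_image.2 ⟨k, Finset.mem_range.2 (by omega), huniq k hk _ _ (hj k hk) hik⟩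
  have hcard := (Finset.card_le_card hsub).trans Finset.card_image_le
  rw [Finset.card_range, Finset.card_range] at hcard
  have : j n = n := le_antisymm (by omega) (hle n le_rfl)
  have h := hj n le_rfl
  rwa [this] at h

/-- Schläfli's integral near the turning point, in the scaled variable. -/
def scaledSchlafli (δ w : ℝ) : ℝ := schlafli (2 / δ ^ 3) δ 0 (2 / δ ^ 3 + w / δ) / δ

lemma scaled_pos {R δ w : ℝ} (hδ : 0 < δ) (hRδ : R * δ ^ 2 ≤ 1) (hw : |w| ≤ R) :
    1 / δ ^ 3 ≤ 2 / δ ^ 3 + w / δ := by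
  rw [show 2 / δ ^ 3 + w / δ = (2 + w * δ ^ 2) / δ ^ 3 by field_simp]
  have := (abs_le.1 hw).1
  gcongr
  nlinarith [sq_nonneg δ]

lemma continuousOn_scaledSchlafli {R δ : ℝ} (hδ : 0 < δ) (hRδ : R * δ ^ 2 ≤ 1) :
    ContinuousOn (scaledSchlafli δ) (Icc (-R) R) := by
  intro w hw
  have hx : 0 < 2 / δ ^ 3 + w / δ :=
    lt_of_lt_of_le (by positivity) (scaled_pos hδ hRδ (abs_le.2 hw))
  have h1 := (hasDerivAt_schlafli (ν := 2 / δ ^ 3) (by positivity) hδ.le hx 0).continuousAt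
  have h2 : ContinuousAt (fun w => 2 / δ ^ 3 + w / δ) w := by fun_prop
  exact ((ContinuousAt.comp (f := fun w => 2 / δ ^ 3 + w / δ) h1 h2).div_const δ
    ).continuousWithinAt

lemma scaledSchlafli_sub_le {R : ℝ} (hR : 1 ≤ R) (J : ℕ) : ∃ C, 0 ≤ C ∧ ∀ δ w : ℝ, 0 < δ →
    R * δ ^ 2 ≤ 1 → |w| ≤ R →
    |scaledSchlafli δ w - airyExpansion J (δ ^ 2) w| ≤ C * (δ ^ 2) ^ (J + 1) := by
  obtain ⟨C, hC⟩ := schlafli_expansion J hR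
  refine ⟨max C 0, le_max_right _ _, fun δ w hδ hRδ hw => (hC δ w hδ hRδ hw).trans ?_⟩
  gcongr
  exact le_max_left _ _

lemma airyExpansion_order_zero (ε w : ℝ) : airyExpansion 0 ε w = 2 * Real.pi * airyA w := by
  rw [← airyExpansion_zero 0, airyExpansion, airyExpansion]
  simp [amplitudePoly]

/-- The coefficient of the Bessel equation is of size `δ²` near the turning point. -/
lemma abs_besselCoeff_le {R δ w : ℝ} (hR : 1 ≤ R) (hδ : 0 < δ) (hRδ : R * δ ^ 2 ≤ 1)
    (hw : |w| ≤ R) : |besselCoeff (2 / δ ^ 3 + 1 / 2) (2 / δ ^ 3 + w / δ)| ≤ 6 * R * δ ^ 2 := by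
  have hx := scaled_pos hδ hRδ hw
  have hδ1 : δ ≤ 1 := by nlinarith
  have hx0 : 0 < 2 / δ ^ 3 + w / δ := lt_of_lt_of_le (by positivity) hx
  have h1 : besselCoeff (2 / δ ^ 3 + 1 / 2) (2 / δ ^ 3 + w / δ) =
      -(4 * w / δ ^ 4 + w ^ 2 / δ ^ 2 + 1 / 4) / (2 / δ ^ 3 + w / δ) ^ 2 := by
    rw [besselCoeff, div_sub_one (by positivity)]
    congr 1
    field_simp
    ring
  rw [h1, abs_div, abs_neg, abs_of_pos (show 0 < (2 / δ ^ 3 + w / δ) ^ 2 by positivity),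
    div_le_iff₀ (by positivity)]
  have h2 : (1 / δ ^ 3) ^ 2 ≤ (2 / δ ^ 3 + w / δ) ^ 2 := by gcongr
  have h3 : |4 * w / δ ^ 4 + w ^ 2 / δ ^ 2 + 1 / 4| ≤ 4 * R / δ ^ 4 + R ^ 2 / δ ^ 2 + 1 / 4 := by
    refine (abs_add_three _ _ _).trans ?_
    rw [abs_div, abs_div, abs_mul, abs_of_pos (show (0 : ℝ) < 4 by norm_num),
      abs_of_pos (show 0 < δ ^ 4 by positivity), abs_of_pos (show 0 < δ ^ 2 by positivity),
      abs_of_pos (show (0 : ℝ) < 1 / 4 by norm_num), abs_pow]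
    gcongr
  refine h3.trans ?_
  calc 4 * R / δ ^ 4 + R ^ 2 / δ ^ 2 + 1 / 4
      = (4 * R + R * (R * δ ^ 2) + δ ^ 4 / 4) / δ ^ 4 := by field_simp
    _ ≤ (4 * R + R * 1 + 1 / 4) / δ ^ 4 := by
        have : δ ^ 4 ≤ 1 := pow_le_one₀ hδ.le hδ1
        gcongr
    _ ≤ 6 * R / δ ^ 4 := by gcongr; linarith
    _ = 6 * R * δ ^ 2 * (1 / δ ^ 3) ^ 2 := by field_simp
    _ ≤ _ := by gcongr

lemma eventually_mul_sq_le (R : ℝ) : ∀ᶠ δ : ℝ in 𝓝[>] 0, R * δ ^ 2 ≤ 1 := by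
  have : Tendsto (fun δ : ℝ => R * δ ^ 2) (𝓝[>] 0) (𝓝 0) := by
    have h : Continuous fun δ : ℝ => R * δ ^ 2 := by fun_prop
    simpa using (h.tendsto 0).mono_left nhdsWithin_le_nhds
  exact (this.eventually_lt_const one_pos).mono fun δ h => h.le

/-- The scaled `n`-th Bessel zero converges to the `n`-th zero of the reverse Airy function. -/
lemma eventually_abs_zero_sub_lt {z : ℕ → ℝ} (hz : IsAiryZeroSequence z) (n : ℕ) {r₀ : ℝ}
    (hr₀ : 0 < r₀) : ∀ᶠ δ : ℝ in 𝓝[>] 0, ∀ ρ, IsBesselZeroSequence (2 / δ ^ 3 + 1 / 2) ρ →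
      |δ * (ρ n - 2 / δ ^ 3) - z n| < r₀ := by
  have hzA : ∀ k, airyA (z k) = 0 := fun k => by
    have : z k ∈ {x : ℝ | airyA x = 0} := hz.2 ▸ mem_range_self k
    exact this
  have hzpos : ∀ k, 0 < z k := fun k => airyA_zero_pos (hzA k)
  have hAc : Continuous airyA :=
    continuous_iff_continuousAt.2 fun w => (isSol_airyA w (mem_univ w)).1.continuousAt
  obtain ⟨k₀, hk₀, hmin⟩ := (Finset.range (n + 1)).exists_min_image (fun k => z (k + 1) - z k)
    ⟨0, by simp⟩
  set g := z (k₀ + 1) - z k₀ with hg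
  have hg0 : 0 < g := sub_pos.2 (hz.1 (Nat.lt_succ_self k₀))
  have hgap : ∀ k ≤ n, g ≤ z (k + 1) - z k := fun k hk =>
    hmin k (Finset.mem_range.2 (Nat.lt_succ_of_le hk))
  set R := z (n + 1) + 1 with hR
  have hR1 : 1 ≤ R := by linarith [hzpos (n + 1)]
  set r := min r₀ (min (g / 4) (1 / (5 * R))) with hr
  have hr0 : 0 < r := lt_min hr₀ (lt_min (by linarith) (by positivity))
  have hrg : r ≤ g / 4 := (min_le_right _ _).trans (min_le_left _ _)
  have hrR : r ≤ 1 / (5 * R) := (min_le_right _ _).trans (min_le_right _ _)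
  have hr1 : r < 1 := hrR.trans_lt (by rw [div_lt_one (by positivity)]; linarith)
  set b := (z n + z (n + 1)) / 2 with hb
  have hgn := hgap n le_rfl
  have hzn : ∀ k ≤ n, z k ≤ z n := fun k hk => hz.1.monotone hk
  -- away from the zeros, the Airy function is bounded below
  set K := Icc (-1) b \ ⋃ k ∈ Finset.range (n + 1), Ioo (z k - r) (z k + r) with hK
  have hKc : IsCompact K := isCompact_Icc.diff
    (isOpen_biUnion fun k _ => isOpen_Ioo)
  obtain ⟨m, hm0, hm⟩ := hKc.exists_forall_le' (f := fun w => |airyA w|) hAc.abs.continuousOn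
    (a := 0) fun w hw => by
      refine abs_pos.2 fun h0 => hw.2 ?_
      obtain ⟨k, rfl⟩ : w ∈ range z := hz.2 ▸ h0
      have hk : k < n + 1 := hz.1.lt_iff_lt.1 (by linarith [hw.1.2, hz.1 (Nat.lt_succ_self n)])
      exact mem_biUnion (Finset.mem_coe.2 (Finset.mem_range.2 hk)) ⟨by linarith, by linarith⟩
  -- sign changes at the zeros
  have hsign : ∀ k, ∃ p ∈ Ioo (z k - r) (z k), ∃ q ∈ Ioo (z k) (z k + r),
      airyA p * airyA q < 0 := fun k =>
    exists_mul_neg_of_hasDerivAt (isSol_airyA (z k) (mem_univ _)).1 (hzA k)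
      (airyA'_ne_zero (hzA k)) hr0
  choose p hp q hq hpq using hsign
  obtain ⟨C, hC0, hC⟩ := scaledSchlafli_sub_le hR1 0
  have hconv : ∀ w, |w| ≤ R → Tendsto (fun δ => scaledSchlafli δ w) (𝓝[>] 0)
      (𝓝 (2 * Real.pi * airyA w)) := fun w hw => by
    rw [tendsto_iff_norm_sub_tendsto_zero]
    refine squeeze_zero' (Eventually.of_forall fun _ => norm_nonneg _)
      (g := fun δ : ℝ => C * (δ ^ 2) ^ (0 + 1)) ?_ ?_
    · filter_upwards [eventually_mul_sq_le R, self_mem_nhdsWithin] with δ h1 h2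
      have := hC δ w h2 h1 hw
      rwa [airyExpansion_order_zero] at this
    · have h : Continuous fun δ : ℝ => C * (δ ^ 2) ^ (0 + 1) := by fun_prop
      simpa using (h.tendsto 0).mono_left nhdsWithin_le_nhds
  have habs : ∀ k ≤ n, ∀ w, |w - z k| < r → |w| ≤ R := fun k hk w hw => by
    have h1 := abs_lt.1 hw
    have h2 := hzn k hk
    have h3 := hzpos k
    rw [abs_le]
    constructor <;> linarith
  have hpk : ∀ k, |p k - z k| < r := fun k => by
    rw [abs_lt]; constructor <;> linarith [(hp k).1, (hp k).2]
  have hqk : ∀ k, |q k - z k| < r := fun k => by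
    rw [abs_lt]; constructor <;> linarith [(hq k).1, (hq k).2]
  have hneg : ∀ᶠ δ in 𝓝[>] (0 : ℝ), ∀ k ∈ Finset.range (n + 1),
      scaledSchlafli δ (p k) * scaledSchlafli δ (q k) < 0 := by
    rw [Filter.eventually_all_finset]
    intro k hk
    have hk' : k ≤ n := Nat.lt_succ_iff.1 (Finset.mem_range.1 hk)
    refine ((hconv _ (habs k hk' _ (hpk k))).mul (hconv _ (habs k hk' _ (hqk k)))
      ).eventually_lt_const ?_
    have := hpq k
    have hπ := Real.pi_pos
    rw [show 2 * Real.pi * airyA (p k) * (2 * Real.pi * airyA (q k)) =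
      (2 * Real.pi) ^ 2 * (airyA (p k) * airyA (q k)) by ring]
    exact mul_neg_of_pos_of_neg (by positivity) this
  have hCm : ∀ᶠ δ in 𝓝[>] (0 : ℝ), C * δ ^ 2 < 2 * Real.pi * m := by
    have h : Continuous fun δ : ℝ => C * δ ^ 2 := by fun_prop
    have h' : Tendsto (fun δ : ℝ => C * δ ^ 2) (𝓝[>] 0) (𝓝 0) := by
      simpa using (h.tendsto 0).mono_left nhdsWithin_le_nhds
    exact h'.eventually_lt_const (by have := Real.pi_pos; positivity)
  filter_upwards [eventually_mul_sq_le R, self_mem_nhdsWithin, hneg, hCm] with δ hRδ hδ' hneg hCm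
    ρ hρ
  have hδ : 0 < δ := hδ'
  have hδ1 : δ ≤ 1 := by nlinarith
  set ν := 2 / δ ^ 3 with hν
  have hν2 : 2 ≤ ν := by
    rw [hν, le_div_iff₀ (by positivity)]
    have : δ ^ 3 ≤ 1 := pow_le_one₀ hδ.le hδ1
    linarith
  obtain ⟨c, hc⟩ := exists_schlafli_eq (ν := ν) (A := δ) (by linarith) hδ.le
  have hxpos : ∀ w, |w| ≤ R → 0 < ν + w / δ := fun w hw =>
    lt_of_lt_of_le (by positivity) (scaled_pos hδ hRδ hw)
  have hrel : ∀ w, |w| ≤ R → √(ν + w / δ) * (δ * scaledSchlafli δ w) =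
      c * besselF (ν + 1 / 2) (ν + w / δ) := fun w hw => by
    rw [← hc _ (hxpos w hw), scaledSchlafli, mul_div_cancel₀ _ hδ.ne']
  have hc0 : c ≠ 0 := fun h => by
    have h1 := hrel (p 0) (habs 0 (Nat.zero_le n) _ (hpk 0))
    have h2 : 0 < √(ν + p 0 / δ) :=
      Real.sqrt_pos.2 (hxpos _ (habs 0 (Nat.zero_le n) _ (hpk 0)))
    rw [h, zero_mul] at h1
    have h3 := hneg 0 (by simp)
    have h4 : scaledSchlafli δ (p 0) ≠ 0 := fun h => by rw [h, zero_mul] at h3; exact lt_irrefl _ h3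
    exact (mul_ne_zero h2.ne' (mul_ne_zero hδ.ne' h4)) h1
  have hiff : ∀ w, |w| ≤ R → (scaledSchlafli δ w = 0 ↔ besselF (ν + 1 / 2) (ν + w / δ) = 0) :=
    fun w hw => by
      have h1 := hrel w hw
      have h2 : 0 < √(ν + w / δ) := Real.sqrt_pos.2 (hxpos w hw)
      constructor <;> intro h
      · rw [h, mul_zero, mul_zero] at h1
        exact (mul_eq_zero.1 h1.symm).resolve_left hc0
      · rw [h, mul_zero] at h1
        exact (mul_eq_zero.1 ((mul_eq_zero.1 h1).resolve_left h2.ne')).resolve_left hδ.ne'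
  have hρW : ∀ j, ν + (δ * (ρ j - ν)) / δ = ρ j := fun j => by field_simp; ring
  refine (abs_sub_lt_of_localized (W := fun j => δ * (ρ j - ν)) hz.1
    (fun i j hij => mul_lt_mul_of_pos_left (sub_lt_sub_right (hρ.1 hij) ν) hδ) (r := r) (b := b)
    (fun k hk => by linarith [hgap k hk]) (by linarith) (fun k hk => ?_) (fun i hi => ?_)
    fun k hk i j hi hj => ?_).trans_le (min_le_left _ _)
  · -- existence, by the sign change
    have hcont : ContinuousOn (scaledSchlafli δ) (Icc (p k) (q k)) :=
      (continuousOn_scaledSchlafli hδ hRδ).mono fun w hw => by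
        have := abs_le.1 (habs k hk _ (hpk k))
        have := abs_le.1 (habs k hk _ (hqk k))
        exact ⟨by linarith [hw.1], by linarith [hw.2]⟩
    have hpqk : p k ≤ q k := by linarith [(hp k).2, (hq k).1]
    obtain ⟨w, hw, hw0⟩ : ∃ w ∈ Icc (p k) (q k), scaledSchlafli δ w = 0 := by
      have hn := hneg k (Finset.mem_range.2 (Nat.lt_succ_of_le hk))
      rcases mul_neg_iff.1 hn with ⟨h1, h2⟩ | ⟨h1, h2⟩
      · exact intermediate_value_Icc' hpqk hcont ⟨h2.le, h1.le⟩
      · exact intermediate_value_Icc hpqk hcont ⟨h1.le, h2.le⟩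
    have hwk : |w - z k| < r := by
      rw [abs_lt]; constructor <;> linarith [hw.1, hw.2, (hp k).1, (hq k).2]
    have hwR := habs k hk w hwk
    obtain ⟨j, hj⟩ : ν + w / δ ∈ range ρ := hρ.2 ▸ ⟨hxpos w hwR, (hiff w hwR).1 hw0⟩
    refine ⟨j, ?_⟩
    have : δ * (ρ j - ν) = w := by rw [hj]; field_simp; ring
    rw [this]
    exact hwk
  · -- no zeros elsewhere
    have hlow : -1 ≤ δ * (ρ i - ν) := by
      by_contra! hlt
      have h1 := lt_sq_of_besselF_eq_zero (s := ν + 1 / 2) (by linarith) (hρ.pos i) (hρ.zero i)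
      have h2 : ρ i < ν - 1 / δ := by
        have : 1 / δ < ν - ρ i := by rw [div_lt_iff₀ hδ]; linarith
        linarith
      have h3 : ρ i ^ 2 ≤ (ν - 1 / δ) ^ 2 := pow_le_pow_left₀ (hρ.pos i).le h2.le 2
      have h4 : (ν - 1 / δ) ^ 2 ≤ ν ^ 2 - 3 := by
        have : ν ^ 2 - 3 - (ν - 1 / δ) ^ 2 = (4 - δ ^ 2 - 3 * δ ^ 4) / δ ^ 4 := by
          rw [hν]; field_simp; ring
        have h5 : δ ^ 2 ≤ 1 := pow_le_one₀ hδ.le hδ1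
        have h6 : δ ^ 4 ≤ 1 := pow_le_one₀ hδ.le hδ1
        have h7 : 0 ≤ (4 - δ ^ 2 - 3 * δ ^ 4) / δ ^ 4 := div_nonneg (by linarith) (by positivity)
        linarith
      nlinarith
    have hWR : |δ * (ρ i - ν)| ≤ R := by
      have hi' : δ * (ρ i - ν) < b := hi
      rw [abs_le]
      constructor <;> linarith [hz.1 (Nat.lt_succ_self n)]
    have h0 : scaledSchlafli δ (δ * (ρ i - ν)) = 0 := by
      rw [hiff _ hWR, hρW]
      exact hρ.zero i
    by_contra! hne
    have hmem : δ * (ρ i - ν) ∈ K := by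
      refine ⟨⟨hlow, le_of_lt hi⟩, fun hmem => ?_⟩
      simp only [mem_iUnion, Finset.mem_range] at hmem
      obtain ⟨k, hk, hk1, hk2⟩ := hmem
      refine absurd (hne k (Nat.lt_succ_iff.1 hk)) (not_le.2 ?_)
      rw [abs_lt]
      constructor <;> linarith
    have h1 := hm _ hmem
    have h2 := hC δ _ hδ hRδ hWR
    rw [h0, airyExpansion_order_zero, zero_sub, abs_neg, abs_mul, zero_add, pow_one,
      abs_of_pos (by have := Real.pi_pos; positivity)] at h2
    have : 2 * Real.pi * m ≤ 2 * Real.pi * |airyA (δ * (ρ i - ν))| := by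
      have := Real.pi_pos
      gcongr
    linarith
  · -- uniqueness, by the spacing of the zeros
    by_contra hij
    wlog hlt : i < j generalizing i j
    · exact this j i hj hi (Ne.symm hij) (lt_of_le_of_ne (not_lt.1 hlt) (Ne.symm hij))
    have hρlt := hρ.1 hlt
    have hsub : Icc (ρ i) (ρ j) ⊆ Ioi 0 := fun x hx => (hρ.pos i).trans_le hx.1
    refine (isSol_besselF (s := ν + 1 / 2) (by linarith)).zero_unique ordConnected_Ioi
      (continuousOn_besselCoeff _ subset_rfl) (exists_besselF_ne_zero (by linarith)) hsub
      (M := 6 * R * δ ^ 2) (d := 2 * r / δ) (fun x hx => ?_) ?_ ?_ (hρ.zero i) (hρ.zero j) hρlt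
    · have hw : |δ * (x - ν)| ≤ R := by
        refine habs k hk _ (abs_lt.2 ⟨?_, ?_⟩)
        · refine (abs_lt.1 hi).1.trans_le ?_
          have := hx.1
          gcongr
        · refine lt_of_le_of_lt ?_ (abs_lt.1 hj).2
          have := hx.2
          gcongr
      have := abs_besselCoeff_le hR1 hδ hRδ hw
      rwa [← hν, show ν + δ * (x - ν) / δ = x by field_simp; ring] at this
    · rw [le_div_iff₀ hδ]
      have h1 := (abs_lt.1 hi).1
      have h2 := (abs_lt.1 hj).2
      linarith
    · have h1 : 6 * R * δ ^ 2 * (2 * r / δ) ^ 2 = 24 * R * r ^ 2 := by field_simp; ring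
      rw [h1]
      calc 24 * R * r ^ 2 ≤ 24 * R * (1 / (5 * R)) ^ 2 := by gcongr
        _ = 24 / (25 * R) := by field_simp; ring
        _ < 1 := by rw [div_lt_one (by positivity)]; linarith

/-! ### Full expansion of the Bessel zeros -/

lemma scaledSchlafli_zero {R δ w : ℝ} (hδ : 0 < δ) (hRδ : R * δ ^ 2 ≤ 1) (hδ1 : δ ≤ 1)
    (hw : |w| ≤ R) (h0 : besselF (2 / δ ^ 3 + 1 / 2) (2 / δ ^ 3 + w / δ) = 0) :
    scaledSchlafli δ w = 0 := by
  have hν : 1 / 2 < 2 / δ ^ 3 := by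
    rw [lt_div_iff₀ (by positivity)]
    have : δ ^ 3 ≤ 1 := pow_le_one₀ hδ.le hδ1
    linarith
  have hx : 0 < 2 / δ ^ 3 + w / δ :=
    lt_of_lt_of_le (by positivity) (scaled_pos hδ hRδ hw)
  obtain ⟨c, hc⟩ := exists_schlafli_eq hν hδ.le
  have h := hc _ hx
  rw [h0, mul_zero] at h
  rw [scaledSchlafli, (mul_eq_zero.1 h).resolve_left (Real.sqrt_pos.2 hx).ne', zero_div]

lemma isInvertible_of_ne_zero {L : ℝ →L[ℝ] ℝ} (h : L 1 ≠ 0) : L.IsInvertible := by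
  refine ⟨ContinuousLinearEquiv.unitsEquivAut ℝ (Units.mk0 (L 1) h), ?_⟩
  ext
  simp

/-- The scaled `n`-th Bessel zero agrees to every order with a smooth function of `δ²`, the zero of
the truncated expansion given by the implicit function theorem. -/
lemma exists_contDiffAt_zero {z : ℕ → ℝ} (hz : IsAiryZeroSequence z) (n J : ℕ) :
    ∃ ψ : ℝ → ℝ, ContDiffAt ℝ (J + 1 : ℕ) ψ 0 ∧ ψ 0 = z n ∧ ∃ C, ∀ᶠ δ : ℝ in 𝓝[>] 0,
      ∀ ρ, IsBesselZeroSequence (2 / δ ^ 3 + 1 / 2) ρ →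
        |δ * (ρ n - 2 / δ ^ 3) - ψ (δ ^ 2)| ≤ C * (δ ^ 2) ^ (J + 1) := by
  have hzA : airyA (z n) = 0 := by
    have : z n ∈ {x : ℝ | airyA x = 0} := hz.2 ▸ mem_range_self n
    exact this
  have hzpos := airyA_zero_pos hzA
  set f : (ℝ × ℝ) × ℝ → ℝ := fun v => airyExpansion J v.1.1 v.2 - v.1.2 with hf
  set u : (ℝ × ℝ) × ℝ := ((0, 0), z n) with hu
  have hfu : f u = 0 := by simp [hf, hu, airyExpansion_zero, hzA]
  have hcd : ContDiff ℝ (J + 1 : ℕ) f :=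
    ((contDiff_airyExpansion (J + 1) J).comp
      ((contDiff_fst.comp contDiff_fst).prodMk contDiff_snd)).sub (contDiff_snd.comp contDiff_fst)
  have hn0 : ((J + 1 : ℕ) : WithTop ℕ∞) ≠ 0 := by exact_mod_cast Nat.succ_ne_zero J
  have hcf : ContDiffAt ℝ (J + 1 : ℕ) f u := hcd.contDiffAt
  have hinv : (fderiv ℝ f u ∘L .inr ℝ (ℝ × ℝ) ℝ).IsInvertible := by
    refine isInvertible_of_ne_zero ?_
    have h1 : HasDerivAt (fun w : ℝ => (((0 : ℝ), (0 : ℝ)), w)) (0, 1) (z n) :=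
      (hasDerivAt_const _ _).prodMk (hasDerivAt_id _)
    have h2 := ((hcd.differentiable hn0 u).hasFDerivAt).comp_hasDerivAt (z n) h1
    have h3 : HasDerivAt (f ∘ fun w : ℝ => (((0 : ℝ), (0 : ℝ)), w))
        (2 * Real.pi * airyA' (z n)) (z n) := by
      refine ((isSol_airyA (z n) (mem_univ _)).1.const_mul (2 * Real.pi)).congr_of_eventuallyEq ?_
      exact Eventually.of_forall fun w => by simp [hf, airyExpansion_zero]
    have h4 := h2.unique h3
    have h5 : (fderiv ℝ f u ∘L .inr ℝ (ℝ × ℝ) ℝ) 1 = 2 * Real.pi * airyA' (z n) := by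
      rw [← h4]; rfl
    rw [h5]
    have := Real.pi_pos
    exact mul_ne_zero (by positivity) (airyA'_ne_zero hzA)
  set g := hcf.implicitFunction hn0 hinv with hg
  have hgu : g (0, 0) = z n := hcf.implicitFunction_apply_self hn0 hinv
  have hgc : ContDiffAt ℝ (J + 1 : ℕ) g (0, 0) := hcf.contDiffAt_implicitFunction hn0 hinv
  obtain ⟨L, t, ht, hL⟩ := (hgc.of_le (m := 1)
    (by exact_mod_cast Nat.succ_le_succ (Nat.zero_le J))).exists_lipschitzOnWith
  obtain ⟨r₁, hr₁, hball₁⟩ := Metric.mem_nhds_iff.1 ht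
  obtain ⟨r₂, hr₂, hball₂⟩ := Metric.eventually_nhds_iff_ball.1
    (hcf.eventually_apply_eq_iff_implicitFunction hn0 hinv)
  set R := z n + 1 with hR
  have hR1 : 1 ≤ R := by linarith
  obtain ⟨C, hC0, hC⟩ := scaledSchlafli_sub_le hR1 J
  refine ⟨fun ε => g (ε, 0), ?_, hgu, L * C, ?_⟩
  · exact ContDiffAt.comp (x := (0 : ℝ)) (f := fun ε : ℝ => (ε, (0 : ℝ))) hgc
      (contDiffAt_id.prodMk contDiffAt_const)
  have hsm : ∀ᶠ δ : ℝ in 𝓝[>] 0, δ ^ 2 < min r₁ r₂ := by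
    have h : Continuous fun δ : ℝ => δ ^ 2 := by fun_prop
    have h' : Tendsto (fun δ : ℝ => δ ^ 2) (𝓝[>] 0) (𝓝 0) := by
      simpa using (h.tendsto 0).mono_left nhdsWithin_le_nhds
    exact h'.eventually_lt_const (lt_min hr₁ hr₂)
  have hsm' : ∀ᶠ δ : ℝ in 𝓝[>] 0, C * (δ ^ 2) ^ (J + 1) < min r₁ r₂ := by
    have h : Continuous fun δ : ℝ => C * (δ ^ 2) ^ (J + 1) := by fun_prop
    have h' : Tendsto (fun δ : ℝ => C * (δ ^ 2) ^ (J + 1)) (𝓝[>] 0) (𝓝 0) := by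
      simpa using (h.tendsto 0).mono_left nhdsWithin_le_nhds
    exact h'.eventually_lt_const (lt_min hr₁ hr₂)
  filter_upwards [eventually_mul_sq_le R, self_mem_nhdsWithin, hsm, hsm',
    eventually_abs_zero_sub_lt hz n (lt_min hr₂ one_pos)] with δ hRδ hδ' h1 h2 h3 ρ hρ
  have hδ : 0 < δ := hδ'
  have hδ1 : δ ≤ 1 := by nlinarith
  have h4 := h3 ρ hρ
  set w := δ * (ρ n - 2 / δ ^ 3) with hw
  have hw2 : |w - z n| < r₂ := h4.trans_le (min_le_left _ _)
  have hw1 : |w - z n| < 1 := h4.trans_le (min_le_right _ _)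
  have hwR : |w| ≤ R := by
    have := abs_lt.1 hw1
    rw [abs_le]
    constructor <;> linarith
  have hρw : 2 / δ ^ 3 + w / δ = ρ n := by rw [hw]; field_simp; ring
  have hD : scaledSchlafli δ w = 0 :=
    scaledSchlafli_zero hδ hRδ hδ1 hwR (by rw [hρw]; exact hρ.zero n)
  have hF : |airyExpansion J (δ ^ 2) w| ≤ C * (δ ^ 2) ^ (J + 1) := by
    have := hC δ w hδ hRδ hwR
    rwa [hD, zero_sub, abs_neg] at this
  set F := airyExpansion J (δ ^ 2) w with hFdef
  have hδ2 : |δ ^ 2| = δ ^ 2 := abs_of_nonneg (sq_nonneg δ)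
  -- the implicit function recovers `w` from the value `F` of the expansion
  have hgw : g (δ ^ 2, F) = w := by
    have hmem : (((δ ^ 2, F), w) : (ℝ × ℝ) × ℝ) ∈ Metric.ball u r₂ := by
      rw [Metric.mem_ball, Prod.dist_eq, Prod.dist_eq]
      refine max_lt (max_lt ?_ ?_) hw2
      · rw [Real.dist_eq, sub_zero, hδ2]
        exact h1.trans_le (min_le_right _ _)
      · rw [Real.dist_eq, sub_zero]
        exact hF.trans_lt (h2.trans_le (min_le_right _ _))
    refine (hball₂ _ hmem).1 ?_
    rw [hfu]
    simp [hf, hFdef]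
  have hm1 : ((δ ^ 2, F) : ℝ × ℝ) ∈ t := hball₁ (by
    rw [Metric.mem_ball, Prod.dist_eq, Real.dist_eq, Real.dist_eq, sub_zero, sub_zero, hδ2]
    exact max_lt (h1.trans_le (min_le_left _ _)) (hF.trans_lt (h2.trans_le (min_le_left _ _))))
  have hm2 : ((δ ^ 2, 0) : ℝ × ℝ) ∈ t := hball₁ (by
    rw [Metric.mem_ball, Prod.dist_eq, Real.dist_eq, Real.dist_eq, sub_zero, sub_zero, hδ2,
      abs_zero]
    exact max_lt (h1.trans_le (min_le_left _ _)) hr₁)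
  have hlip := hL.dist_le_mul _ hm1 _ hm2
  rw [hgw, Prod.dist_eq, dist_self, Real.dist_eq, Real.dist_eq, sub_zero,
    max_eq_right (abs_nonneg F)] at hlip
  calc |w - g (δ ^ 2, 0)| ≤ L * |F| := hlip
    _ ≤ L * (C * (δ ^ 2) ^ (J + 1)) := by gcongr
    _ = _ := by ring

/-! ### Asymptotic expansions in powers of a small parameter -/

lemma coeff_eq_zero_of_isBigO {α : Type*} {l : Filter α} [l.NeBot] {η : α → ℝ}
    (hη : Tendsto η l (𝓝[>] 0)) {N : ℕ} {a : ℕ → ℝ} {C : ℝ}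
    (h : ∀ᶠ x in l, |∑ j ∈ Finset.range N, a j * η x ^ j| ≤ C * η x ^ N) :
    ∀ j < N, a j = 0 := by
  induction N generalizing a with
  | zero => exact fun j hj => absurd hj (Nat.not_lt_zero j)
  | succ N ih =>
    have hη0 : Tendsto η l (𝓝 0) := hη.mono_right nhdsWithin_le_nhds
    have hpos : ∀ᶠ x in l, 0 < η x := hη.eventually self_mem_nhdsWithin
    have hlim : Tendsto (fun x => |∑ j ∈ Finset.range (N + 1), a j * η x ^ j|) l (𝓝 |a 0|) := by
      have hc : Continuous fun y : ℝ => |∑ j ∈ Finset.range (N + 1), a j * y ^ j| := by fun_prop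
      have := (hc.tendsto 0).comp hη0
      rw [Finset.sum_eq_single 0 (fun j _ hj => by rw [zero_pow hj, mul_zero]) (by simp)] at this
      simpa [Function.comp_def] using this
    have hlim' : Tendsto (fun x => C * η x ^ (N + 1)) l (𝓝 0) := by
      simpa using (hη0.pow (N + 1)).const_mul C
    have h0 : a 0 = 0 := abs_eq_zero.1 (le_antisymm (le_of_tendsto_of_tendsto hlim hlim' h)
      (abs_nonneg _))
    have hs := ih (a := fun j => a (j + 1)) (by
      filter_upwards [h, hpos] with x hx hx0
      rw [Finset.sum_range_succ', h0, zero_mul, add_zero] at hx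
      have e : ∑ j ∈ Finset.range N, a (j + 1) * η x ^ (j + 1) =
          η x * ∑ j ∈ Finset.range N, a (j + 1) * η x ^ j := by
        rw [Finset.mul_sum]
        exact Finset.sum_congr rfl fun j _ => by ring
      rw [e, abs_mul, abs_of_pos hx0, pow_succ', ← mul_assoc, mul_comm C, mul_assoc] at hx
      exact le_of_mul_le_mul_left hx hx0)
    intro j hj
    rcases j with _ | j
    · exact h0
    · exact hs j (Nat.lt_of_succ_lt_succ hj)

/-- If a function has polynomial approximations of every order, these are the truncations of one
formal power series. -/
lemma exists_coeff_of_forall_order {α : Type*} {l : Filter α} [l.NeBot] {η G : α → ℝ}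
    (hη : Tendsto η l (𝓝[>] 0))
    (h : ∀ J : ℕ, ∃ (c : ℕ → ℝ) (C : ℝ), ∀ᶠ x in l,
      |G x - ∑ j ∈ Finset.range (J + 1), c j * η x ^ j| ≤ C * η x ^ (J + 1)) :
    ∃ β : ℕ → ℝ, ∀ J : ℕ, ∃ C : ℝ, ∀ᶠ x in l,
      |G x - ∑ j ∈ Finset.range (J + 1), β j * η x ^ j| ≤ C * η x ^ (J + 1) := by
  choose c C hC using h
  have hpos : ∀ᶠ x in l, 0 < η x := hη.eventually self_mem_nhdsWithin
  have hle1 : ∀ᶠ x in l, η x < 1 :=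
    (hη.mono_right nhdsWithin_le_nhds).eventually_lt_const one_pos
  have hstep : ∀ J, ∀ j < J + 1, c (J + 1) j = c J j := fun J j hj => by
    refine sub_eq_zero.1 (coeff_eq_zero_of_isBigO hη (a := fun j => c (J + 1) j - c J j)
      (C := C J + (|C (J + 1)| + |c (J + 1) (J + 1)|)) ?_ j hj)
    filter_upwards [hC J, hC (J + 1), hpos, hle1] with x h1 h2 h3 h4
    rw [Finset.sum_range_succ] at h2
    have e : ∑ j ∈ Finset.range (J + 1), (c (J + 1) j - c J j) * η x ^ j =
        (G x - ∑ j ∈ Finset.range (J + 1), c J j * η x ^ j) -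
        (G x - (∑ j ∈ Finset.range (J + 1), c (J + 1) j * η x ^ j +
          c (J + 1) (J + 1) * η x ^ (J + 1))) - c (J + 1) (J + 1) * η x ^ (J + 1) := by
      simp only [sub_mul, Finset.sum_sub_distrib]
      ring
    have h5 : C (J + 1) * η x ^ (J + 1 + 1) ≤ |C (J + 1)| * η x ^ (J + 1) := by
      calc C (J + 1) * η x ^ (J + 1 + 1) ≤ |C (J + 1)| * η x ^ (J + 1 + 1) := by
            gcongr
            exact le_abs_self _
        _ ≤ _ := by
            gcongr ?_ * ?_
            exact pow_le_pow_of_le_one h3.le h4.le (Nat.le_succ _)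
    have h6 : |c (J + 1) (J + 1) * η x ^ (J + 1)| = |c (J + 1) (J + 1)| * η x ^ (J + 1) := by
      rw [abs_mul, abs_of_pos (pow_pos h3 _)]
    rw [e]
    refine (abs_sub _ _).trans ?_
    have := abs_sub (G x - ∑ j ∈ Finset.range (J + 1), c J j * η x ^ j)
      (G x - (∑ j ∈ Finset.range (J + 1), c (J + 1) j * η x ^ j +
          c (J + 1) (J + 1) * η x ^ (J + 1)))
    linarith
  have hdiag : ∀ J j, j ≤ J → c J j = c j j := fun J j hj => by
    induction J, hj using Nat.le_induction with
    | base => rfl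
    | succ J hJ ih => rw [hstep J j (Nat.lt_succ_of_le hJ), ih]
  refine ⟨fun j => c j j, fun J => ⟨C J, (hC J).mono fun x hx => ?_⟩⟩
  have e : ∑ j ∈ Finset.range (J + 1), c j j * η x ^ j =
      ∑ j ∈ Finset.range (J + 1), c J j * η x ^ j := Finset.sum_congr rfl fun j hj => by
    rw [hdiag J j (Nat.lt_succ_iff.1 (Finset.mem_range.1 hj))]
  change |G x - ∑ j ∈ Finset.range (J + 1), c j j * η x ^ j| ≤ _
  rw [e]
  exact hx

/-- Taylor's formula at the origin, to the right. -/
lemma exists_taylor_of_contDiffAt {f : ℝ → ℝ} {J : ℕ} (hf : ContDiffAt ℝ (J + 1 : ℕ) f 0) :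
    ∃ (c : ℕ → ℝ) (C : ℝ), ∀ᶠ x in 𝓝[>] (0 : ℝ),
      |f x - ∑ j ∈ Finset.range (J + 1), c j * x ^ j| ≤ C * x ^ (J + 1) := by
  obtain ⟨u, hu, hfu⟩ := hf.contDiffOn le_rfl (by simp)
  obtain ⟨r, hr, hru⟩ := Metric.mem_nhds_iff.1 hu
  have hsub : Icc 0 (r / 2) ⊆ u := fun x hx => hru (by
    rw [Metric.mem_ball, Real.dist_eq, sub_zero, abs_of_nonneg hx.1]
    linarith [hx.2])
  obtain ⟨C, hC⟩ := exists_taylor_mean_remainder_bound (n := J) (half_pos hr).le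
    (by exact_mod_cast hfu.mono hsub)
  refine ⟨fun j => iteratedDerivWithin j f (Icc 0 (r / 2)) 0 / j.factorial, C, ?_⟩
  filter_upwards [Ioo_mem_nhdsGT (half_pos hr)] with x hx
  have h := hC x ⟨hx.1.le, hx.2.le⟩
  rw [taylor_within_apply, sub_zero, Real.norm_eq_abs] at h
  convert h using 3
  refine Finset.sum_congr rfl fun j _ => ?_
  rw [smul_eq_mul, div_eq_inv_mul]
  ring

/-! ### Expansion of the eigenvalues -/

/-- The index `ν` of the Bessel equation, with `ν² - 1 / 4 = π² / (4 h²)`. -/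
def besselIndex (h : ℝ) : ℝ := √(1 / 4 + Real.pi ^ 2 / (4 * h ^ 2))

/-- The factor relating `δ² = (2 / ν)^(2 / 3)` to `η = h^(2 / 3)`. -/
def scaleFactor (η : ℝ) : ℝ := (16 / (Real.pi ^ 2 + η ^ 3)) ^ (1 / 3 : ℝ)

lemma pi_sq_add_pos {η : ℝ} (hη : 0 ≤ η) : 0 < Real.pi ^ 2 + η ^ 3 := by
  have := Real.pi_pos
  positivity

lemma scaleFactor_pos {η : ℝ} (hη : 0 ≤ η) : 0 < scaleFactor η :=
  Real.rpow_pos_of_pos (div_pos (by norm_num) (pi_sq_add_pos hη)) _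

lemma scaleFactor_cube {η : ℝ} (hη : 0 ≤ η) :
    scaleFactor η ^ 3 = 16 / (Real.pi ^ 2 + η ^ 3) := by
  rw [scaleFactor, ← Real.rpow_natCast, ← Real.rpow_mul
    (div_pos (by norm_num) (pi_sq_add_pos hη)).le]
  norm_num

lemma contDiffAt_scaleFactor (n : ℕ) : ContDiffAt ℝ n scaleFactor 0 := by
  have h0 := pi_sq_add_pos (le_refl (0 : ℝ))
  refine ContDiffAt.rpow_const_of_ne (ContDiffAt.div contDiffAt_const (by fun_prop) h0.ne') ?_
  exact (div_pos (by norm_num) h0).ne'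

/-- The scale `δ` with `2 / δ³ = ν`, as a function of `η = h^(2 / 3)`. -/
def turningScale (η : ℝ) : ℝ := √(η * scaleFactor η)

lemma turningScale_pos {η : ℝ} (hη : 0 < η) : 0 < turningScale η :=
  Real.sqrt_pos.2 (mul_pos hη (scaleFactor_pos hη.le))

lemma turningScale_sq {η : ℝ} (hη : 0 ≤ η) : turningScale η ^ 2 = η * scaleFactor η :=
  Real.sq_sqrt (mul_nonneg hη (scaleFactor_pos hη).le)

lemma tendsto_turningScale : Tendsto turningScale (𝓝[>] 0) (𝓝[>] 0) := by
  refine tendsto_nhdsWithin_iff.2 ⟨?_, ?_⟩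
  · have h : ContinuousAt turningScale 0 := Real.continuous_sqrt.continuousAt.comp
      (continuousAt_id.mul (contDiffAt_scaleFactor 0).continuousAt)
    have h0 : turningScale 0 = 0 := by simp [turningScale]
    have := h.tendsto
    rw [h0] at this
    exact this.mono_left nhdsWithin_le_nhds
  · filter_upwards [self_mem_nhdsWithin] with η hη using turningScale_pos hη

lemma turningScale_pow_six {η : ℝ} (hη : 0 ≤ η) :
    turningScale η ^ 6 = 16 * η ^ 3 / (Real.pi ^ 2 + η ^ 3) := by
  rw [show turningScale η ^ 6 = (turningScale η ^ 2) ^ 3 by ring, turningScale_sq hη, mul_pow,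
    scaleFactor_cube hη]
  ring

lemma two_div_turningScale {h η : ℝ} (hη : 0 < η) (hh : h ^ 2 = η ^ 3) :
    2 / turningScale η ^ 3 = besselIndex h := by
  have hδ := turningScale_pos hη
  have hp := pi_sq_add_pos hη.le
  have e : 1 / 4 + Real.pi ^ 2 / (4 * h ^ 2) = (2 / turningScale η ^ 3) ^ 2 := by
    rw [hh, div_pow, show (turningScale η ^ 3) ^ 2 = turningScale η ^ 6 by ring,
      turningScale_pow_six hη.le]
    field_simp
    ring
  rw [besselIndex, e, Real.sqrt_sq (by positivity)]

/-- The eigenvalue in terms of the scaled Bessel zero `w`. -/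
lemma eigenvalue_eq {h η x : ℝ} (hη : 0 < η) (hh : h ^ 2 = η ^ 3) :
    (h * x / (Real.pi * √2)) ^ 2 = (Real.pi ^ 2 + η ^ 3) * (2 + turningScale η *
      (x - 2 / turningScale η ^ 3) * (η * scaleFactor η)) ^ 2 / (32 * Real.pi ^ 2) := by
  have hδ := turningScale_pos hη
  have hp := pi_sq_add_pos hη.le
  have hπ := Real.pi_pos
  rw [← turningScale_sq hη.le]
  have h6 : h ^ 2 = (Real.pi ^ 2 + η ^ 3) * turningScale η ^ 6 / 16 := by
    rw [turningScale_pow_six hη.le, hh]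
    field_simp
  have h1 : 2 + turningScale η * (x - 2 / turningScale η ^ 3) * turningScale η ^ 2 =
      turningScale η ^ 3 * x := by
    field_simp
    ring
  rw [h1, div_pow, mul_pow, mul_pow, Real.sq_sqrt (by norm_num), h6]
  field_simp
  ring

/-- The eigenvalues have expansions to every order, for a polynomial that may depend on the
order. -/
lemma eigenvalue_expansion_of_order {z : ℕ → ℝ} (hz : IsAiryZeroSequence z) (n J : ℕ) :
    ∃ (c : ℕ → ℝ) (C : ℝ), ∀ᶠ η in 𝓝[>] (0 : ℝ), ∀ h ρ, h ^ 2 = η ^ 3 →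
      IsBesselZeroSequence (besselIndex h + 1 / 2) ρ →
      |(h * ρ n / (Real.pi * √2)) ^ 2 - ∑ j ∈ Finset.range (J + 1), c j * η ^ j| ≤
        C * η ^ (J + 1) := by
  have hπ := Real.pi_pos
  obtain ⟨ψ, hψ, hψ0, C₁, hC₁⟩ := exists_contDiffAt_zero hz n J
  have hsf := contDiffAt_scaleFactor (J + 1)
  set F : ℝ → ℝ := fun η => (Real.pi ^ 2 + η ^ 3) *
    (2 + ψ (η * scaleFactor η) * (η * scaleFactor η)) ^ 2 / (32 * Real.pi ^ 2) with hF
  have hψ' : ContDiffAt ℝ (J + 1 : ℕ) (fun η => ψ (η * scaleFactor η)) 0 := by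
    refine ContDiffAt.comp (x := (0 : ℝ)) (g := ψ) (f := fun η => η * scaleFactor η) ?_
      (contDiffAt_id.mul hsf)
    rwa [zero_mul]
  have hFc : ContDiffAt ℝ (J + 1 : ℕ) F 0 := by
    have h1 : ContDiffAt ℝ (J + 1 : ℕ) (fun η : ℝ => Real.pi ^ 2 + η ^ 3) 0 := by fun_prop
    exact (h1.mul ((contDiffAt_const.add (hψ'.mul (contDiffAt_id.mul hsf))).pow 2)).div_const _
  obtain ⟨c, C₂, hC₂⟩ := exists_taylor_of_contDiffAt hFc
  -- bounds valid near the origin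
  have hbd : ∀ {g : ℝ → ℝ}, ContinuousAt g 0 → ∃ M, 0 ≤ M ∧ ∀ᶠ η in 𝓝[>] (0 : ℝ), |g η| ≤ M :=
    fun {g} hg => ⟨|g 0| + 1, by positivity, ((hg.abs.tendsto.mono_left
      nhdsWithin_le_nhds).eventually_lt_const (lt_add_one _)).mono fun η h => h.le⟩
  obtain ⟨M₁, hM₁0, hM₁⟩ := hbd (hψ'.continuousAt)
  obtain ⟨M₂, hM₂0, hM₂⟩ := hbd (hsf.continuousAt)
  set K := |C₁| * M₂ ^ (J + 1) with hK
  have hK0 : 0 ≤ K := by positivity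
  refine ⟨c, (Real.pi ^ 2 + 1) * (M₂ * (4 + (2 * M₁ + K) * M₂) * K) / (32 * Real.pi ^ 2) + C₂, ?_⟩
  filter_upwards [tendsto_turningScale.eventually hC₁, hC₂, hM₁, hM₂, self_mem_nhdsWithin,
    Ioo_mem_nhdsGT one_pos] with η h1 h2 h3 h4 hη' hη1' h ρ hh hρ
  have hη : 0 < η := hη'
  have hη1 : η ≤ 1 := hη1'.2.le
  have hsp := scaleFactor_pos hη.le
  rw [abs_of_pos hsp] at h4
  rw [← two_div_turningScale hη hh] at hρ
  have h5 := h1 ρ hρ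
  rw [turningScale_sq hη.le] at h5
  rw [eigenvalue_eq hη hh]
  set w := turningScale η * (ρ n - 2 / turningScale η ^ 3) with hw
  set v := ψ (η * scaleFactor η) with hv
  set ε := η * scaleFactor η with hε
  have hε0 : 0 < ε := mul_pos hη hsp
  have hεM : ε ≤ η * M₂ := by rw [hε]; gcongr
  have hεM' : ε ≤ M₂ := hεM.trans (mul_le_of_le_one_left hM₂0 hη1)
  have hwv : |w - v| ≤ K * η ^ (J + 1) := by
    refine h5.trans ?_
    calc C₁ * ε ^ (J + 1) ≤ |C₁| * (η * M₂) ^ (J + 1) := by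
          gcongr
          exact le_abs_self _
      _ = _ := by rw [hK, mul_pow]; ring
  have hwv' : |w - v| ≤ K := hwv.trans (mul_le_of_le_one_right hK0 (pow_le_one₀ hη.le hη1))
  have hsum : |4 + (w + v) * ε| ≤ 4 + (2 * M₁ + K) * M₂ := by
    have h6 : |w + v| ≤ 2 * M₁ + K := by
      have : w + v = (w - v) + (v + v) := by ring
      rw [this]
      refine (abs_add_le _ _).trans ?_
      have := abs_add_le v v
      linarith
    refine (abs_add_le _ _).trans ?_
    rw [abs_mul, abs_of_pos hε0, abs_of_pos (show (0 : ℝ) < 4 by norm_num)]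
    gcongr
  have hdiff : |(Real.pi ^ 2 + η ^ 3) * (2 + w * ε) ^ 2 / (32 * Real.pi ^ 2) - F η| ≤
      (Real.pi ^ 2 + 1) * (M₂ * (4 + (2 * M₁ + K) * M₂) * K) / (32 * Real.pi ^ 2) *
        η ^ (J + 1) := by
    have e : (Real.pi ^ 2 + η ^ 3) * (2 + w * ε) ^ 2 / (32 * Real.pi ^ 2) - F η =
        (Real.pi ^ 2 + η ^ 3) * (ε * (4 + (w + v) * ε) * (w - v)) / (32 * Real.pi ^ 2) := by
      simp only [hF]
      rw [← hε, ← hv]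
      ring
    rw [e, abs_div, abs_mul, abs_mul, abs_mul, abs_of_pos (pi_sq_add_pos hη.le), abs_of_pos hε0,
      abs_of_pos (show 0 < 32 * Real.pi ^ 2 by positivity)]
    have h7 : η ^ 3 ≤ 1 := pow_le_one₀ hη.le hη1
    have h8 : 0 ≤ 4 + (2 * M₁ + K) * M₂ := (abs_nonneg _).trans hsum
    calc (Real.pi ^ 2 + η ^ 3) * (ε * |4 + (w + v) * ε| * |w - v|) / (32 * Real.pi ^ 2)
        ≤ (Real.pi ^ 2 + 1) * (M₂ * (4 + (2 * M₁ + K) * M₂) * (K * η ^ (J + 1))) /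
          (32 * Real.pi ^ 2) := by gcongr
      _ = _ := by ring
  calc _ ≤ |(Real.pi ^ 2 + η ^ 3) * (2 + w * ε) ^ 2 / (32 * Real.pi ^ 2) - F η| +
        |F η - ∑ j ∈ Finset.range (J + 1), c j * η ^ j| := abs_sub_le _ _ _
    _ ≤ _ := (add_le_add hdiff h2).trans_eq (add_mul _ _ _).symm

lemma scaleFactor_zero_div : scaleFactor 0 / 8 = (4 * Real.pi * √2) ^ (-(2 / 3) : ℝ) := by
  have hπ := Real.pi_pos
  have h1 : (4 * Real.pi * √2) ^ (-(2 / 3) : ℝ) =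
      ((1 / 8) ^ 3 * (16 / Real.pi ^ 2)) ^ (1 / 3 : ℝ) := by
    rw [show (-(2 / 3) : ℝ) = (-2 : ℝ) * (1 / 3) by norm_num, Real.rpow_mul (by positivity)]
    congr 1
    rw [Real.rpow_neg (by positivity), Real.rpow_two, mul_pow, mul_pow,
      Real.sq_sqrt (by norm_num)]
    field_simp
    norm_num
  have h2 : ((1 / 8 : ℝ) ^ 3) ^ (1 / 3 : ℝ) = 1 / 8 := by
    rw [← Real.rpow_natCast, ← Real.rpow_mul (by norm_num)]
    norm_num
  rw [h1, Real.mul_rpow (by positivity) (by positivity), h2, scaleFactor, zero_pow (by norm_num),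
    add_zero]
  ring

/-- The first two terms of the expansion. -/
lemma tendsto_eigenvalue {z : ℕ → ℝ} (hz : IsAiryZeroSequence z) (n : ℕ) {ρ : ℝ → ℕ → ℝ}
    {l : Filter ℝ} {η : ℝ → ℝ} (hη : Tendsto η l (𝓝[>] 0))
    (hρ : ∀ᶠ h in l, h ^ 2 = η h ^ 3 ∧ IsBesselZeroSequence (besselIndex h + 1 / 2) (ρ h)) :
    Tendsto (fun h => ((h * ρ h n / (Real.pi * √2)) ^ 2 - 1 / 8) / η h) l
      (𝓝 ((4 * Real.pi * √2) ^ (-(2 / 3) : ℝ) * z n)) := by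
  have hπ := Real.pi_pos
  have hη0 : Tendsto η l (𝓝 0) := hη.mono_right nhdsWithin_le_nhds
  have hpos : ∀ᶠ h in l, 0 < η h := hη.eventually self_mem_nhdsWithin
  set w : ℝ → ℝ := fun h => turningScale (η h) * (ρ h n - 2 / turningScale (η h) ^ 3) with hw
  have hwlim : Tendsto w l (𝓝 (z n)) := by
    rw [Metric.tendsto_nhds]
    intro r hr
    filter_upwards [(tendsto_turningScale.comp hη).eventually (eventually_abs_zero_sub_lt hz n hr),
      hρ, hpos] with h h1 h2 h3
    refine h1 _ ?_
    rw [Function.comp_apply, two_div_turningScale h3 h2.1]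
    exact h2.2
  have hs : Tendsto (fun h => scaleFactor (η h)) l (𝓝 (scaleFactor 0)) :=
    (contDiffAt_scaleFactor 0).continuousAt.tendsto.comp hη0
  have hlim : Tendsto (fun h => (4 * η h ^ 2 + (Real.pi ^ 2 + η h ^ 3) *
      (4 * w h * scaleFactor (η h) + w h ^ 2 * (η h * scaleFactor (η h) ^ 2))) /
        (32 * Real.pi ^ 2)) l (𝓝 ((4 * (0 : ℝ) ^ 2 + (Real.pi ^ 2 + (0 : ℝ) ^ 3) *
      (4 * z n * scaleFactor 0 + z n ^ 2 * (0 * scaleFactor 0 ^ 2))) / (32 * Real.pi ^ 2))) :=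
    ((((hη0.pow 2).const_mul 4).add (((hη0.pow 3).const_add _).mul
      (((hwlim.const_mul 4).mul hs).add ((hwlim.pow 2).mul (hη0.mul (hs.pow 2)))))).div_const _)
  have hval : (4 * (0 : ℝ) ^ 2 + (Real.pi ^ 2 + (0 : ℝ) ^ 3) *
      (4 * z n * scaleFactor 0 + z n ^ 2 * (0 * scaleFactor 0 ^ 2))) / (32 * Real.pi ^ 2) =
      (4 * Real.pi * √2) ^ (-(2 / 3) : ℝ) * z n := by
    rw [← scaleFactor_zero_div]
    field_simp
    ring
  rw [hval] at hlim
  refine hlim.congr' ?_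
  filter_upwards [hρ, hpos] with h h2 h3
  rw [eigenvalue_eq h3 h2.1]
  simp only [hw]
  field_simp
  ring

/-- The expansion of `(h ρ_n / (π √2))²`, for the zeros `ρ_n` of the Bessel solution. -/
lemma exists_eigenvalue_expansion {z : ℕ → ℝ} (hz : IsAiryZeroSequence z) {ρ : ℝ → ℕ → ℝ}
    (hρ : ∀ h, 0 < h → IsBesselZeroSequence (besselIndex h + 1 / 2) (ρ h)) (n : ℕ) :
    ∃ β : ℕ → ℝ, β 0 = 1 / 8 ∧ β 1 = (4 * Real.pi * √2) ^ (-(2 / 3) : ℝ) * z n ∧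
      ∀ J : ℕ, ∃ C h₀ : ℝ, 0 < h₀ ∧ ∀ h : ℝ, 0 < h → h < h₀ →
        |(h * ρ h n / (Real.pi * √2)) ^ 2 -
          ∑ j ∈ Finset.range (J + 1), β j * h ^ (2 * (j : ℝ) / 3)|
          ≤ C * h ^ (2 * ((J : ℝ) + 1) / 3) := by
  set η : ℝ → ℝ := fun h => h ^ (2 / 3 : ℝ) with hηdef
  have hη : Tendsto η (𝓝[>] 0) (𝓝[>] 0) := by
    refine tendsto_nhdsWithin_iff.2 ⟨?_, ?_⟩
    · have := (Real.continuous_rpow_const (q := (2 / 3 : ℝ)) (by norm_num)).tendsto 0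
      rw [Real.zero_rpow (by norm_num)] at this
      exact this.mono_left nhdsWithin_le_nhds
    · filter_upwards [self_mem_nhdsWithin] with h hh using Real.rpow_pos_of_pos hh _
  have hη3 : ∀ h : ℝ, 0 < h → h ^ 2 = η h ^ 3 := fun h hh => by
    rw [hηdef, ← Real.rpow_natCast (h ^ (2 / 3 : ℝ)), ← Real.rpow_mul hh.le, ← Real.rpow_natCast]
    norm_num
  have hρ' : ∀ᶠ h in 𝓝[>] (0 : ℝ),
      h ^ 2 = η h ^ 3 ∧ IsBesselZeroSequence (besselIndex h + 1 / 2) (ρ h) := by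
    filter_upwards [self_mem_nhdsWithin] with h hh using ⟨hη3 h hh, hρ h hh⟩
  obtain ⟨β, hβ⟩ := exists_coeff_of_forall_order (G := fun h => (h * ρ h n / (Real.pi * √2)) ^ 2)
    hη fun J => by
      obtain ⟨c, C, hC⟩ := eigenvalue_expansion_of_order hz n J
      refine ⟨c, C, ?_⟩
      filter_upwards [hη.eventually hC, hρ'] with h h1 h2
      exact h1 h _ h2.1 h2.2
  have hlim := tendsto_eigenvalue hz n hη hρ'
  have hη0 : Tendsto η (𝓝[>] 0) (𝓝 0) := hη.mono_right nhdsWithin_le_nhds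
  have hpos : ∀ᶠ h in 𝓝[>] (0 : ℝ), 0 < η h := hη.eventually self_mem_nhdsWithin
  have hG : Tendsto (fun h => (h * ρ h n / (Real.pi * √2)) ^ 2) (𝓝[>] 0) (𝓝 (1 / 8)) := by
    have := (hlim.mul hη0).add_const (1 / 8)
    rw [mul_zero, zero_add] at this
    refine this.congr' ?_
    filter_upwards [hpos] with h hh
    field_simp
    ring
  obtain ⟨C₁, hC₁⟩ := hβ 1
  have hβ0 : β 0 = 1 / 8 := by
    have h1 : Tendsto (fun h => (h * ρ h n / (Real.pi * √2)) ^ 2 - (β 0 + β 1 * η h)) (𝓝[>] 0)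
        (𝓝 0) := by
      refine squeeze_zero_norm' (a := fun h => C₁ * η h ^ (1 + 1)) ?_
        (by simpa using (hη0.pow 2).const_mul C₁)
      filter_upwards [hC₁] with h hh
      simpa [Finset.sum_range_succ] using hh
    have h2 := hG.sub ((hη0.const_mul (β 1)).const_add (β 0))
    have := tendsto_nhds_unique h1 h2
    rw [mul_zero, add_zero] at this
    linarith
  refine ⟨β, hβ0, ?_, fun J => ?_⟩
  · have h1 : Tendsto (fun h => ((h * ρ h n / (Real.pi * √2)) ^ 2 - 1 / 8) / η h - β 1) (𝓝[>] 0)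
        (𝓝 0) := by
      refine squeeze_zero_norm' (a := fun h => C₁ * η h) ?_
        (by simpa using hη0.const_mul C₁)
      filter_upwards [hC₁, hpos] with h hh h0
      simp only [Finset.sum_range_succ, Finset.range_zero, Finset.sum_empty, pow_zero, mul_one,
        zero_add, pow_one, hβ0] at hh
      rw [div_sub' h0.ne', norm_div, Real.norm_eq_abs, Real.norm_eq_abs, abs_of_pos h0,
        div_le_iff₀ h0]
      calc _ = |(h * ρ h n / (Real.pi * √2)) ^ 2 - (1 / 8 + β 1 * η h)| := by congr 1; ring
        _ ≤ C₁ * η h ^ (1 + 1) := hh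
        _ = _ := by ring
    have := tendsto_nhds_unique h1 (hlim.sub_const (β 1))
    linarith
  · obtain ⟨C, hC⟩ := hβ J
    obtain ⟨h₀, hh₀, hsub⟩ := mem_nhdsGT_iff_exists_Ioo_subset.1 hC
    refine ⟨C, h₀, hh₀, fun h hh0 hh1 => ?_⟩
    have hp : ∀ j : ℕ, h ^ (2 * (j : ℝ) / 3) = η h ^ j := fun j => by
      rw [hηdef, ← Real.rpow_natCast (h ^ (2 / 3 : ℝ)), ← Real.rpow_mul hh0.le]
      congr 1
      ring
    have h1 : |(h * ρ h n / (Real.pi * √2)) ^ 2 - ∑ j ∈ Finset.range (J + 1), β j * η h ^ j| ≤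
        C * η h ^ (J + 1) := hsub ⟨hh0, hh1⟩
    have hp1 := hp (J + 1)
    push_cast at hp1
    rw [hp1]
    simp only [hp]
    exact h1

/-! ### Regularity of eigenfunctions -/

/-- Integration by parts for primitives, by Fubini's theorem. -/
lemma integral_mul_primitive {F k : ℝ → ℂ} {a b : ℝ} (hab : a ≤ b)
    (hF : IntegrableOn F (Ioc a b)) (hk : IntegrableOn k (Ioc a b)) :
    ∫ x in a..b, F x * ∫ t in a..x, k t = ∫ t in a..b, (∫ x in t..b, F x) * k t := by
  set P : ℝ → ℝ → ℂ := fun x t => {p : ℝ × ℝ | p.2 < p.1}.indicator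
    (fun p => F p.1 * k p.2) (x, t) with hP
  have hint : Integrable (Function.uncurry P)
      ((volume.restrict (Ioc a b)).prod (volume.restrict (Ioc a b))) := by
    have h1 : Integrable (fun p : ℝ × ℝ => F p.1 * k p.2)
      ((volume.restrict (Ioc a b)).prod (volume.restrict (Ioc a b))) := hF.mul_prod hk
    exact h1.indicator (measurableSet_lt measurable_snd measurable_fst)
  have h := integral_integral_swap hint
  rw [intervalIntegral.integral_of_le hab, intervalIntegral.integral_of_le hab]
  refine Eq.trans ?_ (h.trans ?_)
  · refine setIntegral_congr_fun measurableSet_Ioc fun x hx => ?_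
    have e : ∀ t, P x t = (Iio x).indicator (fun t => F x * k t) t := fun t => by
      simp only [hP, indicator, mem_ofPred_eq, mem_Iio]
    simp only [e]
    rw [integral_indicator measurableSet_Iio, Measure.restrict_restrict measurableSet_Iio,
      integral_const_mul, intervalIntegral.integral_of_le hx.1.le, integral_Ioc_eq_integral_Ioo]
    congr 3
    ext t
    simp only [mem_inter_iff, mem_Iio, mem_Ioc, mem_Ioo]
    constructor
    · exact fun ht => ⟨ht.2, ht.1, ht.2.le.trans hx.2⟩
    · exact fun ht => ⟨ht.2.1, ht.1⟩
  · refine setIntegral_congr_fun measurableSet_Ioc fun t ht => ?_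
    have e : ∀ x, P x t = (Ioi t).indicator (fun x => F x * k t) x := fun x => by
      simp only [hP, indicator, mem_ofPred_eq, mem_Ioi]
    simp only [e]
    rw [integral_indicator measurableSet_Ioi, Measure.restrict_restrict measurableSet_Ioi,
      integral_mul_const, intervalIntegral.integral_of_le ht.2]
    congr 3
    ext x
    simp only [mem_inter_iff, mem_Ioi, mem_Ioc]
    constructor
    · exact fun hx => ⟨hx.1, hx.2.2⟩
    · exact fun hx => ⟨hx.1, ht.1.trans hx.1, hx.2⟩

/-- The singular end point `-π√2`. -/
def leftEnd : ℝ := -(Real.pi * √2)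

lemma leftEnd_neg : leftEnd < 0 := zero_mem.1

lemma I_eq : I = Ioo leftEnd 0 := rfl

instance isFiniteMeasure_restrict_I : IsFiniteMeasure (volume.restrict I) := ⟨by simp [I]⟩

lemma V_eq (x : ℝ) : V x = Real.pi ^ 2 / (4 * (x - leftEnd) ^ 2) := by
  rw [V, leftEnd, sub_neg_eq_add]

lemma continuousOn_V : ContinuousOn V (Ioi leftEnd) := by
  have : V = fun x => Real.pi ^ 2 / (4 * (x - leftEnd) ^ 2) := funext V_eq
  rw [this]
  refine continuousOn_const.div (by fun_prop) fun x hx => ?_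
  have h : 0 < x - leftEnd := sub_pos.2 hx
  positivity

lemma V_le_of_le {c x : ℝ} (hc : leftEnd < c) (hx : c ≤ x) : V x ≤ V c := by
  rw [V_eq, V_eq]
  have h : 0 < c - leftEnd := sub_pos.2 hc
  gcongr

/-- Pairs `(∫ k, k)` with `k` square integrable of mean zero, supported inside the interval, belong
to the form domain. -/
lemma primitive_mem_formDomain {k : ℝ → ℂ} {c d : ℝ} (hc : leftEnd < c) (hd : d < 0)
    (hk : MemLp k 2 volume) (hki : Integrable k) (hsupp : ∀ t ∉ Ioo c d, k t = 0)
    (hmean : ∫ t in c..d, k t = 0) :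
    ∃ q ∈ formDomain, (q.2 : ℝ → ℂ) =ᵐ[volume.restrict I] k ∧
      (q.1 : ℝ → ℂ) =ᵐ[volume.restrict I] fun x => ∫ t in leftEnd..x, k t := by
  have hii : ∀ x y, IntervalIntegrable k volume x y := fun x y => hki.intervalIntegrable
  have hΦc : Continuous fun x => ∫ t in leftEnd..x, k t :=
    intervalIntegral.continuous_primitive hii _
  have hz : ∀ x y, (∀ t ∈ uIoc x y, t ∉ Ioo c d) → ∫ t in x..y, k t = 0 := fun x y h =>
    intervalIntegral.integral_zero_ae (Eventually.of_forall fun t ht => hsupp t (h t ht))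
  have hΦl : ∀ x, leftEnd ≤ x → x ≤ c → ∫ t in leftEnd..x, k t = 0 := fun x hx hxc =>
    hz _ _ fun t ht ht' => by
      rw [uIoc_of_le hx] at ht
      linarith [ht.2, ht'.1]
  have hΦr : ∀ x, d ≤ x → ∫ t in leftEnd..x, k t = 0 := fun x hx => by
    rw [← intervalIntegral.integral_add_adjacent_intervals (hii leftEnd c) (hii c x),
      hΦl c hc.le le_rfl, ← intervalIntegral.integral_add_adjacent_intervals (hii c d) (hii d x),
      hmean, hz d x fun t ht ht' => by
        rw [uIoc_of_le hx] at ht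
        linarith [ht.1, ht'.2]]
    simp
  set Φ : ℝ → ℂ := fun x => ∫ t in leftEnd..x, k t with hΦ
  have hbd : ∀ x ∈ I, ‖Φ x‖ ≤ ∫ t, ‖k t‖ := fun x hx => by
    refine (intervalIntegral.norm_integral_le_integral_norm_uIoc).trans ?_
    exact setIntegral_le_integral hki.norm (Eventually.of_forall fun t => norm_nonneg _)
  have m1 : MemLp Φ 2 (volume.restrict I) := MemLp.of_bound hΦc.aestronglyMeasurable (∫ t, ‖k t‖)
    ((ae_restrict_mem measurableSet_Ioo).mono hbd)
  have m2 : MemLp k 2 (volume.restrict I) := hk.restrict I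
  have ftc : ∀ x ∈ Ioc (-(Real.pi * √2)) 0,
      ∫ t in (-(Real.pi * √2))..x, (m2.toLp _ : L2) t = Φ x := fun x hx =>
    integral_congr_L2 m2.coeFn_toLp hx
  refine ⟨(m1.toLp _, m2.toLp _), ⟨⟨?_, ?_⟩, ?_⟩, m2.coeFn_toLp, m1.coeFn_toLp⟩
  · filter_upwards [m1.coeFn_toLp,
      ae_restrict_mem (measurableSet_Ioo : MeasurableSet I)] with x hx hxI
    rw [ftc x ⟨hxI.1, hxI.2.le⟩]
    exact hx
  · rw [ftc 0 zero_mem]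
    exact hΦr 0 hd.le
  · refine MemLp.ae_eq (f := fun x => (√(V x) : ℂ) * Φ x) ?_
      (MemLp.of_bound ?_ (√(V c) * ∫ t, ‖k t‖) ?_)
    · filter_upwards [m1.coeFn_toLp] with x hx
      rw [hx]
    · exact (Complex.measurable_ofReal.comp measurable_V.sqrt).aestronglyMeasurable.mul
        m1.aestronglyMeasurable
    · filter_upwards [ae_restrict_mem (measurableSet_Ioo : MeasurableSet I)] with x hxI
      have h0 : 0 ≤ ∫ t, ‖k t‖ := integral_nonneg fun t => norm_nonneg _
      rcases le_total x c with hxc | hxc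
      · have : Φ x = 0 := hΦl x (le_of_lt hxI.1) hxc
        rw [this, mul_zero, norm_zero]
        positivity
      · rw [norm_mul, Complex.norm_real, Real.norm_eq_abs, abs_of_nonneg (Real.sqrt_nonneg _)]
        exact mul_le_mul (Real.sqrt_le_sqrt (V_le_of_le hc hxc)) (hbd x hxI) (norm_nonneg _)
          (Real.sqrt_nonneg _)

/-- The continuous representative of the first component of a pair in the form domain. -/
def primitive (g : L2) (x : ℝ) : ℂ := ∫ t in leftEnd..x, I.indicator g t

lemma integrable_indicator_L2 (g : L2) : Integrable (I.indicator g) :=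
  (integrable_L2 g).integrable_indicator measurableSet_Ioo

lemma continuous_primitive (g : L2) : Continuous (primitive g) :=
  intervalIntegral.continuous_primitive
    (fun _ _ => (integrable_indicator_L2 g).intervalIntegrable) _

lemma primitive_eq (g : L2) {x : ℝ} (hx : x ∈ Ioc leftEnd 0) :
    ∫ t in (-(Real.pi * √2))..x, g t = primitive g x := by
  refine integral_congr_L2 ?_ hx
  filter_upwards [ae_restrict_mem (measurableSet_Ioo : MeasurableSet I)] with t ht
  rw [indicator_of_mem ht]

lemma ae_eq_primitive {p : L2 × L2} (hp : p ∈ formDomain) :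
    (p.1 : ℝ → ℂ) =ᵐ[volume.restrict I] primitive p.2 := by
  filter_upwards [hp.1.1, ae_restrict_mem (measurableSet_Ioo : MeasurableSet I)] with x hx hxI
  rw [hx, primitive_eq _ ⟨hxI.1, hxI.2.le⟩]

lemma primitive_zero {p : L2 × L2} (hp : p ∈ formDomain) : primitive p.2 0 = 0 := by
  rw [← primitive_eq _ zero_mem]
  exact hp.1.2

lemma primitive_leftEnd (g : L2) : primitive g leftEnd = 0 := intervalIntegral.integral_same

/-- `p = (ψ, ψ')` solves the weak form of the eigenvalue equation for `μ`; `ψ = 0` is allowed. -/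
def IsWeakEigenpair (h : ℝ) (μ : ℂ) (p : L2 × L2) : Prop :=
  p ∈ formDomain ∧ ∀ q ∈ formDomain, form h p q = μ * inner ℂ q.1 p.1

/-- Nonzero eigenfunctions have positive eigenvalues. -/
lemma IsWeakEigenpair.exists_pos {h : ℝ} (hh : 0 < h) {μ : ℂ} {p : L2 × L2}
    (hp : IsWeakEigenpair h μ p) (h0 : p.1 ≠ 0) : ∃ lam : ℝ, 0 < lam ∧ μ = lam := by
  have h1 := hp.2 p hp.1
  have hpot : ∫ x in I, (V x : ℂ) * p.1 x * (starRingEnd ℂ) (p.1 x) =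
      ((∫ x in I, V x * ‖p.1 x‖ ^ 2 : ℝ) : ℂ) := by
    rw [← integral_complex_ofReal]
    refine integral_congr_ae (Eventually.of_forall fun x => ?_)
    simp only
    rw [mul_assoc, Complex.mul_conj, Complex.normSq_eq_norm_sq]
    push_cast
    rfl
  have hpot0 : 0 ≤ ∫ x in I, V x * ‖p.1 x‖ ^ 2 :=
    integral_nonneg fun x => mul_nonneg (V_nonneg x) (sq_nonneg _)
  rw [form, hpot, inner_self_eq_norm_sq_to_K, inner_self_eq_norm_sq_to_K] at h1
  have hn : 0 < ‖p.1‖ := norm_pos_iff.2 h0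
  have hg : p.2 ≠ 0 := fun hg => by
    refine h0 ((Lp.eq_zero_iff_ae_eq_zero).2 ?_)
    filter_upwards [hp.1.1.1, ae_restrict_mem (measurableSet_Ioo : MeasurableSet I)] with x hx hxI
    rw [hx, integral_congr_L2 (g := fun _ => 0) (by rw [hg]; exact Lp.coeFn_zero ℂ 2 _)
      ⟨hxI.1, hxI.2.le⟩]
    simp
  have hgn : 0 < ‖p.2‖ := norm_pos_iff.2 hg
  refine ⟨(h ^ 2 * ‖p.2‖ ^ 2 + ∫ x in I, V x * ‖p.1 x‖ ^ 2) / ‖p.1‖ ^ 2, by positivity, ?_⟩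
  have hn' : (‖p.1‖ : ℂ) ^ 2 ≠ 0 := pow_ne_zero 2 (Complex.ofReal_ne_zero.2 hn.ne')
  push_cast
  rw [eq_div_iff hn']
  exact h1.symm

/-- Du Bois-Reymond's lemma for the eigenvalue equation on a compact subinterval. -/
lemma IsWeakEigenpair.exists_ae_eq {h lam : ℝ} (hh : 0 < h) {p : L2 × L2}
    (hp : IsWeakEigenpair h lam p) {c d : ℝ} (hc : leftEnd < c) (hcd : c < d) (hd : d < 0) :
    ∃ m : ℂ, ∀ᵐ t ∂volume.restrict (Ioo c d), I.indicator p.2 t =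
      m - ∫ x in t..d, (((V x - lam) / h ^ 2 : ℝ) : ℂ) * primitive p.2 x := by
  set F : ℝ → ℂ := fun x => (((V x - lam) / h ^ 2 : ℝ) : ℂ) * primitive p.2 x with hF
  have hsub : Icc c d ⊆ Ioi leftEnd := fun x hx => hc.trans_le hx.1
  have hsubI : Ioo c d ⊆ I := fun x hx => ⟨hc.trans hx.1, hx.2.trans hd⟩
  have hFc : ContinuousOn F (Icc c d) :=
    (Complex.continuous_ofReal.comp_continuousOn
      (((continuousOn_V.mono hsub).sub continuousOn_const).div_const _)).mul
      (continuous_primitive p.2).continuousOn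
  have hFi : IntegrableOn F (Icc c d) := hFc.integrableOn_Icc
  set E : ℝ → ℂ := fun t => ∫ x in t..d, F x with hE
  have hEc : ContinuousOn E (Icc c d) := by
    have := intervalIntegral.continuousOn_primitive_interval_left (a := c) (b := d) (f := F)
      (by rwa [uIcc_of_le hcd.le])
    rwa [uIcc_of_le hcd.le] at this
  set H : ℝ → ℂ := fun t => I.indicator p.2 t + E t with hH
  have hfin : IsFiniteMeasure (volume.restrict (Ioo c d)) := ⟨by simp⟩
  have hgm : MemLp (I.indicator p.2) 2 (volume.restrict (Ioo c d)) :=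
    ((memLp_indicator_iff_restrict measurableSet_Ioo).2 (Lp.memLp p.2)).restrict _
  have hEm : MemLp E 2 (volume.restrict (Ioo c d)) := by
    obtain ⟨B, hB⟩ := isCompact_Icc.exists_bound_of_continuousOn hEc
    refine MemLp.of_bound ((hEc.mono Ioo_subset_Icc_self).aestronglyMeasurable measurableSet_Ioo) B
      ((ae_restrict_mem measurableSet_Ioo).mono fun x hx => hB x (Ioo_subset_Icc_self hx))
  have hHm : MemLp H 2 (volume.restrict (Ioo c d)) := hgm.add hEm
  have hHi : IntegrableOn H (Ioo c d) := hHm.integrable (by norm_num)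
  set m : ℂ := (∫ t in Ioo c d, H t) / (d - c) with hm
  have hdc : ((d : ℂ) - c) ≠ 0 := by
    rw [← Complex.ofReal_sub]
    exact Complex.ofReal_ne_zero.2 (sub_pos.2 hcd).ne'
  -- the test function is the deviation of `H` from its mean
  set k : ℝ → ℂ := (Ioo c d).indicator fun t => H t - m with hk
  have hkm' : MemLp (fun t => H t - m) 2 (volume.restrict (Ioo c d)) := hHm.sub (memLp_const m)
  have hkm : MemLp k 2 volume := (memLp_indicator_iff_restrict measurableSet_Ioo).2 hkm'
  have hki' : IntegrableOn (fun t => H t - m) (Ioo c d) := hkm'.integrable (by norm_num)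
  have hki : Integrable k := hki'.integrable_indicator measurableSet_Ioo
  have hmean : ∫ t in c..d, k t = 0 := by
    rw [intervalIntegral.integral_of_le hcd.le, integral_Ioc_eq_integral_Ioo, hk,
      setIntegral_indicator measurableSet_Ioo, inter_self, integral_sub hHi (integrable_const m),
      setIntegral_const, hm]
    simp only [Measure.real, Real.volume_Ioo, Complex.real_smul]
    rw [ENNReal.toReal_ofReal (sub_pos.2 hcd).le]
    push_cast
    rw [mul_div_cancel₀ _ hdc, sub_self]
  obtain ⟨q, hq, hq2, hq1⟩ := primitive_mem_formDomain hc hd hkm hki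
    (fun t ht => indicator_of_notMem ht _) hmean
  set Φ : ℝ → ℂ := fun x => ∫ t in leftEnd..x, k t with hΦ
  have hweak := hp.2 q hq
  -- the weak form, as an integral over `(c, d)`
  have hpot_int := integrable_form hp.1 hq
  have hin1 : inner ℂ q.1 p.1 = ∫ x in I, p.1 x * (starRingEnd ℂ) (q.1 x) := by
    rw [L2.inner_def]; rfl
  have hin2 : inner ℂ q.2 p.2 = ∫ x in I, p.2 x * (starRingEnd ℂ) (q.2 x) := by
    rw [L2.inner_def]; rfl
  have hint1 : Integrable (fun x => p.1 x * (starRingEnd ℂ) (q.1 x)) (volume.restrict I) := by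
    have := L2.integrable_inner (𝕜 := ℂ) q.1 p.1
    exact this
  have hsum : inner ℂ q.2 p.2 = -∫ x in I, F x * (starRingEnd ℂ) (Φ x) := by
    have e1 : ∫ x in I, F x * (starRingEnd ℂ) (Φ x) =
        ((h : ℂ) ^ 2)⁻¹ * ((∫ x in I, (V x : ℂ) * p.1 x * (starRingEnd ℂ) (q.1 x)) -
          lam * ∫ x in I, p.1 x * (starRingEnd ℂ) (q.1 x)) := by
      rw [← integral_const_mul (lam : ℂ), ← integral_sub hpot_int (hint1.const_mul _),
        ← integral_const_mul]
      refine integral_congr_ae ?_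
      filter_upwards [hq1, ae_eq_primitive hp.1] with x h1 h2
      rw [h1, h2]
      simp only [hF]
      push_cast
      ring
    rw [form, hin1] at hweak
    rw [e1, ← hweak]
    have : (h : ℂ) ^ 2 ≠ 0 := pow_ne_zero 2 (Complex.ofReal_ne_zero.2 hh.ne')
    rw [sub_add_cancel_right, mul_neg, neg_neg, inv_mul_cancel_left₀ this]
  have hΦ0 : ∀ x ∈ I, x ∉ Ioo c d → Φ x = 0 := by
    intro x hx hxcd
    have hii : ∀ x y, IntervalIntegrable k volume x y := fun x y => hki.intervalIntegrable
    have hz : ∀ x y, (∀ t ∈ uIoc x y, t ∉ Ioo c d) → ∫ t in x..y, k t = 0 := fun x y h =>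
      intervalIntegral.integral_zero_ae (Eventually.of_forall fun t ht =>
        indicator_of_notMem (h t ht) _)
    have hl : ∀ x, leftEnd ≤ x → x ≤ c → ∫ t in leftEnd..x, k t = 0 := fun x hx hxc =>
      hz _ _ fun t ht ht' => by
        rw [uIoc_of_le hx] at ht
        linarith [ht.2, ht'.1]
    rcases le_or_gt x c with hxc | hxc
    · exact hl x (le_of_lt hx.1) hxc
    · have hxd : d ≤ x := by
        by_contra! hlt
        exact hxcd ⟨hxc, hlt⟩
      simp only [hΦ]
      rw [← intervalIntegral.integral_add_adjacent_intervals (hii leftEnd c) (hii c x),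
        hl c hc.le le_rfl, ← intervalIntegral.integral_add_adjacent_intervals (hii c d) (hii d x),
        hmean, hz d x fun t ht ht' => by
          rw [uIoc_of_le hxd] at ht
          linarith [ht.1, ht'.2]]
      simp
  have hΦc : ∀ x ∈ Ioo c d, Φ x = ∫ t in c..x, k t := fun x hx => by
    have hii : ∀ x y, IntervalIntegrable k volume x y := fun x y => hki.intervalIntegrable
    simp only [hΦ]
    rw [← intervalIntegral.integral_add_adjacent_intervals (hii leftEnd c) (hii c x),
      intervalIntegral.integral_zero_ae (a := leftEnd) (b := c) (Eventually.of_forall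
        fun t ht => indicator_of_notMem (fun ht' => by
          rw [uIoc_of_le hc.le] at ht
          exact absurd ht'.1 (not_lt.2 ht.2)) _), zero_add]
  have hconjk : IntegrableOn (fun t => (starRingEnd ℂ) (k t)) (Ioc c d) :=
    (Complex.conjCLE.toContinuousLinearMap.integrable_comp hki).integrableOn
  have e2 : ∫ x in I, F x * (starRingEnd ℂ) (Φ x) =
      ∫ t in c..d, E t * (starRingEnd ℂ) (k t) := by
    have hsubint : ∫ x in I, F x * (starRingEnd ℂ) (Φ x) =
        ∫ x in Ioo c d, F x * (starRingEnd ℂ) (Φ x) :=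
      setIntegral_eq_of_subset_of_forall_sdiff_eq_zero measurableSet_Ioo hsubI
        fun x hx => by rw [hΦ0 x hx.1 hx.2, map_zero, mul_zero]
    rw [hsubint, hE,
      ← integral_mul_primitive hcd.le (hFi.mono_set Ioc_subset_Icc_self) hconjk,
      intervalIntegral.integral_of_le hcd.le, integral_Ioc_eq_integral_Ioo]
    refine setIntegral_congr_fun measurableSet_Ioo fun x hx => ?_
    rw [hΦc x hx, intervalIntegral.integral_of_le hx.1.le, intervalIntegral.integral_of_le hx.1.le,
      integral_conj]
  have e3 : inner ℂ q.2 p.2 = ∫ t in c..d, I.indicator p.2 t * (starRingEnd ℂ) (k t) := by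
    rw [hin2, intervalIntegral.integral_of_le hcd.le, integral_Ioc_eq_integral_Ioo,
      ← setIntegral_eq_of_subset_of_forall_sdiff_eq_zero measurableSet_Ioo hsubI
      (fun x hx => by rw [hk, indicator_of_notMem hx.2, map_zero, mul_zero])]
    refine integral_congr_ae ?_
    filter_upwards [hq2, ae_restrict_mem (measurableSet_Ioo : MeasurableSet I)] with x h1 h2
    rw [h1, indicator_of_mem h2]
  have hconjkm : MemLp (fun t => (starRingEnd ℂ) (k t)) 2 (volume.restrict (Ioo c d)) :=
    (hkm.restrict _).star
  have hi1 : IntegrableOn (fun t => I.indicator p.2 t * (starRingEnd ℂ) (k t)) (Ioo c d) :=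
    MemLp.integrable_mul hgm hconjkm
  have hi2 : IntegrableOn (fun t => E t * (starRingEnd ℂ) (k t)) (Ioo c d) :=
    MemLp.integrable_mul hEm hconjkm
  have hi3 : IntegrableOn (fun t => m * (starRingEnd ℂ) (k t)) (Ioo c d) :=
    (hconjk.mono_set Ioo_subset_Ioc_self).const_mul m
  have hzero : ∫ t in Ioo c d, ‖k t‖ ^ 2 = 0 := by
    have h1 : ∫ t in Ioo c d, m * (starRingEnd ℂ) (k t) = 0 := by
      rw [integral_const_mul, integral_conj]
      rw [intervalIntegral.integral_of_le hcd.le, integral_Ioc_eq_integral_Ioo] at hmean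
      rw [hmean, map_zero, mul_zero]
    rw [hsum, e2, intervalIntegral.integral_of_le hcd.le, intervalIntegral.integral_of_le hcd.le,
      integral_Ioc_eq_integral_Ioo, integral_Ioc_eq_integral_Ioo] at e3
    have h2 : ∫ t in Ioo c d, ((‖k t‖ ^ 2 : ℝ) : ℂ) = 0 := by
      have h3 : ∫ t in Ioo c d, ((‖k t‖ ^ 2 : ℝ) : ℂ) =
          ∫ t in Ioo c d, ((I.indicator p.2 t * (starRingEnd ℂ) (k t) +
            E t * (starRingEnd ℂ) (k t)) - m * (starRingEnd ℂ) (k t)) := by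
        refine setIntegral_congr_fun measurableSet_Ioo fun t ht => ?_
        have h4 : k t = I.indicator p.2 t + E t - m := by rw [hk, indicator_of_mem ht]
        have h5 : ((‖k t‖ ^ 2 : ℝ) : ℂ) = k t * (starRingEnd ℂ) (k t) := by
          rw [Complex.mul_conj, Complex.normSq_eq_norm_sq]
        rw [h5]
        linear_combination (starRingEnd ℂ) (k t) * h4
      have h6 := integral_sub (hi1.add hi2) hi3
      have h7 := integral_add hi1 hi2
      simp only [Pi.add_apply] at h6
      rw [h3, h6, h7, h1, ← e3]
      ring
    rw [integral_complex_ofReal] at h2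
    exact_mod_cast h2
  have hk2 : IntegrableOn (fun t => ‖k t‖ ^ 2) (Ioo c d) := (hkm.restrict _).norm.integrable_sq
  have hae := (integral_eq_zero_iff_of_nonneg (fun t => sq_nonneg ‖k t‖) hk2).1 hzero
  refine ⟨m, ?_⟩
  filter_upwards [hae, ae_restrict_mem measurableSet_Ioo] with t h1 h2
  have h3 : k t = 0 := by simpa using h1
  rw [hk, indicator_of_mem h2] at h3
  simp only [hH] at h3
  linear_combination h3

/-- Eigenfunctions are classical solutions of the eigenvalue equation. -/
lemma IsWeakEigenpair.hasDerivAt {h lam : ℝ} (hh : 0 < h) {p : L2 × L2}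
    (hp : IsWeakEigenpair h lam p) {x : ℝ} (hx : x ∈ I) :
    HasDerivAt (primitive p.2) (deriv (primitive p.2) x) x ∧
      HasDerivAt (deriv (primitive p.2))
        ((((V x - lam) / h ^ 2 : ℝ) : ℂ) * primitive p.2 x) x := by
  obtain ⟨c, hc, hcx⟩ := exists_between hx.1
  obtain ⟨d, hxd, hd⟩ := exists_between hx.2
  have hcd : c < d := hcx.trans hxd
  have hc' : leftEnd < c := hc
  obtain ⟨m, hm⟩ := hp.exists_ae_eq hh hc' hcd hd
  set F : ℝ → ℂ := fun x => (((V x - lam) / h ^ 2 : ℝ) : ℂ) * primitive p.2 x with hF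
  have hFc : ContinuousOn F (Ioi leftEnd) :=
    (Complex.continuous_ofReal.comp_continuousOn
      ((continuousOn_V.sub continuousOn_const).div_const _)).mul
      (continuous_primitive p.2).continuousOn
  have hFi : ∀ y ∈ Ioi leftEnd, ∀ z ∈ Ioi leftEnd, IntervalIntegrable F volume y z :=
    fun y hy z hz => (hFc.mono (ordConnected_Ioi.uIcc_subset hy hz)).intervalIntegrable
  set P : ℝ → ℂ := fun t => m - ∫ y in t..d, F y with hP
  have hd' : d ∈ Ioi leftEnd := hc'.trans hcd
  have hPd : ∀ t ∈ Ioi leftEnd, HasDerivAt P (F t) t := fun t ht => by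
    have h1 := intervalIntegral.integral_hasDerivAt_left (hFi t ht d hd')
      (hFc.stronglyMeasurableAtFilter isOpen_Ioi t ht) (hFc.continuousAt (Ioi_mem_nhds ht))
    simpa using h1.const_sub m
  have hPc : ContinuousOn P (Ioi leftEnd) := fun t ht => (hPd t ht).continuousAt.continuousWithinAt
  have hgi : ∀ y z, IntervalIntegrable (I.indicator p.2) volume y z := fun y z =>
    (integrable_indicator_L2 p.2).intervalIntegrable
  have hprim : ∀ t ∈ Ioo c d, primitive p.2 t = primitive p.2 c + ∫ y in c..t, P y := by
    intro t ht
    rw [primitive, primitive, ← intervalIntegral.integral_add_adjacent_intervals (hgi leftEnd c)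
      (hgi c t)]
    congr 1
    rw [intervalIntegral.integral_of_le ht.1.le, intervalIntegral.integral_of_le ht.1.le,
      integral_Ioc_eq_integral_Ioo, integral_Ioc_eq_integral_Ioo]
    exact integral_congr_ae (ae_restrict_of_ae_restrict_of_subset
      (Ioo_subset_Ioo_right ht.2.le) hm)
  have hder : ∀ t ∈ Ioo c d, HasDerivAt (primitive p.2) (P t) t := by
    intro t ht
    have ht' : t ∈ Ioi leftEnd := hc'.trans ht.1
    have h1 := intervalIntegral.integral_hasDerivAt_right
      ((hPc.mono (ordConnected_Ioi.uIcc_subset (mem_Ioi.2 hc') ht')).intervalIntegrable)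
      (hPc.stronglyMeasurableAtFilter isOpen_Ioi t ht') (hPc.continuousAt (Ioi_mem_nhds ht'))
    refine (h1.const_add (primitive p.2 c)).congr_of_eventuallyEq ?_
    filter_upwards [Ioo_mem_nhds ht.1 ht.2] with y hy using hprim y hy
  have hxm : x ∈ Ioo c d := ⟨hcx, hxd⟩
  refine ⟨(hder x hxm).differentiableAt.hasDerivAt, ?_⟩
  refine (hPd x (hc'.trans hcx)).congr_of_eventuallyEq ?_
  filter_upwards [Ioo_mem_nhds hcx hxd] with y hy using (hder y hy).deriv

/-! ### Classification of the eigenfunctions -/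

lemma one_lt_besselIndex_add {h : ℝ} (hh : 0 < h) : 1 < besselIndex h + 1 / 2 := by
  have h1 : (1 / 2 : ℝ) < besselIndex h := by
    refine Real.lt_sqrt_of_sq_lt ?_
    have : 0 < Real.pi ^ 2 / (4 * h ^ 2) := by positivity
    linarith
  linarith

lemma besselIndex_mul {h : ℝ} (hh : 0 < h) :
    (besselIndex h + 1 / 2) * (besselIndex h + 1 / 2 - 1) = Real.pi ^ 2 / (4 * h ^ 2) := by
  have h1 : besselIndex h ^ 2 = 1 / 4 + Real.pi ^ 2 / (4 * h ^ 2) := Real.sq_sqrt (by positivity)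
  linear_combination h1

/-- In the variable `y = κ (x + π√2)`, the eigenvalue equation for `(h κ)²` is Bessel's equation. -/
lemma potential_eq_besselCoeff {h κ x : ℝ} (hh : 0 < h) (hκ : 0 < κ) (hx : leftEnd < x) :
    (V x - (h * κ) ^ 2) / h ^ 2 =
      κ ^ 2 * besselCoeff (besselIndex h + 1 / 2) (κ * (x - leftEnd)) := by
  have h1 : 0 < x - leftEnd := sub_pos.2 hx
  rw [V_eq, besselCoeff, besselIndex_mul hh]
  field_simp

/-- The solution `f_s(κ (x + π√2))` of the eigenvalue equation which is recessive at `-π√2`. -/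
def besselMode (s κ x : ℝ) : ℝ := besselF s (κ * (x - leftEnd))

/-- The derivative of `besselMode`. -/
def besselMode' (s κ x : ℝ) : ℝ := κ * besselF' s (κ * (x - leftEnd))

lemma isSol_besselMode {h κ : ℝ} (hh : 0 < h) (hκ : 0 < κ) :
    IsSol (fun x => (V x - (h * κ) ^ 2) / h ^ 2) (Ioi leftEnd)
      (besselMode (besselIndex h + 1 / 2) κ) (besselMode' (besselIndex h + 1 / 2) κ) := by
  intro x hx
  have hx0 : 0 < κ * (x - leftEnd) := mul_pos hκ (sub_pos.2 hx)
  obtain ⟨h1, h2⟩ := isSol_besselF (one_lt_besselIndex_add hh) _ hx0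
  have h3 : HasDerivAt (fun x : ℝ => κ * (x - leftEnd)) κ x := by
    simpa using ((hasDerivAt_id x).sub_const leftEnd).const_mul κ
  have h4 := (h2.comp x h3).const_mul κ
  refine ⟨(h1.comp x h3).congr_deriv (mul_comm _ _), HasDerivAt.congr_deriv h4 ?_⟩
  beta_reduce
  rw [potential_eq_besselCoeff hh hκ hx, besselMode]
  ring

lemma continuous_besselMode {s : ℝ} (hs : 1 < s) (κ : ℝ) : Continuous (besselMode s κ) :=
  (continuous_besselF hs).comp (by fun_prop)

/-- An eigenfunction is a multiple of the recessive solution, and vanishes at `0`. -/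
lemma IsWeakEigenpair.exists_eq_const_mul {h κ : ℝ} (hh : 0 < h) (hκ : 0 < κ) {p : L2 × L2}
    (hp : IsWeakEigenpair h ((h * κ) ^ 2 : ℝ) p) :
    ∃ c : ℂ, (∀ x ∈ I, primitive p.2 x = c * besselMode (besselIndex h + 1 / 2) κ x) ∧
      c * besselMode (besselIndex h + 1 / 2) κ 0 = 0 := by
  set s := besselIndex h + 1 / 2 with hs
  have hs1 : 1 < s := one_lt_besselIndex_add hh
  have hY : 0 < κ * (0 - leftEnd) := mul_pos hκ (sub_pos.2 leftEnd_neg)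
  have hmem : ∀ y ∈ Ioo 0 (κ * (0 - leftEnd)), leftEnd + y / κ ∈ I := fun y hy => by
    refine ⟨?_, ?_⟩
    · have : 0 < y / κ := div_pos hy.1 hκ
      change leftEnd < _
      linarith
    · have : y / κ < 0 - leftEnd := (div_lt_iff₀' hκ).2 hy.2
      linarith
  -- real and imaginary parts are treated separately
  have key : ∀ ℓ : ℂ →L[ℝ] ℝ, ∃ c : ℝ, ∀ x ∈ I, ℓ (primitive p.2 x) = c * besselMode s κ x := by
    intro ℓ
    have hsol : IsSol (besselCoeff s) (Ioo 0 (κ * (0 - leftEnd)))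
        (fun y => ℓ (primitive p.2 (leftEnd + y / κ)))
        (fun y => ℓ (deriv (primitive p.2) (leftEnd + y / κ)) * κ⁻¹) := by
      intro y hy
      obtain ⟨h1, h2⟩ := hp.hasDerivAt hh (hmem y hy)
      have h3 : HasDerivAt (fun y : ℝ => leftEnd + y / κ) κ⁻¹ y := by
        simpa using ((hasDerivAt_id y).div_const κ).const_add leftEnd
      have h4 := (ℓ.hasFDerivAt.comp_hasDerivAt _ h1).comp y h3
      have h5 := ((ℓ.hasFDerivAt.comp_hasDerivAt _ h2).comp y h3).mul_const κ⁻¹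
      refine ⟨h4, h5.congr_deriv ?_⟩
      have h6 : (((V (leftEnd + y / κ) - (h * κ) ^ 2) / h ^ 2 : ℝ) : ℂ) *
          primitive p.2 (leftEnd + y / κ) = ((V (leftEnd + y / κ) - (h * κ) ^ 2) / h ^ 2) •
            primitive p.2 (leftEnd + y / κ) := (Complex.real_smul).symm
      rw [h6, map_smul, potential_eq_besselCoeff hh hκ (hmem y hy).1, smul_eq_mul,
        add_sub_cancel_left, mul_div_cancel₀ _ hκ.ne', ← hs]
      have h7 : κ * κ⁻¹ = 1 := mul_inv_cancel₀ hκ.ne'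
      linear_combination
        besselCoeff s y * ℓ (primitive p.2 (leftEnd + y / κ)) * (κ * κ⁻¹ + 1) * h7
    obtain ⟨c, hc⟩ := hsol.eq_const_mul_besselF hs1 ordConnected_Ioo (fun y hy => hy.1)
      (Ioo_mem_nhdsGT hY) (by
        have h1 : Continuous fun y : ℝ => ℓ (primitive p.2 (leftEnd + y / κ)) :=
          ℓ.continuous.comp ((continuous_primitive p.2).comp (by fun_prop))
        have h2 := h1.tendsto 0
        rw [zero_div, add_zero, primitive_leftEnd, map_zero] at h2
        exact h2.mono_left nhdsWithin_le_nhds)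
    refine ⟨c, fun x hx => ?_⟩
    have hx1 : leftEnd < x := hx.1
    have h1 := hc (κ * (x - leftEnd)) ⟨mul_pos hκ (sub_pos.2 hx1),
      mul_lt_mul_of_pos_left (sub_lt_sub_right hx.2 _) hκ⟩
    rwa [mul_div_cancel_left₀ _ hκ.ne', add_sub_cancel] at h1
  obtain ⟨a, ha⟩ := key Complex.reCLM
  obtain ⟨b, hb⟩ := key Complex.imCLM
  have hc : ∀ x ∈ I, primitive p.2 x = (⟨a, b⟩ : ℂ) * besselMode s κ x := fun x hx => by
    refine Complex.ext ?_ ?_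
    · rw [Complex.re_mul_ofReal]
      exact ha x hx
    · rw [Complex.im_mul_ofReal]
      exact hb x hx
  refine ⟨⟨a, b⟩, hc, ?_⟩
  have h1 : Tendsto (primitive p.2) (𝓝[<] 0) (𝓝 0) := by
    have := (continuous_primitive p.2).tendsto 0
    rw [primitive_zero hp.1] at this
    exact this.mono_left nhdsWithin_le_nhds
  have h2 : Tendsto (fun x => (⟨a, b⟩ : ℂ) * besselMode s κ x) (𝓝[<] 0)
      (𝓝 ((⟨a, b⟩ : ℂ) * besselMode s κ 0)) :=
    ((continuous_const.mul (Complex.continuous_ofReal.comp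
      (continuous_besselMode hs1 κ))).tendsto 0).mono_left nhdsWithin_le_nhds
  refine tendsto_nhds_unique h2 (h1.congr' ?_)
  filter_upwards [Ioo_mem_nhdsLT leftEnd_neg] with x hx using hc x hx

/-! ### Existence of the eigenfunctions -/

lemma continuousOn_besselF' {s : ℝ} (hs : 1 < s) : ContinuousOn (besselF' s) (Ici 0) := by
  intro x hx
  rcases eq_or_lt_of_le (mem_Ici.1 hx) with rfl | hx0
  · have h0 : besselF' s 0 = 0 := by
      have := abs_besselF'_le hs le_rfl (x := 0)
      rw [Real.zero_rpow (by linarith), mul_zero] at this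
      exact abs_nonpos_iff.1 this
    rw [ContinuousWithinAt, h0]
    have h1 : Tendsto (fun x : ℝ => 2 * (s + x) * x ^ (s - 1)) (𝓝[≥] 0) (𝓝 0) := by
      have : Continuous fun x : ℝ => 2 * (s + x) * x ^ (s - 1) := by
        have := Real.continuous_rpow_const (q := s - 1) (by linarith)
        fun_prop
      have h2 := this.tendsto 0
      rw [Real.zero_rpow (by linarith), mul_zero] at h2
      exact h2.mono_left nhdsWithin_le_nhds
    refine squeeze_zero_norm' ?_ h1
    filter_upwards [self_mem_nhdsWithin] with x hx using abs_besselF'_le hs hx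
  · exact (isSol_besselF hs x hx0).2.continuousAt.continuousWithinAt

lemma continuousOn_besselMode' {s κ : ℝ} (hs : 1 < s) (hκ : 0 < κ) :
    ContinuousOn (besselMode' s κ) (Ici leftEnd) :=
  continuousOn_const.mul ((continuousOn_besselF' hs).comp (by fun_prop)
    fun _ hx => mul_nonneg hκ.le (sub_nonneg.2 hx))

lemma besselMode_leftEnd {s : ℝ} (hs : 1 < s) (κ : ℝ) : besselMode s κ leftEnd = 0 := by
  rw [besselMode, sub_self, mul_zero, besselF_zero hs]

/-- The potential term `V u` is integrable, although `V` is not. -/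
lemma integrableOn_potential_mul {h κ : ℝ} (hh : 0 < h) (hκ : 0 < κ) :
    IntegrableOn (fun x => V x * besselMode (besselIndex h + 1 / 2) κ x) (Ioc leftEnd 0) := by
  set s := besselIndex h + 1 / 2 with hs
  have hs1 : 1 < s := one_lt_besselIndex_add hh
  have h1 : IntervalIntegrable (fun x : ℝ => (x - leftEnd) ^ (s - 2)) volume leftEnd 0 := by
    have := (intervalIntegral.intervalIntegrable_rpow' (r := s - 2) (a := 0) (b := 0 - leftEnd)
      (by linarith)).comp_sub_right leftEnd
    simpa using this
  rw [intervalIntegrable_iff_integrableOn_Ioc_of_le leftEnd_neg.le] at h1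
  refine (h1.const_mul (Real.pi ^ 2 / 2 * κ ^ s)).mono'
    (measurable_V.aestronglyMeasurable.mul
      (continuous_besselMode hs1 κ).aestronglyMeasurable) ?_
  filter_upwards [ae_restrict_mem measurableSet_Ioc] with x hx
  have hx0 : 0 < x - leftEnd := sub_pos.2 hx.1
  rw [Real.norm_eq_abs, abs_mul, abs_of_nonneg (V_nonneg x), V_eq, besselMode]
  refine (mul_le_mul_of_nonneg_left (abs_besselF_le hs1 (by positivity)) (by positivity)).trans ?_
  rw [Real.mul_rpow hκ.le hx0.le, Real.rpow_sub hx0, Real.rpow_two]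
  refine le_of_eq ?_
  field_simp
  norm_num

lemma abs_sqrt_potential_mul_le {s κ x : ℝ} (hs : 1 < s) (hκ : 0 < κ) (hx : x ∈ I) :
    |√(V x) * besselMode s κ x| ≤ Real.pi * κ * (κ * (0 - leftEnd)) ^ (s - 1) := by
  have hx0 : 0 < x - leftEnd := sub_pos.2 hx.1
  have h1 : √(V x) = Real.pi / (2 * (x - leftEnd)) := by
    rw [V_eq, show Real.pi ^ 2 / (4 * (x - leftEnd) ^ 2) = (Real.pi / (2 * (x - leftEnd))) ^ 2 by
      rw [div_pow, mul_pow]; norm_num, Real.sqrt_sq (by positivity)]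
  rw [h1, abs_mul, abs_of_nonneg (by positivity), besselMode]
  refine (mul_le_mul_of_nonneg_left (abs_besselF_le hs (by positivity)) (by positivity)).trans ?_
  have h2 : (κ * (x - leftEnd)) ^ s = κ * (x - leftEnd) * (κ * (x - leftEnd)) ^ (s - 1) := by
    conv_lhs => rw [show s = 1 + (s - 1) by ring]
    rw [Real.rpow_add (by positivity), Real.rpow_one]
  have h3 : (κ * (x - leftEnd)) ^ (s - 1) ≤ (κ * (0 - leftEnd)) ^ (s - 1) :=
    Real.rpow_le_rpow (by positivity)
      (mul_le_mul_of_nonneg_left (sub_le_sub_right hx.2.le _) hκ.le) (by linarith)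
  rw [h2]
  calc Real.pi / (2 * (x - leftEnd)) *
        (2 * (κ * (x - leftEnd) * (κ * (x - leftEnd)) ^ (s - 1)))
      = Real.pi * κ * (κ * (x - leftEnd)) ^ (s - 1) := by field_simp
    _ ≤ _ := mul_le_mul_of_nonneg_left h3 (by positivity)

/-- If the recessive solution vanishes at `0`, it is in the form domain. -/
lemma exists_besselMode_mem {h κ : ℝ} (hh : 0 < h) (hκ : 0 < κ)
    (h0 : besselMode (besselIndex h + 1 / 2) κ 0 = 0) :
    ∃ p ∈ formDomain,
      (p.1 =ᵐ[volume.restrict I] fun x => (besselMode (besselIndex h + 1 / 2) κ x : ℂ)) ∧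
      (p.2 =ᵐ[volume.restrict I] fun x => (besselMode' (besselIndex h + 1 / 2) κ x : ℂ)) := by
  set s := besselIndex h + 1 / 2 with hs
  have hs1 : 1 < s := one_lt_besselIndex_add hh
  have hc1 : ContinuousOn (fun x => (besselMode s κ x : ℂ)) (Icc leftEnd 0) :=
    (Complex.continuous_ofReal.comp (continuous_besselMode hs1 κ)).continuousOn
  have hc2 : ContinuousOn (fun x => (besselMode' s κ x : ℂ)) (Icc leftEnd 0) :=
    Complex.continuous_ofReal.comp_continuousOn
      ((continuousOn_besselMode' hs1 hκ).mono fun x hx => hx.1)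
  have hmem : ∀ f : ℝ → ℂ, ContinuousOn f (Icc leftEnd 0) → MemLp f 2 (volume.restrict I) := by
    intro f hf
    obtain ⟨B, hB⟩ := isCompact_Icc.exists_bound_of_continuousOn hf
    exact MemLp.of_bound ((hf.mono Ioo_subset_Icc_self).aestronglyMeasurable measurableSet_Ioo) B
      ((ae_restrict_mem measurableSet_Ioo).mono fun x hx => hB x (Ioo_subset_Icc_self hx))
  have m1 := hmem _ hc1
  have m2 := hmem _ hc2
  have ftc : ∀ x ∈ Ioc (-(Real.pi * √2)) 0,
      ∫ t in (-(Real.pi * √2))..x, (m2.toLp _ : L2) t = (besselMode s κ x : ℂ) := fun x hx => by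
    have hsub : Icc leftEnd x ⊆ Icc leftEnd 0 := Icc_subset_Icc_right hx.2
    have h1 := intervalIntegral.integral_eq_sub_of_hasDerivAt_of_le (a := leftEnd) (b := x)
      hx.1.le (hc1.mono hsub) (fun t ht => (isSol_besselMode hh hκ t ht.1).1.ofReal_comp)
      ((hc2.mono hsub).intervalIntegrable_of_Icc hx.1.le)
    rw [integral_congr_L2 m2.coeFn_toLp hx]
    refine h1.trans ?_
    rw [besselMode_leftEnd hs1, Complex.ofReal_zero, sub_zero]
  refine ⟨(m1.toLp _, m2.toLp _), ⟨⟨?_, ?_⟩, ?_⟩, m1.coeFn_toLp, m2.coeFn_toLp⟩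
  · filter_upwards [m1.coeFn_toLp,
      ae_restrict_mem (measurableSet_Ioo : MeasurableSet I)] with x hx hxI
    rw [ftc x ⟨hxI.1, hxI.2.le⟩]
    exact hx
  · rw [ftc 0 zero_mem, h0, Complex.ofReal_zero]
  · refine MemLp.ae_eq (f := fun x => (√(V x) : ℂ) * (besselMode s κ x : ℂ)) ?_
      (MemLp.of_bound ?_ (Real.pi * κ * (κ * (0 - leftEnd)) ^ (s - 1)) ?_)
    · filter_upwards [m1.coeFn_toLp] with x hx
      rw [hx]
    · exact (Complex.measurable_ofReal.comp measurable_V.sqrt).aestronglyMeasurable.mul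
        m1.aestronglyMeasurable
    · filter_upwards [ae_restrict_mem (measurableSet_Ioo : MeasurableSet I)] with x hxI
      rw [← Complex.ofReal_mul, Complex.norm_real]
      exact abs_sqrt_potential_mul_le hs1 hκ hxI

/-- If the recessive solution vanishes at `0`, it is an eigenfunction. -/
lemma exists_isWeakEigenpair {h κ : ℝ} (hh : 0 < h) (hκ : 0 < κ)
    (h0 : besselMode (besselIndex h + 1 / 2) κ 0 = 0) :
    ∃ p, IsWeakEigenpair h ((h * κ) ^ 2 : ℝ) p ∧
      p.1 =ᵐ[volume.restrict I] fun x => (besselMode (besselIndex h + 1 / 2) κ x : ℂ) := by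
  obtain ⟨p, hp, hp1, hp2⟩ := exists_besselMode_mem hh hκ h0
  refine ⟨p, ⟨hp, fun q hq => ?_⟩, hp1⟩
  set s := besselIndex h + 1 / 2 with hs
  have hs1 : 1 < s := one_lt_besselIndex_add hh
  have hle := leftEnd_neg.le
  set F : ℝ → ℂ := fun x => (((V x - (h * κ) ^ 2) / h ^ 2 * besselMode s κ x : ℝ) : ℂ) with hF
  set k : ℝ → ℂ := fun t => (starRingEnd ℂ) (I.indicator q.2 t) with hk
  have hFi : IntegrableOn F (Ioc leftEnd 0) := by
    have h1 : IntegrableOn (fun x => (h * κ) ^ 2 * besselMode s κ x) (Ioc leftEnd 0) :=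
      ((continuous_besselMode hs1 κ).const_mul _ |>.integrableOn_Icc).mono_set Ioc_subset_Icc_self
    refine Integrable.ofReal (((integrableOn_potential_mul hh hκ).sub h1).div_const
      (h ^ 2) |>.congr (Eventually.of_forall fun x => ?_))
    change (V x * besselMode s κ x - (h * κ) ^ 2 * besselMode s κ x) / h ^ 2 =
      (V x - (h * κ) ^ 2) / h ^ 2 * besselMode s κ x
    ring
  have hki : Integrable k :=
    Complex.conjCLE.toContinuousLinearMap.integrable_comp (integrable_indicator_L2 q.2)
  have hu'c : ContinuousOn (fun x => (besselMode' s κ x : ℂ)) (Icc leftEnd 0) :=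
    Complex.continuous_ofReal.comp_continuousOn
      ((continuousOn_besselMode' hs1 hκ).mono fun x hx => hx.1)
  have hFt : ∀ t ∈ Ioc leftEnd 0, ∫ x in t..0, F x = besselMode' s κ 0 - besselMode' s κ t :=
    fun t ht => by
      refine intervalIntegral.integral_eq_sub_of_hasDerivAt_of_le ht.2
        (hu'c.mono (Icc_subset_Icc_left ht.1.le))
        (fun x hx => (isSol_besselMode hh hκ x (ht.1.trans hx.1)).2.ofReal_comp) ?_
      rw [intervalIntegrable_iff_integrableOn_Ioc_of_le ht.2]
      exact hFi.mono_set (Ioc_subset_Ioc_left ht.1.le)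
  have hk0 : ∫ t in leftEnd..0, k t = 0 := by
    have h1 := primitive_zero hq
    rw [primitive, intervalIntegral.integral_of_le hle] at h1
    rw [intervalIntegral.integral_of_le hle, hk, integral_conj, h1, map_zero]
  have hkq : ∀ x, ∫ t in leftEnd..x, k t = (starRingEnd ℂ) (primitive q.2 x) := fun x => by
    rw [primitive, intervalIntegral, intervalIntegral, map_sub, hk, integral_conj, integral_conj]
  have hin1 : inner ℂ q.1 p.1 = ∫ x in I, p.1 x * (starRingEnd ℂ) (q.1 x) := by
    rw [L2.inner_def]; rfl
  have hin2 : inner ℂ q.2 p.2 = ∫ x in I, p.2 x * (starRingEnd ℂ) (q.2 x) := by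
    rw [L2.inner_def]; rfl
  have hint1 : Integrable (fun x => p.1 x * (starRingEnd ℂ) (q.1 x)) (volume.restrict I) :=
    L2.integrable_inner (𝕜 := ℂ) q.1 p.1
  have hint2 : Integrable (fun x => p.2 x * (starRingEnd ℂ) (q.2 x)) (volume.restrict I) :=
    L2.integrable_inner (𝕜 := ℂ) q.2 p.2
  have hparts := integral_mul_primitive hle hFi hki.integrableOn
  have e1 : ∫ x in leftEnd..0, F x * ∫ t in leftEnd..x, k t =
      ((h : ℂ) ^ 2)⁻¹ * ((∫ x in I, (V x : ℂ) * p.1 x * (starRingEnd ℂ) (q.1 x)) -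
        ((h * κ) ^ 2 : ℝ) * ∫ x in I, p.1 x * (starRingEnd ℂ) (q.1 x)) := by
    rw [intervalIntegral.integral_of_le hle, integral_Ioc_eq_integral_Ioo, ← I_eq,
      ← integral_const_mul (((h * κ) ^ 2 : ℝ) : ℂ),
      ← integral_sub (integrable_form hp hq) (hint1.const_mul _), ← integral_const_mul]
    refine integral_congr_ae ?_
    filter_upwards [hp1, ae_eq_primitive hq] with x h1 h2
    rw [h1, h2, hkq x]
    simp only [hF]
    push_cast
    ring
  have e2 : ∫ t in leftEnd..0, (∫ x in t..0, F x) * k t = -inner ℂ q.2 p.2 := by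
    have h1 : ∫ t in leftEnd..0, (∫ x in t..0, F x) * k t =
        ∫ t in leftEnd..0, ((besselMode' s κ 0 : ℂ) * k t - besselMode' s κ t * k t) := by
      rw [intervalIntegral.integral_of_le hle, intervalIntegral.integral_of_le hle]
      refine setIntegral_congr_fun measurableSet_Ioc fun t ht => ?_
      simp only [hFt t ht]
      ring
    have h3 : ∀ᵐ t ∂volume.restrict I, (p.2 : ℝ → ℂ) t * (starRingEnd ℂ) (q.2 t) =
        besselMode' s κ t * k t := by
      filter_upwards [hp2, ae_restrict_mem (measurableSet_Ioo : MeasurableSet I)] with t h1 h2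
      simp only [hk]
      rw [h1, indicator_of_mem h2]
    have h4 : IntervalIntegrable (fun t => (besselMode' s κ t : ℂ) * k t) volume leftEnd 0 := by
      rw [intervalIntegrable_iff_integrableOn_Ioo_of_le hle, ← I_eq]
      exact hint2.congr h3
    rw [h1, intervalIntegral.integral_sub (hki.intervalIntegrable.const_mul _) h4,
      intervalIntegral.integral_const_mul, hk0, mul_zero, zero_sub, hin2,
      integral_congr_ae h3, intervalIntegral.integral_of_le hle, integral_Ioc_eq_integral_Ioo, I_eq]
  rw [e1, e2] at hparts
  have hh2 : (h : ℂ) ^ 2 ≠ 0 := pow_ne_zero 2 (Complex.ofReal_ne_zero.2 hh.ne')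
  rw [inv_mul_eq_iff_eq_mul₀ hh2] at hparts
  rw [form, hin1]
  linear_combination hparts

lemma besselMode_ne_zero {s κ : ℝ} (hs : 1 < s) (hκ : 0 < κ) :
    ¬ ∀ᵐ x ∂volume.restrict I, (besselMode s κ x : ℂ) = 0 := by
  intro h
  obtain ⟨r, hr, hr0⟩ : ∃ r, leftEnd < r ∧ r ≤ 0 ∧ κ * (r - leftEnd) ≤ 1 := by
    refine ⟨min 0 (leftEnd + κ⁻¹), lt_min leftEnd_neg (by simpa using hκ), min_le_left _ _, ?_⟩
    have h1 : min 0 (leftEnd + κ⁻¹) - leftEnd ≤ κ⁻¹ := by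
      have := min_le_right 0 (leftEnd + κ⁻¹)
      linarith
    calc κ * _ ≤ κ * κ⁻¹ := mul_le_mul_of_nonneg_left h1 hκ.le
      _ = 1 := mul_inv_cancel₀ hκ.ne'
  have h1 : ∀ᵐ x ∂volume.restrict (Ioo leftEnd r), False := by
    filter_upwards [ae_restrict_of_ae_restrict_of_subset (Ioo_subset_Ioo_right hr0.1) h,
      ae_restrict_mem measurableSet_Ioo] with x hx hxr
    have h2 : 0 < κ * (x - leftEnd) := mul_pos hκ (sub_pos.2 hxr.1)
    have h3 : κ * (x - leftEnd) ≤ 1 :=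
      (mul_le_mul_of_nonneg_left (sub_le_sub_right hxr.2.le _) hκ.le).trans hr0.2
    exact (besselF_pos hs h2 h3).ne' (Complex.ofReal_eq_zero.1 hx)
  rw [ae_iff] at h1
  simp at h1
  linarith

/-! ### The eigenvalue sequence -/

lemma besselMode_zero (s κ : ℝ) : besselMode s κ 0 = besselF s (κ * (Real.pi * √2)) := by
  rw [besselMode, leftEnd, zero_sub, neg_neg]

/-- A nonzero eigenfunction for `(h κ)²` exists only if `f_s(κ π√2) = 0`. -/
lemma IsWeakEigenpair.besselMode_eq_zero {h κ : ℝ} (hh : 0 < h) (hκ : 0 < κ) {p : L2 × L2}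
    (hp : IsWeakEigenpair h ((h * κ) ^ 2 : ℝ) p) (h0 : p.1 ≠ 0) :
    besselMode (besselIndex h + 1 / 2) κ 0 = 0 := by
  obtain ⟨c, hc, hc0⟩ := hp.exists_eq_const_mul hh hκ
  rcases mul_eq_zero.1 hc0 with h1 | h1
  · refine absurd ((Lp.eq_zero_iff_ae_eq_zero).2 ?_) h0
    filter_upwards [ae_eq_primitive hp.1,
      ae_restrict_mem (measurableSet_Ioo : MeasurableSet I)] with x hx hxI
    rw [hx, hc x hxI, h1, zero_mul]
    rfl
  · exact Complex.ofReal_eq_zero.1 h1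

lemma mem_eigenspace_iff {h : ℝ} {μ : ℂ} (ψ : (operator h).domain) :
    ψ ∈ eigenspace (operator h) μ ↔ ∃ g : L2, IsWeakEigenpair h μ ((ψ : L2), g) := by
  have h1 : ψ ∈ eigenspace (operator h) μ ↔ operator h ψ = μ • (ψ : L2) := by
    rw [eigenspace, LinearMap.mem_ker, LinearMap.sub_apply, sub_eq_zero]
    rfl
  have h2 : operator h ψ = μ • (ψ : L2) ↔ ((ψ : L2), μ • (ψ : L2)) ∈ graph h := by
    rw [← operator_graph, ← LinearPMap.image_iff ψ.2, eq_comm]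
  rw [h1, h2]
  refine exists_congr fun g => and_congr_right fun _ => ?_
  simp only [inner_smul_right]

lemma IsWeakEigenpair.mem_domain {h : ℝ} {μ : ℂ} {p : L2 × L2} (hp : IsWeakEigenpair h μ p) :
    p.1 ∈ (operator h).domain := by
  refine LinearPMap.mem_domain_of_mem_graph (y := μ • p.1) ?_
  rw [operator_graph]
  exact ⟨p.2, hp.1, fun q hq => by rw [inner_smul_right]; exact hp.2 q hq⟩

/-- The eigenvalues are simple. -/
lemma rank_eigenspace_eq_one {h κ : ℝ} (hh : 0 < h) (hκ : 0 < κ)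
    (h0 : besselMode (besselIndex h + 1 / 2) κ 0 = 0) :
    Module.rank ℂ (eigenspace (operator h) ((h * κ) ^ 2 : ℝ)) = 1 := by
  obtain ⟨p, hp, hp1⟩ := exists_isWeakEigenpair hh hκ h0
  have hs1 := one_lt_besselIndex_add hh
  set v : eigenspace (operator h) ((h * κ) ^ 2 : ℝ) :=
    ⟨⟨p.1, hp.mem_domain⟩, (mem_eigenspace_iff _).2 ⟨p.2, hp⟩⟩ with hv
  refine rank_eq_one v (fun hv0 => ?_) fun w => ?_
  · have h1 : p.1 = 0 := congrArg (fun w : eigenspace (operator h) ((h * κ) ^ 2 : ℝ) =>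
      ((w : (operator h).domain) : L2)) hv0
    refine besselMode_ne_zero hs1 hκ ?_
    filter_upwards [hp1, (Lp.eq_zero_iff_ae_eq_zero).1 h1] with x h2 h3
    rw [← h2, h3]
    rfl
  · obtain ⟨g, hg⟩ := (mem_eigenspace_iff _).1 w.2
    obtain ⟨c, hc, -⟩ := hg.exists_eq_const_mul hh hκ
    refine ⟨c, Subtype.ext (Subtype.ext ?_)⟩
    change c • p.1 = ((w : (operator h).domain) : L2)
    refine Lp.ext ?_
    filter_upwards [Lp.coeFn_smul c p.1, hp1, ae_eq_primitive hg.1,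
      ae_restrict_mem (measurableSet_Ioo : MeasurableSet I)] with x h1 h2 h3 hxI
    rw [h1, Pi.smul_apply, h2, h3, hc x hxI, smul_eq_mul]

/-- The eigenvalues are the numbers `(h ρ / (π√2))²`, for the positive zeros `ρ` of `f_s`. -/
lemma isEigenvalueSequence_operator {h : ℝ} (hh : 0 < h) {ρ : ℕ → ℝ}
    (hρ : IsBesselZeroSequence (besselIndex h + 1 / 2) ρ) :
    IsEigenvalueSequence (operator h) fun n => (h * ρ n / (Real.pi * √2)) ^ 2 := by
  have hL : 0 < Real.pi * √2 := by positivity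
  have hmono : StrictMono fun n => (h * ρ n / (Real.pi * √2)) ^ 2 := fun m n hmn => by
    have h1 := hρ.1 hmn
    have h2 := hρ.pos m
    simp only
    gcongr
  have hκ : ∀ n, 0 < ρ n / (Real.pi * √2) := fun n => div_pos (hρ.pos n) hL
  have hlam : ∀ n, (h * ρ n / (Real.pi * √2)) ^ 2 = (h * (ρ n / (Real.pi * √2))) ^ 2 := fun n => by
    rw [mul_div_assoc]
  refine ⟨hmono.monotone, fun μ => ?_⟩
  by_cases hμ : ∃ n, (((h * ρ n / (Real.pi * √2)) ^ 2 : ℝ) : ℂ) = μ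
  · obtain ⟨n, rfl⟩ := hμ
    have h1 : {m : ℕ | (((h * ρ m / (Real.pi * √2)) ^ 2 : ℝ) : ℂ) =
        (((h * ρ n / (Real.pi * √2)) ^ 2 : ℝ) : ℂ)} = {n} := by
      ext m
      rw [mem_ofPred_eq, mem_singleton_iff, Complex.ofReal_inj]
      exact hmono.injective.eq_iff
    rw [h1, encard_singleton, hlam, rank_eigenspace_eq_one hh (hκ n), map_one]
    rw [besselMode_zero, div_mul_cancel₀ _ hL.ne']
    exact hρ.zero n
  · have h1 : {m : ℕ | (((h * ρ m / (Real.pi * √2)) ^ 2 : ℝ) : ℂ) = μ} = ∅ :=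
      eq_empty_of_forall_notMem fun m hm => hμ ⟨m, hm⟩
    have h2 : eigenspace (operator h) μ = ⊥ := by
      refine (Submodule.eq_bot_iff _).2 fun ψ hψ => ?_
      by_contra hne
      obtain ⟨g, hg⟩ := (mem_eigenspace_iff _).1 hψ
      have hψ0 : (ψ : L2) ≠ 0 := fun h0 => hne (Subtype.ext h0)
      obtain ⟨lam, hlam0, rfl⟩ := hg.exists_pos hh hψ0
      have hκ0 : 0 < √lam / h := div_pos (Real.sqrt_pos.2 hlam0) hh
      have hlam2 : lam = (h * (√lam / h)) ^ 2 := by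
        rw [mul_div_cancel₀ _ hh.ne', Real.sq_sqrt hlam0.le]
      rw [hlam2] at hg
      have h3 := hg.besselMode_eq_zero hh hκ0 hψ0
      rw [besselMode_zero] at h3
      have h4 : √lam / h * (Real.pi * √2) ∈ range ρ := by
        rw [hρ.2]
        exact ⟨mul_pos hκ0 hL, h3⟩
      obtain ⟨n, hn⟩ := h4
      refine hμ ⟨n, ?_⟩
      rw [hlam, hn, mul_div_cancel_right₀ _ hL.ne', ← hlam2]
    rw [h1, h2, encard_empty, rank_bot, map_zero]

end

end BornOppenheimer

theorem theorem4p1 :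
    ∃ (lam : ℝ → ℕ → ℝ) (z : ℕ → ℝ) (β : ℕ → ℕ → ℝ),
      (∀ h : ℝ, 0 < h →
        BornOppenheimer.IsEigenvalueSequence (BornOppenheimer.operator h) (lam h)) ∧
      BornOppenheimer.IsAiryZeroSequence z ∧
      ∀ n : ℕ,
        β 0 n = 1 / 8 ∧
        β 1 n = (4 * Real.pi * √2) ^ (-(2 / 3) : ℝ) * z n ∧
        ∀ J : ℕ, ∃ C h₀ : ℝ, 0 < h₀ ∧ ∀ h : ℝ, 0 < h → h < h₀ →
          |lam h n - ∑ j ∈ Finset.range (J + 1), β j n * h ^ (2 * (j : ℝ) / 3)|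
            ≤ C * h ^ (2 * ((J : ℝ) + 1) / 3) := by
  obtain ⟨z, hz⟩ := BornOppenheimer.exists_isAiryZeroSequence
  have hex : ∀ h : ℝ, ∃ ρ : ℕ → ℝ, 0 < h →
      BornOppenheimer.IsBesselZeroSequence (BornOppenheimer.besselIndex h + 1 / 2) ρ := fun h => by
    by_cases hh : 0 < h
    · obtain ⟨ρ, hρ⟩ :=
        BornOppenheimer.exists_besselF_zeros (BornOppenheimer.one_lt_besselIndex_add hh)
      exact ⟨ρ, fun _ => hρ⟩
    · exact ⟨0, fun h0 => absurd h0 hh⟩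
  choose ρ hρ using hex
  choose β hβ using BornOppenheimer.exists_eigenvalue_expansion hz hρ
  exact ⟨fun h n => (h * ρ h n / (Real.pi * √2)) ^ 2, z, fun j n => β n j,
    fun h hh => BornOppenheimer.isEigenvalueSequence_operator hh (hρ h hh), hz, hβ⟩
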